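/- Let $m,t,d$ be positive integers with $t\mid m$ and $d\ge 2$, and let $G=G(m,t,d)$ be the finite group of linear maps $(z_1,\dots,z_d)\mapsto(e^{2\pi i\nu_1/m}z_{\sigma(1)},\dots,e^{2\pi i\nu_d/m}z_{\sigma(d)})$ of $\mathbb C^d$, where $\sigma$ is a permutation and $\nu_1,\dots,\nu_d$ are integers with $t\mid\nu_1+\cdots+\nu_d$. Let $\theta=(\theta_1,\dots,\theta_d)$ with $\theta_i(z)=E_i(z_1^m,\dots,z_d^m)$ for $1\le i\le d-1$ ($E_i$ the $i$-th elementary symmetric polynomial) and $\theta_d(z)=(z_1\cdots z_d)^{m/t}$. Let $\mathcal A(\theta(\mathbb D^d))$ be the algebra, with the supremum norm, of continuous functions on $\overline{\theta(\mathbb D^d)}$ that are holomorphic on $\theta(\mathbb D^d)$. Let $\rho:G\to\mathbb C^\times$ be a one-dimensional representation, and let $\ell_\rho\neq0$ be a homogeneous polynomial with $\ell_\rho(\sigma z)=\rho(\sigma)\ell_\rho(z)$ for $\sigma\in G$ such that every polynomial $f$ with $f(\sigma z)=\rho(\sigma)f(z)$ for all $\sigma\in G$ is $\ell_\rho$ times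 a $G$-invariant polynomial (it exists and is unique up to a scalar). The Hardy space $H^2_\rho(\theta(\mathbb D^d))$ consists of the holomorphic $f$ on $\theta(\mathbb D^d)$ with $\ell_\rho\cdot(f\circ\theta)\in H^2(\mathbb D^d)$; through the radial limits $f^*(\theta(\zeta))=\lim_{r\to1-}f(\theta(r\zeta))$ it is identified with a closed subspace of $L^2(\theta(\mathbb T^d),\mu_{\rho,\theta})$, where $\int f\,d\mu_{\rho,\theta}=\frac1{|G|}\int_{\mathbb T^d}(f\circ\theta)|\ell_\rho|^2\,d\nu$ and $\nu$ is the normalized Haar measure of $\mathbb T^d$. It is a module over $\mathcal A(\theta(\mathbb D^d))$ by multiplication. A Hilbert module over $\mathcal A=\mathcal A(\theta(\mathbb D^d))$ is a Hilbert space that is an $\mathcal A$-module with jointly continuous action; it is contractive if $\|a\cdot h\|\le\|a\|\|h\|$ for all $a,h$, and cramped if there is a bounded invertible module map from it onto a contractive Hilbert module. Let $\mathfrak H$ (respectively $\mathfrak C$) be the category of all (respectively all cramped) Hilbert modules over $\mathcal A$ and bounded module maps. An object $P$ of either category is projective if every short exact sequence $0\to H\to K\to P\to0$ in that category splits, and $\operatorname{Ext}(K,H)$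 in either category is the group of equivalence classes of short exact sequences $0\to H\to J\to K\to0$ in it, whose zero is the class of the direct sum sequence. Then $H^2_\rho(\theta(\mathbb D^d))$ is not projective in $\mathfrak H$, nor is it projective in $\mathfrak C$. Moreover $\operatorname{Ext}_{\mathfrak H}(H^2_\rho(\theta(\mathbb D^d)),H^2_\rho(\theta(\mathbb D^d)))\ne0$ and $\operatorname{Ext}_{\mathfrak C}(H^2_\rho(\theta(\mathbb D^d)),H^2_\rho(\theta(\mathbb D^d)))\ne0$. -/

import Mathlib

namespace QuotientHardy

/-- A Hilbert module over a commutative complex Banach (or normed) algebra `A`: a Hilbert space that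
is an `A`-module, compatibly with its complex scalars, such that `(a, h) ↦ a • h` is jointly
continuous. -/
structure HilbertModule (A : Type) [NormedCommRing A] [NormedAlgebra ℂ A] where
  carrier : Type
  [normedAddCommGroup : NormedAddCommGroup carrier]
  [innerProductSpace : InnerProductSpace ℂ carrier]
  [completeSpace : CompleteSpace carrier]
  [module : Module A carrier]
  [isScalarTower : IsScalarTower ℂ A carrier]
  [continuousSMul : ContinuousSMul A carrier]

namespace HilbertModule

variable {A : Type} [NormedCommRing A] [NormedAlgebra ℂ A]

instance : CoeSort (HilbertModule A) Type := ⟨HilbertModule.carrier⟩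

attribute [instance] normedAddCommGroup innerProductSpace completeSpace module isScalarTower
  continuousSMul

/-- The module action satisfies `‖a • h‖ ≤ ‖a‖ ‖h‖`. -/
def IsContractive (H : HilbertModule A) : Prop :=
  ∀ (a : A) (h : H), ‖a • h‖ ≤ ‖a‖ * ‖h‖

/-- Cramped: similar to a contractive Hilbert module, through a bounded invertible module map.
(A continuous `A`-linear map is the same thing as a bounded `ℂ`-linear module map.) -/
def IsCramped (H : HilbertModule A) : Prop :=
  ∃ K : HilbertModule A, K.IsContractive ∧ Nonempty (H ≃L[A] K)

theorem IsContractive.isCramped {H : HilbertModule A} (h : H.IsContractive) : H.IsCramped :=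
  ⟨H, h, ⟨ContinuousLinearEquiv.refl A H⟩⟩

/-- The Hilbert space direct sum with the diagonal action. -/
noncomputable def prod (H K : HilbertModule A) : HilbertModule A where
  carrier := WithLp 2 (H × K)
  continuousSMul := by
    refine ⟨?_⟩
    have h : Continuous fun q : A × WithLp 2 (H × K) =>
        WithLp.toLp 2 (q.1 • (WithLp.ofLp q.2).1, q.1 • (WithLp.ofLp q.2).2) := by
      have := WithLp.prod_continuous_ofLp 2 H K
      refine (WithLp.prod_continuous_toLp 2 H K).comp ?_
      fun_prop
    exact h

/-- The inclusion `h ↦ (h, 0)`. -/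
noncomputable def inl (H K : HilbertModule A) : H →L[A] prod H K where
  toFun h := WithLp.toLp 2 (h, 0)
  map_add' x y := by
    apply WithLp.ofLp_injective 2
    exact Prod.ext rfl (add_zero _).symm
  map_smul' a x := by
    apply WithLp.ofLp_injective 2
    exact Prod.ext rfl (smul_zero _).symm
  cont := (WithLp.prod_continuous_toLp 2 H K).comp (by fun_prop)

/-- The projection `(h, k) ↦ k`. -/
noncomputable def snd (H K : HilbertModule A) : prod H K →L[A] K where
  toFun x := (WithLp.ofLp x).2
  map_add' _ _ := rfl
  map_smul' _ _ := rfl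
  cont := continuous_snd.comp (WithLp.prod_continuous_ofLp 2 H K)

theorem IsContractive.prod {H K : HilbertModule A} (hH : H.IsContractive)
    (hK : K.IsContractive) : (H.prod K).IsContractive := by
  intro a x
  change WithLp 2 (H × K) at x
  change ‖(a • x : WithLp 2 (H × K))‖ ≤ ‖a‖ * ‖x‖
  have h1 := hH a x.fst
  have h2 := hK a x.snd
  refine abs_le_of_sq_le_sq' ?_ (by positivity) |>.2
  rw [mul_pow, WithLp.prod_norm_sq_eq_of_L2, WithLp.prod_norm_sq_eq_of_L2, mul_add, ← mul_pow,
    ← mul_pow]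
  exact add_le_add (pow_le_pow_left₀ (norm_nonneg _) h1 2) (pow_le_pow_left₀ (norm_nonneg _) h2 2)

theorem IsCramped.prod {H K : HilbertModule A} (hH : H.IsCramped) (hK : K.IsCramped) :
    (H.prod K).IsCramped := by
  obtain ⟨H', hH', ⟨e⟩⟩ := hH
  obtain ⟨K', hK', ⟨f⟩⟩ := hK
  refine ⟨H'.prod K', hH'.prod hK', ⟨?_⟩⟩
  refine
    { toFun := fun x => WithLp.toLp 2 (e (WithLp.ofLp x).1, f (WithLp.ofLp x).2)
      invFun := fun x => WithLp.toLp 2 (e.symm (WithLp.ofLp x).1, f.symm (WithLp.ofLp x).2)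
      map_add' := fun x y => ?_
      map_smul' := fun a x => ?_
      left_inv := fun x => ?_
      right_inv := fun x => ?_
      continuous_toFun := ?_
      continuous_invFun := ?_ }
  · apply WithLp.ofLp_injective 2
    exact Prod.ext (map_add e _ _) (map_add f _ _)
  · apply WithLp.ofLp_injective 2
    exact Prod.ext (map_smul e _ _) (map_smul f _ _)
  · apply WithLp.ofLp_injective 2
    exact Prod.ext (e.symm_apply_apply _) (f.symm_apply_apply _)
  · apply WithLp.ofLp_injective 2
    exact Prod.ext (e.apply_symm_apply _) (f.apply_symm_apply _)
  · have := WithLp.prod_continuous_ofLp 2 H K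
    exact (WithLp.prod_continuous_toLp 2 H' K').comp
      ((e.continuous.comp (continuous_fst.comp this)).prodMk
        (f.continuous.comp (continuous_snd.comp this)))
  · have := WithLp.prod_continuous_ofLp 2 H' K'
    exact (WithLp.prod_continuous_toLp 2 H K).comp
      ((e.symm.continuous.comp (continuous_fst.comp this)).prodMk
        (f.symm.continuous.comp (continuous_snd.comp this)))

end HilbertModule

/-- The two categories of Hilbert modules: all of them, and the cramped ones (both with all bounded
module maps as morphisms). -/
inductive Category
  | all
  | cramped

section Categories

variable {A : Type} [NormedCommRing A] [NormedAlgebra ℂ A]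

/-- Membership of a Hilbert module in one of the two categories. -/
def Category.Mem : Category → HilbertModule A → Prop
  | .all, _ => True
  | .cramped, H => H.IsCramped

variable (A) in
/-- The objects of one of the two categories. -/
abbrev Category.Obj (C : Category) : Type 1 := {H : HilbertModule A // C.Mem H}

theorem Category.Mem.prod {C : Category} {H K : HilbertModule A} (hH : C.Mem H) (hK : C.Mem K) :
    C.Mem (H.prod K) := by
  cases C
  · trivial
  · exact HilbertModule.IsCramped.prod hH hK

/-- Short exact sequences `0 → H → J → K → 0` in one of the two categories. -/
structure Extension {C : Category} (K H : C.Obj A) where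
  J : C.Obj A
  α : H.1 →L[A] J.1
  β : J.1 →L[A] K.1
  injective : Function.Injective α
  exact : Function.Exact α β
  surjective : Function.Surjective β

namespace Extension

variable {C : Category} {K H : C.Obj A}

/-- The sequence splits: `β` has a right inverse among the bounded module maps. -/
def Splits (E : Extension K H) : Prop :=
  ∃ s : K.1 →L[A] E.J.1, E.β.comp s = ContinuousLinearMap.id A K.1

/-- Equivalence of short exact sequences: a module map of the middle terms that commutes with the
identities at both ends. -/
def Equivalent (E E' : Extension K H) : Prop :=
  ∃ γ : E.J.1 →L[A] E'.J.1, γ.comp E.α = E'.α ∧ E'.β.comp γ = E.β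

/-- The map of middle terms is bijective, and its inverse is bounded by the open mapping theorem. -/
theorem Equivalent.symm {E E' : Extension K H} (h : Equivalent E E') : Equivalent E' E := by
  obtain ⟨γ, h1, h2⟩ := h
  have h1' : ∀ x, γ (E.α x) = E'.α x := fun x => congrArg (fun T => T x) h1
  have h2' : ∀ x, E'.β (γ x) = E.β x := fun x => congrArg (fun T => T x) h2
  have hinj : Function.Injective γ := by
    refine (injective_iff_map_eq_zero γ).2 fun x hx => ?_
    have hb : E.β x = 0 := by rw [← h2', hx, map_zero]
    obtain ⟨y, rfl⟩ := (E.exact x).1 hb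
    rw [h1'] at hx
    rw [(injective_iff_map_eq_zero E'.α).1 E'.injective y hx, map_zero]
  have hsurj : Function.Surjective γ := by
    intro y
    obtain ⟨x, hx⟩ := E.surjective (E'.β y)
    have : E'.β (y - γ x) = 0 := by rw [map_sub, h2', hx, sub_self]
    obtain ⟨w, hw⟩ := (E'.exact _).1 this
    refine ⟨x + E.α w, ?_⟩
    rw [map_add, h1', hw]
    abel
  let γ₀ : E.J.1 →L[ℂ] E'.J.1 :=
    ⟨(γ : E.J.1 →ₗ[A] E'.J.1).restrictScalars ℂ, γ.continuous⟩
  have hopen : IsOpenMap γ₀ := γ₀.isOpenMap hsurj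
  let e : E.J.1 ≃ₗ[A] E'.J.1 := LinearEquiv.ofBijective (γ : E.J.1 →ₗ[A] E'.J.1) ⟨hinj, hsurj⟩
  have he : ∀ x, e.symm (γ x) = x := fun x => e.symm_apply_apply x
  have hcont : Continuous e.symm := by
    refine continuous_def.2 fun s hs => ?_
    have : e.symm ⁻¹' s = γ₀ '' s := by
      ext y
      constructor
      · intro hy
        exact ⟨e.symm y, hy, e.apply_symm_apply y⟩
      · rintro ⟨x, hx, rfl⟩
        change e.symm (γ x) ∈ s
        rwa [he]
    rw [this]
    exact hopen s hs
  refine ⟨⟨e.symm, hcont⟩, ?_, ?_⟩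
  · ext x
    change e.symm (E'.α x) = E.α x
    rw [← h1', he]
  · ext y
    obtain ⟨x, rfl⟩ := hsurj y
    change E.β (e.symm (γ x)) = E'.β (γ x)
    rw [he, h2']

instance setoid (K H : C.Obj A) : Setoid (Extension K H) where
  r := Equivalent
  iseqv :=
    { refl := fun _ => ⟨ContinuousLinearMap.id A _, rfl, rfl⟩
      symm := Equivalent.symm
      trans := by
        rintro E E' E'' ⟨γ, h1, h2⟩ ⟨γ', h1', h2'⟩
        refine ⟨γ'.comp γ, ?_, ?_⟩
        · rw [ContinuousLinearMap.comp_assoc, h1, h1']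
        · rw [← ContinuousLinearMap.comp_assoc, h2', h2] }

/-- The direct sum sequence `0 → H → H ⊕ K → K → 0`. -/
noncomputable def trivial (K H : C.Obj A) : Extension K H where
  J := ⟨H.1.prod K.1, H.2.prod K.2⟩
  α := HilbertModule.inl H.1 K.1
  β := HilbertModule.snd H.1 K.1
  injective x y hxy := congrArg (fun w : WithLp 2 (H.1 × K.1) => w.ofLp.1) hxy
  exact x := by
    constructor
    · intro hx
      exact ⟨(WithLp.ofLp x).1, (WithLp.ofLp_injective 2) (Prod.ext rfl hx.symm)⟩
    · rintro ⟨y, rfl⟩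
      rfl
  surjective y := ⟨WithLp.toLp 2 (0, y), rfl⟩

end Extension

/-- The (underlying pointed set of the) extension group `Ext_C(K, H)`: equivalence classes of short
exact sequences `0 → H → J → K → 0` in the category `C`. Its zero is the class of the direct
sum. -/
def Ext {C : Category} (K H : C.Obj A) : Type 1 := Quotient (Extension.setoid K H)

noncomputable instance {C : Category} (K H : C.Obj A) : Zero (Ext K H) :=
  ⟨Quotient.mk _ (Extension.trivial K H)⟩

/-- `P` is projective in the category `C`: every short exact sequence `0 → H → J → P → 0` in `C`
splits. -/
def IsProjective {C : Category} (P : C.Obj A) : Prop :=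
  ∀ (H : C.Obj A) (E : Extension P H), E.Splits

end Categories

/-! ### The group `G(m, t, d)` and the polynomials `ℓ_ρ` -/

section Group

open MvPolynomial

/-- `z ↦ (e^{2πi ν₁/m} z_{σ(1)}, …, e^{2πi ν_d/m} z_{σ(d)})`, as a condition on a linear map. -/
def IsMonomialMap (m d : ℕ) (σ : Equiv.Perm (Fin d)) (ν : Fin d → ℤ)
    (g : (Fin d → ℂ) ≃ₗ[ℂ] (Fin d → ℂ)) : Prop :=
  ∀ z i, g z i = Complex.exp (2 * Real.pi * Complex.I * ν i / m) * z (σ i)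

/-- The group `G(m, t, d)`, acting linearly on `ℂ^d`. -/
def G (m t d : ℕ) : Subgroup ((Fin d → ℂ) ≃ₗ[ℂ] (Fin d → ℂ)) where
  carrier := {g | ∃ (σ : Equiv.Perm (Fin d)) (ν : Fin d → ℤ),
    (t : ℤ) ∣ ∑ i, ν i ∧ IsMonomialMap m d σ ν g}
  one_mem' := ⟨1, 0, by simp, fun z i => by simp⟩
  mul_mem' := by
    rintro g h ⟨σ, ν, hν, hg⟩ ⟨τ, κ, hκ, hh⟩
    refine ⟨τ * σ, fun i => ν i + κ (σ i), ?_, fun z i => ?_⟩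
    · rw [Finset.sum_add_distrib, Equiv.sum_comp σ κ]
      exact dvd_add hν hκ
    · rw [LinearEquiv.mul_apply, hg, hh, ← mul_assoc, ← Complex.exp_add, Equiv.Perm.mul_apply]
      congr 2
      push_cast
      ring
  inv_mem' := by
    rintro g ⟨σ, ν, hν, hg⟩
    refine ⟨σ⁻¹, fun i => - ν (σ⁻¹ i), ?_, fun z i => ?_⟩
    · rw [Finset.sum_neg_distrib, Equiv.sum_comp σ⁻¹ ν]
      exact (dvd_neg).2 hν
    · have h1 : g (g⁻¹ z) (σ⁻¹ i) = z (σ⁻¹ i) := by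
        rw [← LinearEquiv.mul_apply, mul_inv_cancel]; rfl
      rw [hg, show σ (σ⁻¹ i) = i from σ.apply_symm_apply i] at h1
      rw [← h1, ← mul_assoc, ← Complex.exp_add]
      have : (2 * Real.pi * Complex.I * ((-ν (σ⁻¹ i) : ℤ) : ℂ) / m +
        2 * Real.pi * Complex.I * (ν (σ⁻¹ i)) / m : ℂ) = 0 := by push_cast; ring
      rw [this, Complex.exp_zero, one_mul]

variable {m t d : ℕ}

/-- The polynomials in `R_ρ^G(ℂ[z])`: `f(σ z) = ρ(σ) f(z)` for all `σ ∈ G`. One-dimensional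
representations are the homomorphisms into `ℂˣ`. -/
def IsSemiInvariant (ρ : G m t d →* ℂˣ) (f : MvPolynomial (Fin d) ℂ) : Prop :=
  ∀ (g : G m t d) (z : Fin d → ℂ), eval (g.1 z) f = ρ g * eval z f

/-- `ℓ` is a (choice of the) homogeneous polynomial `ℓ_ρ`: the `ρ`-semi-invariant polynomials are
exactly the products of `ℓ` with `G`-invariant polynomials. It is unique up to a nonzero scalar. -/
structure IsSemiInvariantGenerator (ρ : G m t d →* ℂˣ) (ℓ : MvPolynomial (Fin d) ℂ) : Prop where
  ne_zero : ℓ ≠ 0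
  homogeneous : ∃ n, ℓ.IsHomogeneous n
  semiInvariant : IsSemiInvariant ρ ℓ
  generates : ∀ f, IsSemiInvariant ρ f → ∃ f', IsSemiInvariant (1 : G m t d →* ℂˣ) f' ∧ f = ℓ * f'

/-! Existence of `ℓ_ρ` (so that the notion above is never vacuous). -/

theorem finite_G (hm : 0 < m) : Finite (G m t d) := by
  have hm' : (m : ℂ) ≠ 0 := by exact_mod_cast hm.ne'
  have hmZ : (0 : ℤ) < m := by exact_mod_cast hm
  have hG : ∀ g : G m t d, ∃ (σ : Equiv.Perm (Fin d)) (ν : Fin d → ℤ),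
    (t : ℤ) ∣ ∑ i, ν i ∧ IsMonomialMap m d σ ν g.1 := fun g => g.2
  choose σ ν _ hg using hG
  let F : G m t d → Equiv.Perm (Fin d) × (Fin d → Fin m) := fun g =>
    (σ g, fun i => ⟨(ν g i % m).toNat, by
      have := Int.emod_lt_of_pos (ν g i) hmZ
      have := Int.emod_nonneg (ν g i) hmZ.ne'
      omega⟩)
  refine Finite.of_injective F fun g h hgh => ?_
  have h1 : σ g = σ h := congrArg Prod.fst hgh
  have h2 := congrArg Prod.snd hgh
  apply Subtype.ext
  refine LinearEquiv.ext fun z => funext fun i => ?_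
  rw [hg g z i, hg h z i, h1]
  congr 1
  have h3 : (ν g i % m).toNat = (ν h i % m).toNat := congrArg Fin.val (congrFun h2 i)
  generalize ν g i = a at *
  generalize ν h i = b at *
  have h4 : a % m = b % m := by
    have := Int.emod_nonneg a hmZ.ne'
    have := Int.emod_nonneg b hmZ.ne'
    omega
  obtain ⟨c, hc⟩ : (m : ℤ) ∣ a - b := Int.ModEq.dvd (show b ≡ a [ZMOD m] from h4.symm)
  rw [Complex.exp_eq_exp_iff_exists_int]
  refine ⟨c, ?_⟩
  have h5 : (a : ℂ) = b + m * c := by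
    have : a = b + m * c := by linarith
    rw [this]
    push_cast
    rfl
  rw [h5]
  field_simp

/-- Substitution of a linear map in a polynomial. -/
noncomputable def substPoly (g : (Fin d → ℂ) →ₗ[ℂ] (Fin d → ℂ)) :
    MvPolynomial (Fin d) ℂ →ₐ[ℂ] MvPolynomial (Fin d) ℂ :=
  aeval fun i => ∑ j, C (g (Pi.single j 1) i) * X j

theorem eval_substPoly (g : (Fin d → ℂ) →ₗ[ℂ] (Fin d → ℂ)) (z : Fin d → ℂ)
    (f : MvPolynomial (Fin d) ℂ) : eval z (substPoly g f) = eval (g z) f := by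
  have hz : g z = fun i => ∑ j, g (Pi.single j 1) i * z j := by
    conv_lhs => rw [← Finset.univ_sum_single z]
    ext i
    rw [map_sum, Finset.sum_apply]
    refine Finset.sum_congr rfl fun j _ => ?_
    have : (Pi.single j (z j) : Fin d → ℂ) = z j • Pi.single j 1 := by
      rw [← Pi.single_smul, smul_eq_mul, mul_one]
    rw [this, map_smul, Pi.smul_apply, smul_eq_mul, mul_comm]
  rw [hz]
  have : (aeval z : MvPolynomial (Fin d) ℂ →ₐ[ℂ] ℂ).comp (substPoly g) =
      aeval fun i => ∑ j, g (Pi.single j 1) i * z j := by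
    ext i
    simp [substPoly]
  have := congrArg (fun T => T f) this
  simpa [aeval_eq_eval] using this

theorem totalDegree_substPoly_le (g : (Fin d → ℂ) →ₗ[ℂ] (Fin d → ℂ)) (f : MvPolynomial (Fin d) ℂ) :
    (substPoly g f).totalDegree ≤ f.totalDegree := by
  rw [substPoly, aeval_def, eval₂_eq]
  refine totalDegree_finsetSum_le fun s hs => ?_
  refine (totalDegree_mul _ _).trans ?_
  have h1 : (algebraMap ℂ (MvPolynomial (Fin d) ℂ) (coeff s f)).totalDegree = 0 := totalDegree_C _
  rw [h1, zero_add]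
  refine (totalDegree_finsetProd _ _).trans ?_
  refine le_trans (Finset.sum_le_sum (g := fun i => s i) fun i _ => ?_) ?_
  · refine (totalDegree_pow _ _).trans ?_
    have : (∑ j, C (g (Pi.single j 1) i) * X j : MvPolynomial (Fin d) ℂ).totalDegree ≤ 1 := by
      refine totalDegree_finsetSum_le fun j _ => ?_
      refine (totalDegree_mul _ _).trans ?_
      rw [totalDegree_C, totalDegree_X]
    nlinarith
  · exact le_totalDegree hs

/-- A nonzero semi-invariant exists: the substitutions by distinct group elements are linearly
independent characters. -/
theorem exists_semiInvariant (hm : 0 < m) (ρ : G m t d →* ℂˣ) :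
    ∃ f, f ≠ 0 ∧ IsSemiInvariant ρ f := by
  have := finite_G (t := t) (d := d) hm
  have := Fintype.ofFinite (G m t d)
  by_contra! hcon
  let φ : G m t d → (MvPolynomial (Fin d) ℂ →* MvPolynomial (Fin d) ℂ) := fun g =>
    ((substPoly (g.1 : (Fin d → ℂ) →ₗ[ℂ] (Fin d → ℂ)) : MvPolynomial (Fin d) ℂ →ₐ[ℂ] _) :
      MvPolynomial (Fin d) ℂ →* MvPolynomial (Fin d) ℂ)
  have hφ : ∀ g f z, eval z (φ g f) = eval (g.1 z) f := fun g f z => eval_substPoly _ _ _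
  have hinj : Function.Injective φ := by
    intro g h hgh
    apply Subtype.ext
    refine LinearEquiv.ext fun z => funext fun i => ?_
    have h1 := hφ g (X i) z
    rw [hgh, hφ] at h1
    simpa using h1.symm
  have hli := (linearIndependent_monoidHom (MvPolynomial (Fin d) ℂ) (MvPolynomial (Fin d) ℂ)).comp
    φ hinj
  rw [Fintype.linearIndependent_iff] at hli
  have hz := hli (fun g => C ((ρ g : ℂ)⁻¹)) ?_ 1
  · simp at hz
  ext1 f
  simp only [Finset.sum_apply, Pi.smul_apply, Function.comp_apply, Pi.zero_apply, smul_eq_mul]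
  by_contra hne
  refine hcon _ hne fun g z => ?_
  simp only [map_sum, map_mul, eval_C, hφ]
  rw [Finset.mul_sum]
  refine Fintype.sum_equiv (Equiv.mulRight g) _ _ fun h => ?_
  simp only [Equiv.coe_mulRight, map_mul, Units.val_mul, Subgroup.coe_mul, LinearEquiv.mul_apply]
  have := (ρ g).ne_zero
  field_simp

/-- If a polynomial vanishes on the hyperplane `z_i = w z_j`, then `X_i - w X_j` divides it. -/
theorem linear_dvd (i j : Fin d) (hij : i ≠ j) (w : ℂ) (f : MvPolynomial (Fin d) ℂ)
    (hf : ∀ z : Fin d → ℂ, z i = w * z j → eval z f = 0) : X i - C w * X j ∣ f := by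
  classical
  let φ : MvPolynomial (Fin d) ℂ →ₐ[ℂ] MvPolynomial (Fin d) ℂ :=
    aeval fun k => if k = i then C w * X j else X k
  let q := Ideal.Quotient.mkₐ ℂ (Ideal.span {(X i - C w * X j : MvPolynomial (Fin d) ℂ)})
  have h1 : q.comp φ = q := by
    ext k
    simp only [AlgHom.comp_apply, φ, aeval_X]
    split_ifs with hk
    · subst hk
      refine (Ideal.Quotient.eq.2 ?_).symm
      exact Ideal.subset_span rfl
    · rfl
  have h2 : φ f = 0 := by
    refine MvPolynomial.funext fun z => ?_
    have h3 : (aeval z : MvPolynomial (Fin d) ℂ →ₐ[ℂ] ℂ).comp φ =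
        aeval (fun k => if k = i then w * z j else z k) := by
      ext k
      simp only [AlgHom.comp_apply, φ, aeval_X]
      split_ifs <;> simp
    have h4 := congrArg (fun T => T f) h3
    simp only [AlgHom.comp_apply, aeval_eq_eval] at h4
    rw [map_zero]
    refine h4.trans (hf _ ?_)
    simp [hij.symm]
  have h5 : q f = 0 := by rw [← h1, AlgHom.comp_apply, h2, map_zero]
  exact Ideal.mem_span_singleton.1 (Ideal.Quotient.eq_zero_iff_mem.1 h5)

/-- The element of `G(m, t, d)` with given permutation and exponents. -/
noncomputable def mkG (m t d : ℕ) (σ : Equiv.Perm (Fin d)) (ν : Fin d → ℤ)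
    (h : (t : ℤ) ∣ ∑ i, ν i) : G m t d :=
  ⟨{ toFun := fun z i => Complex.exp (2 * Real.pi * Complex.I * ν i / m) * z (σ i)
     invFun := fun z k => Complex.exp (-(2 * Real.pi * Complex.I * ν (σ.symm k) / m)) * z (σ.symm k)
     map_add' := fun x y => by ext i; simp [mul_add]
     map_smul' := fun c x => by ext i; simp [mul_left_comm]
     left_inv := fun x => by
       ext i
       simp only [Equiv.apply_symm_apply]
       rw [← mul_assoc, ← Complex.exp_add, neg_add_cancel, Complex.exp_zero, one_mul]
     right_inv := fun x => by
       ext i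
       simp only [Equiv.symm_apply_apply]
       rw [← mul_assoc, ← Complex.exp_add, add_neg_cancel, Complex.exp_zero, one_mul] },
    σ, ν, h, fun _ _ => rfl⟩

theorem eq_mkG (g : G m t d) : ∃ σ ν h, g = mkG m t d σ ν h := by
  obtain ⟨σ, ν, h, hg⟩ := g.2
  exact ⟨σ, ν, h, Subtype.ext (LinearEquiv.ext fun z => funext fun i => hg z i)⟩

/-- Every element of `G(m, t, d)` is a product of elements that fix a hyperplane `z_i = w z_j`
pointwise. -/
theorem reflection_induction (hd : 2 ≤ d) (p : G m t d → Prop)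
    (hmul : ∀ g h, p g → p h → p (g * h)) (hone : p 1)
    (hrefl : ∀ (g : G m t d) (i j : Fin d) (w : ℂ), i ≠ j →
      (∀ z : Fin d → ℂ, z i = w * z j → g.1 z = z) → p g) (g : G m t d) : p g := by
  classical
  let Q : Equiv.Perm (Fin d) → (Fin d → ℤ) → Prop := fun σ ν => ∃ h, p (mkG m t d σ ν h)
  have hQ1 : Q 1 0 := by
    refine ⟨by simp, ?_⟩
    have : mkG m t d 1 0 (by simp) = 1 :=
      Subtype.ext (LinearEquiv.ext fun z => funext fun i => by simp [mkG])
    rwa [this]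
  have hQmul : ∀ σ ν τ κ, Q σ ν → Q τ κ → Q (τ * σ) (ν + κ ∘ σ) := by
    rintro σ ν τ κ ⟨h, hp⟩ ⟨h', hp'⟩
    have hdvd : (t : ℤ) ∣ ∑ i, (ν + κ ∘ σ) i := by
      simp only [Pi.add_apply, Function.comp_apply]
      rw [Finset.sum_add_distrib, Equiv.sum_comp σ κ]
      exact dvd_add h h'
    refine ⟨hdvd, ?_⟩
    have : mkG m t d (τ * σ) (ν + κ ∘ σ) hdvd = mkG m t d σ ν h * mkG m t d τ κ h' := by
      refine Subtype.ext (LinearEquiv.ext fun z => funext fun i => ?_)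
      simp only [mkG, Subgroup.coe_mul, LinearEquiv.mul_apply, LinearEquiv.coe_mk,
        LinearMap.coe_mk, AddHom.coe_mk]
      rw [← mul_assoc, ← Complex.exp_add, Equiv.Perm.mul_apply]
      congr 2
      simp only [Pi.add_apply, Function.comp_apply]
      push_cast
      ring
    rw [this]
    exact hmul _ _ hp hp'
  have hswap : ∀ (i j : Fin d) (k : ℤ), i ≠ j →
      Q (Equiv.swap i j) (Pi.single i k - Pi.single j k) := by
    intro i j k hij
    refine ⟨by simp [Finset.sum_sub_distrib], ?_⟩
    refine hrefl _ i j (Complex.exp (2 * Real.pi * Complex.I * k / m)) hij fun z hz => ?_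
    ext l
    simp only [mkG, LinearEquiv.coe_mk, LinearMap.coe_mk, AddHom.coe_mk]
    by_cases hli : l = i
    · subst hli
      simp [hij, hz]
    by_cases hlj : l = j
    · subst hlj
      simp only [Pi.sub_apply, Pi.single_eq_same, Pi.single_eq_of_ne hli, Equiv.swap_apply_right,
        hz, zero_sub]
      rw [← mul_assoc, ← Complex.exp_add]
      have : (2 * Real.pi * Complex.I * ((-k : ℤ) : ℂ) / m + 2 * Real.pi * Complex.I * k / m : ℂ)
        = 0 := by push_cast; ring
      rw [this, Complex.exp_zero, one_mul]
    · simp [hli, hlj, Equiv.swap_apply_of_ne_of_ne hli hlj]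
  have hperm : ∀ σ, Q σ 0 := by
    intro σ
    induction σ using Equiv.Perm.swap_induction_on with
    | one => exact hQ1
    | swap_mul f x y hxy ih =>
      have h1 := hswap x y 0 hxy
      have h2 := hQmul _ _ _ _ ih h1
      have h3 : (0 + (Pi.single x 0 - Pi.single y 0 : Fin d → ℤ) ∘ f : Fin d → ℤ) = 0 := by
        ext i
        simp
      rwa [h3] at h2
  have hdiff : ∀ (i j : Fin d) (k : ℤ), Q 1 (Pi.single i k - Pi.single j k) := by
    intro i j k
    by_cases hij : i = j
    · subst hij
      simpa using hQ1
    · simpa using hQmul _ _ _ _ (hswap i j k hij) (hperm (Equiv.swap i j))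
  have hadd : ∀ ν κ, Q 1 ν → Q 1 κ → Q 1 (ν + κ) := by
    intro ν κ h1 h2
    simpa using hQmul _ _ _ _ h1 h2
  let i₀ : Fin d := ⟨0, by omega⟩
  let i₁ : Fin d := ⟨1, by omega⟩
  have hi : i₀ ≠ i₁ := by simp [i₀, i₁]
  have hdiag : ∀ k : ℤ, (t : ℤ) ∣ k → Q 1 (Pi.single i₀ k) := by
    intro k hk
    refine ⟨by simpa using hk, ?_⟩
    refine hrefl _ i₀ i₁ 0 hi fun z hz => ?_
    ext l
    simp only [mkG, LinearEquiv.coe_mk, LinearMap.coe_mk, AddHom.coe_mk]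
    by_cases hl : l = i₀
    · subst hl
      simp [hz]
    · simp [hl]
  obtain ⟨σ, ν, h, rfl⟩ := eq_mkG g
  have hsum : ∀ s : Finset (Fin d), Q 1 (∑ i ∈ s, (Pi.single i (ν i) - Pi.single i₀ (ν i))) := by
    intro s
    induction s using Finset.induction_on with
    | empty => simpa using hQ1
    | insert a s ha ih =>
      rw [Finset.sum_insert ha]
      exact hadd _ _ (hdiff _ _ _) ih
  have hν : Q 1 ν := by
    have h1 := hadd _ _ (hsum Finset.univ) (hdiag _ h)
    have h2 : ∑ i, (Pi.single i (ν i) - Pi.single i₀ (ν i)) + Pi.single i₀ (∑ i, ν i) = ν := by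
      rw [Finset.sum_sub_distrib, Finset.univ_sum_single]
      have : (Pi.single i₀ (∑ i, ν i) : Fin d → ℤ) = ∑ i, Pi.single i₀ (ν i) :=
        map_sum (AddMonoidHom.single (fun _ : Fin d => ℤ) i₀) _ _
      rw [this, sub_add_cancel]
    rwa [h2] at h1
  have h3 : Q σ ν := by simpa using hQmul _ _ _ _ hν (hperm σ)
  exact h3.2

theorem exists_isSemiInvariantGenerator (hd : 2 ≤ d) (hm : 0 < m) (ρ : G m t d →* ℂˣ) :
    ∃ ℓ, IsSemiInvariantGenerator ρ ℓ := by
  classical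
  obtain ⟨f₀, hf₀, hf₀'⟩ := exists_semiInvariant hm ρ
  -- a common divisor of all semi-invariants of maximal degree
  let S : Set ℕ := {n | ∃ p : MvPolynomial (Fin d) ℂ,
    (∀ f, IsSemiInvariant ρ f → p ∣ f) ∧ p.totalDegree = n}
  have hdeg : ∀ p q : MvPolynomial (Fin d) ℂ, q ≠ 0 → p ∣ q → p.totalDegree ≤ q.totalDegree := by
    rintro p _ hq ⟨r, rfl⟩
    rw [totalDegree_mul_of_isDomain (left_ne_zero_of_mul hq) (right_ne_zero_of_mul hq)]
    omega
  have hSne : S.Nonempty := ⟨_, 1, fun f _ => one_dvd f, rfl⟩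
  have hSb : BddAbove S := ⟨f₀.totalDegree, by
    rintro _ ⟨p, hp, rfl⟩
    exact hdeg _ _ hf₀ (hp f₀ hf₀')⟩
  obtain ⟨ℓ, hℓ, hℓS⟩ := Nat.sSup_mem hSne hSb
  have hmax : ∀ p : MvPolynomial (Fin d) ℂ, (∀ f, IsSemiInvariant ρ f → p ∣ f) →
      p.totalDegree ≤ ℓ.totalDegree := fun p hp => hℓS ▸ le_csSup hSb ⟨p, hp, rfl⟩
  have hℓ0 : ℓ ≠ 0 := by
    rintro rfl
    exact hf₀ (zero_dvd_iff.1 (hℓ f₀ hf₀'))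
  have hconst : ∀ p : MvPolynomial (Fin d) ℂ, ℓ ∣ p → p ≠ 0 → p.totalDegree ≤ ℓ.totalDegree →
      ∃ c : ℂ, c ≠ 0 ∧ p = C c * ℓ := by
    rintro _ ⟨r, rfl⟩ hp hle
    have hr := right_ne_zero_of_mul hp
    rw [totalDegree_mul_of_isDomain hℓ0 hr] at hle
    have : r.totalDegree = 0 := by omega
    rw [totalDegree_eq_zero_iff_eq_C] at this
    refine ⟨coeff 0 r, ?_, ?_⟩
    · intro h0
      rw [h0, map_zero] at this
      exact hr this
    · rw [← this, mul_comm]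
  -- uniqueness of a common divisor of maximal degree
  have huniq : ∀ p : MvPolynomial (Fin d) ℂ, (∀ f, IsSemiInvariant ρ f → p ∣ f) →
      ℓ.totalDegree ≤ p.totalDegree → ∃ c : ℂ, p = C c * ℓ := by
    intro p hp hle
    let _ : GCDMonoid (MvPolynomial (Fin d) ℂ) := UniqueFactorizationMonoid.toGCDMonoid _
    have hl : ∀ f, IsSemiInvariant ρ f → lcm ℓ p ∣ f := fun f hf => lcm_dvd (hℓ f hf) (hp f hf)
    have hl0 : lcm ℓ p ≠ 0 := by
      intro h0
      exact hf₀ (zero_dvd_iff.1 (h0 ▸ hl f₀ hf₀'))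
    obtain ⟨c, hc, hcl⟩ := hconst _ (dvd_lcm_left ℓ p) hl0 (hmax _ hl)
    have hpd : p ∣ ℓ := by
      have h1 : p ∣ C c * ℓ := hcl ▸ dvd_lcm_right ℓ p
      have h2 : ℓ = C c⁻¹ * (C c * ℓ) := by
        rw [← mul_assoc, ← C_mul, inv_mul_cancel₀ hc, C_1, one_mul]
      rw [h2]
      exact h1.mul_left _
    obtain ⟨r, hr⟩ := hpd
    have hr0 : r ≠ 0 := by
      rintro rfl
      exact hℓ0 (by simpa using hr)
    have hp0 : p ≠ 0 := by
      rintro rfl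
      exact hℓ0 (by simpa using hr)
    have h3 : r.totalDegree = 0 := by
      have := congrArg totalDegree hr
      rw [totalDegree_mul_of_isDomain hp0 hr0] at this
      omega
    rw [totalDegree_eq_zero_iff_eq_C] at h3
    have hc0 : coeff 0 r ≠ 0 := by
      intro h0
      rw [h0, map_zero] at h3
      exact hr0 h3
    refine ⟨(coeff 0 r)⁻¹, ?_⟩
    rw [hr, h3]
    have : (C (coeff 0 r)⁻¹ * (p * C (coeff 0 r)) : MvPolynomial (Fin d) ℂ) =
      p * C ((coeff 0 r)⁻¹ * coeff 0 r) := by rw [C_mul]; ring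
    rw [coeff_zero_C, this, inv_mul_cancel₀ hc0, C_1, mul_one]
  -- `ℓ` is relatively invariant under all linear maps that preserve the semi-invariants
  have hrel : ∀ g : (Fin d → ℂ) ≃ₗ[ℂ] (Fin d → ℂ),
      (∀ f, IsSemiInvariant ρ f →
        IsSemiInvariant ρ (substPoly (g.symm : (Fin d → ℂ) →ₗ[ℂ] (Fin d → ℂ)) f)) →
      ∃ c : ℂ, ∀ z, eval (g z) ℓ = c * eval z ℓ := by
    intro g hg
    have hinv : ∀ f, substPoly (g : (Fin d → ℂ) →ₗ[ℂ] (Fin d → ℂ))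
        (substPoly (g.symm : (Fin d → ℂ) →ₗ[ℂ] (Fin d → ℂ)) f) = f := by
      intro f
      refine MvPolynomial.funext fun z => ?_
      simp [eval_substPoly]
    have hinv' : ∀ f, substPoly (g.symm : (Fin d → ℂ) →ₗ[ℂ] (Fin d → ℂ))
        (substPoly (g : (Fin d → ℂ) →ₗ[ℂ] (Fin d → ℂ)) f) = f := by
      intro f
      refine MvPolynomial.funext fun z => ?_
      simp [eval_substPoly]
    obtain ⟨c, hc⟩ := huniq (substPoly (g : (Fin d → ℂ) →ₗ[ℂ] (Fin d → ℂ)) ℓ) (fun f hf => by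
      rw [← hinv f]
      exact map_dvd _ (hℓ _ (hg f hf))) (by
      conv_lhs => rw [← hinv' ℓ]
      exact totalDegree_substPoly_le _ _)
    refine ⟨c, fun z => ?_⟩
    have := congrArg (eval z) hc
    simpa [eval_substPoly] using this
  have hrelG : ∀ g : G m t d, ∃ c : ℂ, ∀ z, eval (g.1 z) ℓ = c * eval z ℓ := by
    intro g
    refine hrel g.1 fun f hf h z => ?_
    have e1 : ∀ z, (g.1.symm : (Fin d → ℂ) →ₗ[ℂ] (Fin d → ℂ)) z = (g⁻¹).1 z := fun z => rfl
    rw [eval_substPoly, eval_substPoly, e1, e1, hf, hf, hf]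
    ring
  have hsemi : IsSemiInvariant ρ ℓ := by
    intro g
    refine reflection_induction hd (fun g => ∀ z, eval (g.1 z) ℓ = ρ g * eval z ℓ)
      (fun g h hg hh z => ?_) (fun z => ?_) (fun g i j w hij hfix => ?_) g
    · simp only [Subgroup.coe_mul, LinearEquiv.mul_apply, map_mul, Units.val_mul]
      rw [hg, hh, mul_assoc]
    · simp
    · obtain ⟨c, hc⟩ := hrelG g
      by_contra hne
      have hcρ : c ≠ ρ g := fun h => hne (h ▸ hc)
      have hL0 : (X i - C w * X j : MvPolynomial (Fin d) ℂ) ≠ 0 := by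
        intro h0
        have := congrArg (eval (Pi.single i (1 : ℂ))) h0
        simp [hij.symm] at this
      have hdiv : ∀ f, IsSemiInvariant ρ f → ℓ * (X i - C w * X j) ∣ f := by
        intro f hf
        obtain ⟨f', rfl⟩ := hℓ f hf
        refine mul_dvd_mul_left ℓ (linear_dvd i j hij w f' fun z hz => ?_)
        -- the polynomial identity `c f'(g z) = ρ(g) f'(z)`
        have hid : C c * substPoly (g.1 : (Fin d → ℂ) →ₗ[ℂ] (Fin d → ℂ)) f' = C (ρ g : ℂ) * f' := by
          refine mul_left_cancel₀ hℓ0 (MvPolynomial.funext fun z => ?_)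
          have h1 := hf g z
          simp only [map_mul, eval_C, eval_substPoly] at h1 ⊢
          rw [hc] at h1
          simp only [LinearEquiv.coe_coe]
          linear_combination h1
        have h2 := congrArg (eval z) hid
        simp only [map_mul, eval_C, eval_substPoly, LinearEquiv.coe_coe] at h2
        rw [hfix z hz] at h2
        have h3 : (c - ρ g) * eval z f' = 0 := by linear_combination h2
        exact (mul_eq_zero.1 h3).resolve_left (sub_ne_zero.2 hcρ)
      have h4 := hmax _ hdiv
      rw [totalDegree_mul_of_isDomain hℓ0 hL0] at h4
      have h5 : (X i - C w * X j : MvPolynomial (Fin d) ℂ).totalDegree = 0 := by omega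
      rw [totalDegree_eq_zero_iff_eq_C] at h5
      have h6 := congrArg (eval (Pi.single i (1 : ℂ))) h5
      have h7 := congrArg (eval (0 : Fin d → ℂ)) h5
      rw [eval_C] at h6 h7
      rw [← h7] at h6
      simp [hij.symm] at h6
  refine ⟨ℓ, hℓ0, ?_, hsemi, fun f hf => ?_⟩
  · -- homogeneity, from the dilation by `2`
    let e := LinearEquiv.smulOfNeZero ℂ (Fin d → ℂ) (2 : ℂ) two_ne_zero
    obtain ⟨c, hc⟩ := hrel e (fun f hf g z => by
      rw [eval_substPoly, eval_substPoly, ← hf g]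
      congr 2
      apply e.injective
      have h1 : e (g.1 (e.symm z)) = g.1 (e (e.symm z)) := (map_smul g.1 (2 : ℂ) _).symm
      simp only [LinearEquiv.coe_coe]
      rw [h1, e.apply_symm_apply, e.apply_symm_apply])
    let q : MvPolynomial (Fin d) ℂ := ∑ s ∈ ℓ.support, monomial s (2 ^ s.degree * coeff s ℓ)
    have hq : q = C c * ℓ := by
      refine MvPolynomial.funext fun z => ?_
      rw [map_mul, eval_C, ← hc z, eval_eq (e z) ℓ, map_sum]
      refine Finset.sum_congr rfl fun s _ => ?_
      rw [eval_monomial, Finsupp.prod, show s.degree = ∑ i ∈ s.support, s i from rfl,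
        ← Finset.prod_pow_eq_pow_sum]
      have h2 : ∀ i, e z i = 2 * z i := fun i => rfl
      simp only [h2, mul_pow]
      rw [Finset.prod_mul_distrib]
      ring
    have hcoeff : ∀ s, coeff s ℓ ≠ 0 → (2 : ℂ) ^ s.degree = c := by
      intro s hs
      have h1 := congrArg (coeff s) hq
      rw [coeff_C_mul, coeff_sum] at h1
      simp only [coeff_monomial] at h1
      rw [Finset.sum_ite_eq' ℓ.support s, if_pos (mem_support_iff.2 hs)] at h1
      exact mul_right_cancel₀ hs h1
    obtain ⟨s₀, hs₀⟩ := ne_zero_iff.1 hℓ0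
    refine ⟨s₀.degree, fun s hs => ?_⟩
    have h1 := (hcoeff s hs).trans (hcoeff s₀ hs₀).symm
    have h2 : s.degree = s₀.degree := by
      have : (2 : ℕ) ^ s.degree = 2 ^ s₀.degree := by exact_mod_cast h1
      exact Nat.pow_right_injective le_rfl this
    rw [← h2, Finsupp.degree_eq_weight_one]
    rfl
  · obtain ⟨f', rfl⟩ := hℓ f hf
    refine ⟨f', fun g z => ?_, rfl⟩
    have hid : substPoly (g.1 : (Fin d → ℂ) →ₗ[ℂ] (Fin d → ℂ)) f' = f' := by
      refine mul_left_cancel₀ hℓ0 (MvPolynomial.funext fun z => ?_)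
      have h1 := hf g z
      simp only [map_mul, eval_substPoly, LinearEquiv.coe_coe] at h1 ⊢
      rw [hsemi g z] at h1
      refine mul_left_cancel₀ (ρ g).ne_zero ?_
      linear_combination h1
    have := congrArg (eval z) hid
    simpa [eval_substPoly] using this

end Group

open MeasureTheory Filter Topology
open scoped ENNReal NNReal

/-! ### The quotient domain and its function algebra -/

/-- The open unit polydisc. -/
def polydisc (d : ℕ) : Set (Fin d → ℂ) := {z | ∀ i, ‖z i‖ < 1}

/-- The basic polynomial map of `G(m, t, d)`: `θ_i(z) = E_i(z_1^m, …, z_d^m)` for `1 ≤ i ≤ d - 1`,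
with `E_i` the elementary symmetric polynomials, and `θ_d(z) = (z_1 ⋯ z_d)^{m/t}`. -/
noncomputable def theta (m t d : ℕ) (z : Fin d → ℂ) : Fin d → ℂ := fun i =>
  if (i : ℕ) + 1 = d then (∏ j, z j) ^ (m / t)
  else MvPolynomial.eval (fun j => z j ^ m) (MvPolynomial.esymm (Fin d) ℂ (i + 1))

theorem continuous_theta (m t d : ℕ) : Continuous (theta m t d) := by
  refine continuous_pi fun i => ?_
  unfold theta
  split_ifs
  · fun_prop
  · exact (MvPolynomial.continuous_eval _).comp (by fun_prop)

/-- The quotient domain `θ(𝔻^d)`. -/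
def quotientDomain (m t d : ℕ) : Set (Fin d → ℂ) := theta m t d '' polydisc d

theorem polydisc_subset (d : ℕ) : polydisc d ⊆ Metric.closedBall 0 1 := fun z hz => by
  rw [mem_closedBall_zero_iff]
  exact (pi_norm_le_iff_of_nonneg zero_le_one).2 fun i => (hz i).le

instance (m t d : ℕ) : CompactSpace (closure (quotientDomain m t d)) := by
  refine isCompact_iff_compactSpace.1 ?_
  have h : IsCompact (theta m t d '' Metric.closedBall 0 1) :=
    (isCompact_closedBall 0 1).image (continuous_theta m t d)
  exact h.of_isClosed_subset isClosed_closure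
    (closure_minimal (Set.image_mono (polydisc_subset d)) h.isClosed)

/-- The algebra `𝒜(θ(𝔻^d))` of continuous functions on the closure of `θ(𝔻^d)` that are holomorphic
on `θ(𝔻^d)`, with the supremum norm. -/
def algA (m t d : ℕ) : Subalgebra ℂ C(closure (quotientDomain m t d), ℂ) where
  carrier := {a | ∃ f : (Fin d → ℂ) → ℂ, DifferentiableOn ℂ f (quotientDomain m t d) ∧
    ∀ p : closure (quotientDomain m t d), p.1 ∈ quotientDomain m t d → a p = f p}
  mul_mem' := by
    rintro a b ⟨f, hf, haf⟩ ⟨g, hg, hbg⟩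
    exact ⟨f * g, hf.mul hg, fun p hp => by simp [haf p hp, hbg p hp]⟩
  add_mem' := by
    rintro a b ⟨f, hf, haf⟩ ⟨g, hg, hbg⟩
    exact ⟨f + g, hf.add hg, fun p hp => by simp [haf p hp, hbg p hp]⟩
  algebraMap_mem' c := ⟨fun _ => c, differentiableOn_const c, fun _ _ => rfl⟩

/-! ### The measure `μ_{ρ,θ}` and the Hardy space -/

/-- Normalized Haar measure of the torus, in angular coordinates. -/
noncomputable def haarTorus (d : ℕ) : Measure (UnitAddTorus (Fin d)) :=
  Measure.pi fun _ => AddCircle.haarAddCircle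

/-- The point `(e^{2πi x_1}, …, e^{2πi x_d})` of `𝕋^d ⊆ ℂ^d`. -/
noncomputable def torusPt {d : ℕ} (x : UnitAddTorus (Fin d)) : Fin d → ℂ :=
  fun i => (AddCircle.toCircle (x i) : ℂ)

theorem continuous_torusPt {d : ℕ} : Continuous (torusPt (d := d)) :=
  continuous_pi fun i =>
    continuous_subtype_val.comp (AddCircle.continuous_toCircle.comp (continuous_apply i))

theorem norm_torusPt {d : ℕ} (x : UnitAddTorus (Fin d)) (i : Fin d) : ‖torusPt x i‖ = 1 :=
  Circle.norm_coe _

theorem smul_torusPt_mem {d : ℕ} (x : UnitAddTorus (Fin d)) {r : ℝ} (h0 : 0 ≤ r) (h1 : r < 1) :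
    (r : ℂ) • torusPt x ∈ polydisc d := fun i => by
  simp [norm_torusPt, abs_of_nonneg h0, h1]

variable {d : ℕ}

/-- The Hardy space `H²(𝔻^d)`. -/
def IsHardy (g : (Fin d → ℂ) → ℂ) : Prop :=
  DifferentiableOn ℂ g (polydisc d) ∧
    (⨆ r ∈ Set.Ico (0 : ℝ) 1, ∫⁻ x, ‖g ((r : ℂ) • torusPt x)‖ₑ ^ 2 ∂haarTorus d) < ∞

/-- The measure `|ℓ|² dν` on the torus. -/
noncomputable def weightedTorus (ℓ : MvPolynomial (Fin d) ℂ) : Measure (UnitAddTorus (Fin d)) :=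
  (haarTorus d).withDensity fun x => ‖MvPolynomial.eval (torusPt x) ℓ‖ₑ ^ 2

/-- The measure `μ_{ρ,θ}`: the push-forward of `|G|⁻¹ |ℓ|² dν` under `θ`. It is carried by the Šilov
boundary `θ(𝕋^d)` of `θ(𝔻^d)`, and is regarded as a measure on `ℂ^d`. -/
noncomputable def mu (m t : ℕ) (ℓ : MvPolynomial (Fin d) ℂ) : Measure (Fin d → ℂ) :=
  (Nat.card (G m t d) : ℝ≥0∞)⁻¹ •
    Measure.map (fun x => theta m t d (torusPt x)) (weightedTorus ℓ)

/-- The holomorphic functions that make up `H²_ρ(θ(𝔻^d))`: `f` is holomorphic on `θ(𝔻^d)` and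
`ℓ · (f ∘ θ) ∈ H²(𝔻^d)`. (Only the values of `f` on `θ(𝔻^d)` matter.) -/
def IsQuotientHardy (m t : ℕ) (ℓ : MvPolynomial (Fin d) ℂ) (f : (Fin d → ℂ) → ℂ) : Prop :=
  DifferentiableOn ℂ f (quotientDomain m t d) ∧
    IsHardy fun z => MvPolynomial.eval z ℓ * f (theta m t d z)

/-- `F` is the radial limit of `f`: `F(θ(ζ)) = lim_{r → 1-} f(θ(r ζ))` almost everywhere. -/
def IsRadialLimit (m t : ℕ) (ℓ : MvPolynomial (Fin d) ℂ) (f F : (Fin d → ℂ) → ℂ) : Prop :=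
  ∀ᵐ x ∂weightedTorus ℓ, Tendsto (fun r : ℝ => f (theta m t d ((r : ℂ) • torusPt x))) (𝓝[<] 1)
    (𝓝 (F (theta m t d (torusPt x))))

theorem IsHardy.add {f g : (Fin d → ℂ) → ℂ} (hf : IsHardy f) (hg : IsHardy g) :
    IsHardy (fun z => f z + g z) := by
  refine ⟨hf.1.add hg.1, ?_⟩
  refine lt_of_le_of_lt (b := 2 * (⨆ r ∈ Set.Ico (0 : ℝ) 1,
      ∫⁻ x, ‖f ((r : ℂ) • torusPt x)‖ₑ ^ 2 ∂haarTorus d) + 2 * (⨆ r ∈ Set.Ico (0 : ℝ) 1,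
      ∫⁻ x, ‖g ((r : ℂ) • torusPt x)‖ₑ ^ 2 ∂haarTorus d)) ?_
    (ENNReal.add_lt_top.2 ⟨ENNReal.mul_lt_top (by simp) hf.2, ENNReal.mul_lt_top (by simp) hg.2⟩)
  refine iSup₂_le fun r hr => ?_
  have hcf : Continuous fun x : UnitAddTorus (Fin d) => f ((r : ℂ) • torusPt x) :=
    hf.1.continuousOn.comp_continuous ((continuous_const_smul (r : ℂ)).comp continuous_torusPt)
      fun x => smul_torusPt_mem x hr.1 hr.2
  have hcg : Continuous fun x : UnitAddTorus (Fin d) => g ((r : ℂ) • torusPt x) :=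
    hg.1.continuousOn.comp_continuous ((continuous_const_smul (r : ℂ)).comp continuous_torusPt)
      fun x => smul_torusPt_mem x hr.1 hr.2
  have hp : ∀ a b : ℂ, ‖a + b‖ₑ ^ 2 ≤ 2 * ‖a‖ₑ ^ 2 + 2 * ‖b‖ₑ ^ 2 := by
    intro a b
    simp only [enorm_eq_nnnorm]
    norm_cast
    have h1 : ‖a + b‖₊ ^ 2 ≤ (‖a‖₊ + ‖b‖₊) ^ 2 := by gcongr; exact nnnorm_add_le a b
    refine h1.trans ?_
    rw [← NNReal.coe_le_coe]
    push_cast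
    nlinarith [sq_nonneg (‖a‖ - ‖b‖)]
  calc ∫⁻ x, ‖f ((r : ℂ) • torusPt x) + g ((r : ℂ) • torusPt x)‖ₑ ^ 2 ∂haarTorus d
      ≤ ∫⁻ x, (2 * ‖f ((r : ℂ) • torusPt x)‖ₑ ^ 2 + 2 * ‖g ((r : ℂ) • torusPt x)‖ₑ ^ 2)
          ∂haarTorus d := lintegral_mono fun x => hp _ _
    _ = 2 * ∫⁻ x, ‖f ((r : ℂ) • torusPt x)‖ₑ ^ 2 ∂haarTorus d
        + 2 * ∫⁻ x, ‖g ((r : ℂ) • torusPt x)‖ₑ ^ 2 ∂haarTorus d := by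
      rw [lintegral_add_left ((hcf.measurable.enorm.pow_const 2).const_mul 2),
        lintegral_const_mul' _ _ (by simp),
        lintegral_const_mul' _ _ (by simp)]
    _ ≤ _ := by
      gcongr
      · exact le_iSup₂ (f := fun (r : ℝ) (_ : r ∈ Set.Ico (0 : ℝ) 1) =>
          ∫⁻ x, ‖f ((r : ℂ) • torusPt x)‖ₑ ^ 2 ∂haarTorus d) r hr
      · exact le_iSup₂ (f := fun (r : ℝ) (_ : r ∈ Set.Ico (0 : ℝ) 1) =>
          ∫⁻ x, ‖g ((r : ℂ) • torusPt x)‖ₑ ^ 2 ∂haarTorus d) r hr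

theorem IsHardy.bounded_mul {f g : (Fin d → ℂ) → ℂ} (hf : IsHardy f)
    (hg : DifferentiableOn ℂ g (polydisc d)) {c : ℝ≥0} (hc : ∀ z ∈ polydisc d, ‖g z‖ₑ ≤ c) :
    IsHardy (fun z => g z * f z) := by
  refine ⟨hg.mul hf.1, ?_⟩
  refine lt_of_le_of_lt (b := (c : ℝ≥0∞) ^ 2 * (⨆ r ∈ Set.Ico (0 : ℝ) 1,
      ∫⁻ x, ‖f ((r : ℂ) • torusPt x)‖ₑ ^ 2 ∂haarTorus d)) ?_
    (ENNReal.mul_lt_top (by simp) hf.2)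
  refine iSup₂_le fun r hr => ?_
  calc ∫⁻ x, ‖g ((r : ℂ) • torusPt x) * f ((r : ℂ) • torusPt x)‖ₑ ^ 2 ∂haarTorus d
      ≤ ∫⁻ x, (c : ℝ≥0∞) ^ 2 * ‖f ((r : ℂ) • torusPt x)‖ₑ ^ 2 ∂haarTorus d :=
        lintegral_mono fun x => by
          simp only [enorm_mul, mul_pow]
          gcongr
          exact hc _ (smul_torusPt_mem x hr.1 hr.2)
    _ = (c : ℝ≥0∞) ^ 2 * ∫⁻ x, ‖f ((r : ℂ) • torusPt x)‖ₑ ^ 2 ∂haarTorus d :=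
      lintegral_const_mul' _ _ (by simp)
    _ ≤ _ := by
      gcongr
      exact le_iSup₂ (f := fun (r : ℝ) (_ : r ∈ Set.Ico (0 : ℝ) 1) =>
        ∫⁻ x, ‖f ((r : ℂ) • torusPt x)‖ₑ ^ 2 ∂haarTorus d) r hr

variable (m t : ℕ) (ℓ : MvPolynomial (Fin d) ℂ)

theorem ae_weightedTorus_of_ae_mu {P : (Fin d → ℂ) → Prop} (h : ∀ᵐ p ∂mu m t ℓ, P p) :
    ∀ᵐ x ∂weightedTorus ℓ, P (theta m t d (torusPt x)) := by
  rw [mu, Measure.ae_ennreal_smul_measure_iff (by simp)] at h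
  exact ae_of_ae_map ((continuous_theta m t d).comp continuous_torusPt).measurable.aemeasurable h

theorem tendsto_theta (x : UnitAddTorus (Fin d)) :
    Tendsto (fun r : ℝ => theta m t d ((r : ℂ) • torusPt x)) (𝓝[<] 1)
      (𝓝 (theta m t d (torusPt x))) := by
  have h : Continuous fun r : ℝ => theta m t d ((r : ℂ) • torusPt x) :=
    (continuous_theta m t d).comp (Complex.continuous_ofReal.smul continuous_const)
  have h1 := (h.tendsto 1).mono_left (nhdsWithin_le_nhds (s := Set.Iio 1))
  simpa using h1

theorem eventually_mem (x : UnitAddTorus (Fin d)) :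
    ∀ᶠ r : ℝ in 𝓝[<] 1, theta m t d ((r : ℂ) • torusPt x) ∈ quotientDomain m t d := by
  filter_upwards [Ioo_mem_nhdsLT (zero_lt_one (α := ℝ))] with r hr
  exact ⟨_, smul_torusPt_mem x hr.1.le hr.2, rfl⟩

theorem theta_torusPt_mem (x : UnitAddTorus (Fin d)) :
    theta m t d (torusPt x) ∈ closure (quotientDomain m t d) :=
  mem_closure_of_tendsto (tendsto_theta m t x) (eventually_mem m t x)

theorem ae_mem_closure : ∀ᵐ p ∂mu m t ℓ, p ∈ closure (quotientDomain m t d) := by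
  refine Measure.ae_smul_measure ?_ _
  have h : Measurable fun x : UnitAddTorus (Fin d) => theta m t d (torusPt x) :=
    ((continuous_theta m t d).comp continuous_torusPt).measurable
  exact (ae_map_iff h.aemeasurable isClosed_closure.measurableSet).2
    (ae_of_all _ fun x => theta_torusPt_mem m t x)

/-- The radial limits in `L²(∂θ(𝔻^d), μ_{ρ,θ})` of the functions in `H²_ρ(θ(𝔻^d))`. -/
noncomputable def boundaryValues : Submodule ℂ (Lp ℂ 2 (mu m t ℓ)) where
  carrier := {F | ∃ f, IsQuotientHardy m t ℓ f ∧ IsRadialLimit m t ℓ f F}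
  add_mem' := by
    rintro F F' ⟨f, hf, hF⟩ ⟨f', hf', hF'⟩
    refine ⟨fun p => f p + f' p, ⟨hf.1.add hf'.1, ?_⟩, ?_⟩
    · simpa only [mul_add] using hf.2.add hf'.2
    · filter_upwards [hF, hF', ae_weightedTorus_of_ae_mu m t ℓ (Lp.coeFn_add F F')] with x h1 h2 h3
      rw [h3]
      exact h1.add h2
  zero_mem' := by
    refine ⟨fun _ => 0, ⟨differentiableOn_const _, ?_⟩, ?_⟩
    · simp only [mul_zero]
      exact ⟨differentiableOn_const _, by simp⟩
    · filter_upwards [ae_weightedTorus_of_ae_mu m t ℓ (Lp.coeFn_zero ℂ 2 (mu m t ℓ))] with x h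
      rw [h]
      exact tendsto_const_nhds
  smul_mem' := by
    rintro c F ⟨f, hf, hF⟩
    refine ⟨fun p => c * f p, ⟨hf.1.const_mul c, ?_⟩, ?_⟩
    · have := hf.2.bounded_mul (differentiableOn_const c) (c := ‖c‖₊) fun _ _ => le_rfl
      simpa only [mul_left_comm] using this
    · filter_upwards [hF, ae_weightedTorus_of_ae_mu m t ℓ (Lp.coeFn_smul c F)] with x h1 h2
      rw [h2]
      exact h1.const_mul c

/-- `H²_ρ(θ(𝔻^d))`, identified through radial limits with a closed subspace of
`L²(∂θ(𝔻^d), μ_{ρ,θ})`. (Since `f ↦ f*` is isometric on the complete space `H²_ρ(θ(𝔻^d))`, the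
subspace `boundaryValues` is already closed; taking its closure adds nothing.) -/
noncomputable def hardySubspace : Submodule ℂ (Lp ℂ 2 (mu m t ℓ)) :=
  (boundaryValues m t ℓ).topologicalClosure

variable {m t}

/-- A function in `𝒜(θ(𝔻^d))`, extended by zero to `ℂ^d`. -/
noncomputable def extendFun (a : algA m t d) : (Fin d → ℂ) → ℂ :=
  Function.extend Subtype.val (a : C(closure (quotientDomain m t d), ℂ)) 0

theorem extendFun_apply (a : algA m t d) {p : Fin d → ℂ}
    (hp : p ∈ closure (quotientDomain m t d)) : extendFun a p = a.1 ⟨p, hp⟩ :=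
  Subtype.val_injective.extend_apply a.1 0 ⟨p, hp⟩

theorem measurable_extendFun (a : algA m t d) : Measurable (extendFun a) :=
  (MeasurableEmbedding.subtype_coe isClosed_closure.measurableSet).measurable_extend
    a.1.continuous.measurable measurable_const

theorem norm_extendFun_le (a : algA m t d) (p : Fin d → ℂ) : ‖extendFun a p‖ ≤ ‖a‖ := by
  by_cases hp : p ∈ closure (quotientDomain m t d)
  · rw [extendFun_apply a hp]
    exact a.1.norm_coe_le_norm _
  · rw [extendFun, Function.extend_apply' _ _ _ (by simpa using hp), Pi.zero_apply,
      norm_zero]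
    exact norm_nonneg a

theorem memLp_mul (a : algA m t d) (F : Lp ℂ 2 (mu m t ℓ)) :
    MemLp (fun p => extendFun a p * F p) 2 (mu m t ℓ) :=
  (Lp.memLp F).of_le_mul (c := ‖a‖)
    ((measurable_extendFun a).aestronglyMeasurable.mul (Lp.aestronglyMeasurable F))
    (ae_of_all _ fun p => by
      rw [norm_mul]
      exact mul_le_mul_of_nonneg_right (norm_extendFun_le a p) (norm_nonneg _))

/-- Multiplication by a function of `𝒜(θ(𝔻^d))` on `L²(∂θ(𝔻^d), μ_{ρ,θ})`. -/
noncomputable def mulLp (a : algA m t d) (F : Lp ℂ 2 (mu m t ℓ)) : Lp ℂ 2 (mu m t ℓ) :=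
  (memLp_mul ℓ a F).toLp _

theorem coeFn_mulLp (a : algA m t d) (F : Lp ℂ 2 (mu m t ℓ)) :
    mulLp ℓ a F =ᵐ[mu m t ℓ] fun p => extendFun a p * F p := MemLp.coeFn_toLp _

theorem norm_mulLp_le (a : algA m t d) (F : Lp ℂ 2 (mu m t ℓ)) : ‖mulLp ℓ a F‖ ≤ ‖a‖ * ‖F‖ := by
  refine Lp.norm_le_mul_norm_of_ae_le_mul ?_
  filter_upwards [coeFn_mulLp ℓ a F] with p hp
  rw [hp, norm_mul]
  exact mul_le_mul_of_nonneg_right (norm_extendFun_le a p) (norm_nonneg _)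

theorem mulLp_add (a : algA m t d) (F F' : Lp ℂ 2 (mu m t ℓ)) :
    mulLp ℓ a (F + F') = mulLp ℓ a F + mulLp ℓ a F' := by
  refine Lp.ext ?_
  filter_upwards [coeFn_mulLp ℓ a (F + F'), coeFn_mulLp ℓ a F, coeFn_mulLp ℓ a F',
    Lp.coeFn_add F F', Lp.coeFn_add (mulLp ℓ a F) (mulLp ℓ a F')] with p h1 h2 h3 h4 h5
  rw [h1, h5, Pi.add_apply, h2, h3, h4, Pi.add_apply, mul_add]

theorem mulLp_zero (a : algA m t d) : mulLp ℓ a 0 = 0 := by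
  simpa using mulLp_add ℓ a 0 0

theorem add_mulLp (a b : algA m t d) (F : Lp ℂ 2 (mu m t ℓ)) :
    mulLp ℓ (a + b) F = mulLp ℓ a F + mulLp ℓ b F := by
  refine Lp.ext ?_
  filter_upwards [coeFn_mulLp ℓ (a + b) F, coeFn_mulLp ℓ a F, coeFn_mulLp ℓ b F,
    Lp.coeFn_add (mulLp ℓ a F) (mulLp ℓ b F), ae_mem_closure m t ℓ] with p h1 h2 h3 h4 h5
  rw [h1, h4, Pi.add_apply, h2, h3, extendFun_apply _ h5, extendFun_apply _ h5,
    extendFun_apply _ h5, ← add_mul]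
  rfl

theorem zero_mulLp (F : Lp ℂ 2 (mu m t ℓ)) : mulLp ℓ (0 : algA m t d) F = 0 := by
  simpa using add_mulLp ℓ 0 0 F

theorem mul_mulLp (a b : algA m t d) (F : Lp ℂ 2 (mu m t ℓ)) :
    mulLp ℓ (a * b) F = mulLp ℓ a (mulLp ℓ b F) := by
  refine Lp.ext ?_
  filter_upwards [coeFn_mulLp ℓ (a * b) F, coeFn_mulLp ℓ a (mulLp ℓ b F), coeFn_mulLp ℓ b F,
    ae_mem_closure m t ℓ] with p h1 h2 h3 h4
  rw [h1, h2, h3, extendFun_apply _ h4, extendFun_apply _ h4, extendFun_apply _ h4, ← mul_assoc]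
  rfl

theorem algebraMap_mulLp (c : ℂ) (F : Lp ℂ 2 (mu m t ℓ)) :
    mulLp ℓ (algebraMap ℂ (algA m t d) c) F = c • F := by
  refine Lp.ext ?_
  filter_upwards [coeFn_mulLp ℓ (algebraMap ℂ (algA m t d) c) F, Lp.coeFn_smul c F,
    ae_mem_closure m t ℓ] with p h1 h2 h3
  rw [h1, h2, extendFun_apply _ h3]
  rfl

theorem mulLp_mem (a : algA m t d) {F : Lp ℂ 2 (mu m t ℓ)} (hF : F ∈ hardySubspace m t ℓ) :
    mulLp ℓ a F ∈ hardySubspace m t ℓ := by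
  have hcont : Continuous (mulLp ℓ a) := by
    refine (LipschitzWith.of_dist_le_mul (K := ‖a‖₊) fun F F' => ?_).continuous
    have h : mulLp ℓ a F = mulLp ℓ a F' + mulLp ℓ a (F - F') := by
      rw [← mulLp_add, add_sub_cancel]
    rw [dist_eq_norm, dist_eq_norm, h, add_sub_cancel_left]
    exact norm_mulLp_le ℓ a _
  refine map_mem_closure hcont hF ?_
  rintro F ⟨f, hf, hfF⟩
  obtain ⟨g, hg, hag⟩ := a.2
  have hθ : DifferentiableOn ℂ (theta m t d) (polydisc d) := by
    refine differentiableOn_pi.2 fun i => ?_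
    unfold theta
    split_ifs
    · fun_prop
    · simp only [MvPolynomial.esymm, map_sum, map_prod, MvPolynomial.eval_X]
      exact DifferentiableOn.fun_sum fun s _ =>
        ((contDiff_prod (n := 1) fun j _ => by fun_prop).differentiable one_ne_zero).differentiableOn
  refine ⟨fun p => g p * f p, ⟨hg.mul hf.1, ?_⟩, ?_⟩
  · have h := hf.2.bounded_mul (g := fun z => g (theta m t d z)) (c := ‖a‖₊)
      (hg.comp hθ fun z hz => ⟨z, hz, rfl⟩) fun z hz => by
        have hmem : theta m t d z ∈ quotientDomain m t d := ⟨z, hz, rfl⟩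
        rw [← hag ⟨_, subset_closure hmem⟩ hmem, enorm_eq_nnnorm]
        exact_mod_cast a.1.norm_coe_le_norm _
    simpa only [mul_left_comm] using h
  · filter_upwards [hfF, ae_weightedTorus_of_ae_mu m t ℓ (coeFn_mulLp ℓ a F)] with x h1 h2
    rw [h2, extendFun_apply a (theta_torusPt_mem m t x)]
    refine Tendsto.mul ?_ h1
    have h3 : Tendsto (fun r : ℝ => theta m t d ((r : ℂ) • torusPt x)) (𝓝[<] 1)
        (𝓝[closure (quotientDomain m t d)] (theta m t d (torusPt x))) :=
      tendsto_nhdsWithin_iff.2 ⟨tendsto_theta m t x,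
        (eventually_mem m t x).mono fun _ h => subset_closure h⟩
    have h4 : ContinuousWithinAt (extendFun a) (closure (quotientDomain m t d))
        (theta m t d (torusPt x)) := by
      have : ContinuousOn (extendFun a) (closure (quotientDomain m t d)) := by
        rw [continuousOn_iff_continuous_domRestrict]
        refine a.1.continuous.congr fun p => ?_
        exact (extendFun_apply a p.2).symm
      exact this _ (theta_torusPt_mem m t x)
    have h5 := h4.tendsto.comp h3
    rw [extendFun_apply a (theta_torusPt_mem m t x)] at h5
    refine h5.congr' ?_
    filter_upwards [eventually_mem m t x] with r hr
    rw [Function.comp_apply, extendFun_apply a (subset_closure hr)]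
    exact hag _ hr

variable (m t)

noncomputable instance hardyModule : Module (algA m t d) (hardySubspace m t ℓ) where
  smul a F := ⟨mulLp ℓ a F.1, mulLp_mem ℓ a F.2⟩
  one_smul F := Subtype.ext (by
    have := algebraMap_mulLp (m := m) (t := t) ℓ 1 F.1
    rwa [map_one, one_smul] at this)
  mul_smul a b F := Subtype.ext (mul_mulLp ℓ a b F.1)
  smul_zero a := Subtype.ext (mulLp_zero ℓ a)
  smul_add a F F' := Subtype.ext (mulLp_add ℓ a F.1 F'.1)
  add_smul a b F := Subtype.ext (add_mulLp ℓ a b F.1)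
  zero_smul F := Subtype.ext (zero_mulLp ℓ F.1)

theorem norm_smul_hardy_le (a : algA m t d) (F : hardySubspace m t ℓ) :
    ‖a • F‖ ≤ ‖a‖ * ‖F‖ := norm_mulLp_le ℓ a F.1

/-- The Hardy module `H²_ρ(θ(𝔻^d))` over `𝒜(θ(𝔻^d))`, with the action by multiplication. -/
noncomputable def hardy : HilbertModule (algA m t d) where
  carrier := hardySubspace m t ℓ
  completeSpace := (Submodule.isClosed_topologicalClosure _).completeSpace_coe
  isScalarTower := ⟨fun c a F => by
    have h : (c • a) = algebraMap ℂ (algA m t d) c * a := Algebra.smul_def c a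
    rw [h, mul_smul]
    exact Subtype.ext (algebraMap_mulLp ℓ c _)⟩
  continuousSMul :=
    (IsBoundedSMul.of_norm_smul_le (norm_smul_hardy_le m t ℓ)).continuousSMul

theorem isContractive_hardy : (hardy m t ℓ).IsContractive := norm_smul_hardy_le m t ℓ

/-- The Hardy module as an object of either category. -/
noncomputable def hardyObj (C : Category) : C.Obj (algA m t d) :=
  ⟨hardy m t ℓ, by
    cases C
    · trivial
    · exact (isContractive_hardy m t ℓ).isCramped⟩

end QuotientHardy

/-! Write `P` for the Hardy module, a closed submodule of `L = L²(μ)`. One function `ψ` in `L`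
produces a self-extension of `P`: its middle term `J` is the closure in `L ⊕ P` of the pairs `(aψ +
f, a·1)` with `a ∈ 𝒜(θ(𝔻^d))` and `f ∈ P`, its maps are `f ↦ (f, 0)` and the second coordinate. As a
closed submodule of a contractive module, `J` is contractive, so one and the same sequence serves
both categories. By `exists_extension_not_splits` it is exact and does not split as soon as (1)
`|⟨w, aψ⟩| ≤ C ‖w‖ ‖a·1‖` for all `w ⊥ P`, that is, the Hankel operator with symbol `ψ` is bounded;
(2) no `φ ∈ ψ + P` satisfies `‖aφ‖ ≤ c ‖a·1‖` for all `a`. A splitting would supply such a `φ`, the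
first coordinate of the image of `1`.

The choice is `ψ = log |D|`, where `D ∘ θ = ∏_{i ≠ j} (z_i^m - z_j^m)`; such a `D` exists because
the invariant polynomials are polynomials in `θ` (`IsSemiInvariant.exists_eval_theta`).

For (1), on the torus `ψ ∘ θ` is the sum over ordered pairs of `log (1 - (z̄_i z_j)^m)`. Each
summand is analytic in all variables but `z_i`; its conjugate is the summand with `i` and `j`
exchanged, hence analytic in `z_i`; and the two differ by twice an imaginary part, so by at most
`2π`. `norm_inner_le_mul_norm_sub` shows that a function orthogonal to the analytic monomials sees
only this bounded difference. The logarithms are made smooth by a factor `s < 1`, removed by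
dominated convergence in `norm_integral_mul_logSum_le`. Averaging monomials over `G` transfers `w ⊥
P` to the orthogonality of `ℓ · (w ∘ θ)` to the analytic monomials
(`inner_fourierTorus_liftLp_eq_zero`).

For (2), test against the powers `a_N` of the first coordinate, which is `∑ z_j^m` on the torus.
Since `|a_N|` is invariant under scalar rotations, the mean value property makes `⟨a_N, a_N f⟩ /
‖a_N‖²` independent of `N` for `f ∈ P` (`inner_mulLp_polyA_mul_eq`), while for `φ` the quotient is
at most `c`. So the averages of `ψ` against the weights `|∑ z_j^m|^{2N}` would be bounded. But these
weights concentrate where all `z_j^m` agree, and there `D` vanishes and `ψ` is `-∞`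
(`exists_mul_integral_lt`, `exists_bound_norm_sum_pow`). -/

namespace QuotientHardy

open MeasureTheory Filter Topology
open scoped ENNReal NNReal

/-! ### Self-extensions of a submodule built from one vector -/

section Abstract

variable {A : Type} [NormedCommRing A] [NormedAlgebra ℂ A]

namespace HilbertModule

/-- A closed submodule of a Hilbert module, as a Hilbert module. -/
noncomputable def ofClosed (L : HilbertModule A) (M : Submodule A L) (hM : IsClosed (M : Set L)) :
    HilbertModule A where
  carrier := M.restrictScalars ℂ
  completeSpace := by
    have h : IsClosed ((M.restrictScalars ℂ : Submodule ℂ L) : Set L) := hM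
    exact h.completeSpace_coe
  isScalarTower := ⟨fun c a x => Subtype.ext (smul_assoc c a x.1)⟩
  continuousSMul := ⟨Continuous.subtype_mk
    (continuous_fst.smul (continuous_subtype_val.comp continuous_snd)) _⟩

/-- The inclusion of a closed submodule. -/
noncomputable def ofClosedSubtype (L : HilbertModule A) (M : Submodule A L)
    (hM : IsClosed (M : Set L)) : L.ofClosed M hM →L[A] L where
  toFun x := x.1
  map_add' _ _ := rfl
  map_smul' _ _ := rfl
  cont := continuous_subtype_val

theorem IsContractive.ofClosed {L : HilbertModule A} (hL : L.IsContractive) (M : Submodule A L)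
    (hM : IsClosed (M : Set L)) : (L.ofClosed M hM).IsContractive :=
  fun a x => hL a x.1

end HilbertModule

variable {L P : HilbertModule A} (ι : P →L[A] L) (e : P) (ψ : L)

/-- The submodule of the pairs `(a • ψ + ι f, a • e)` in `L ⊕ P`. -/
noncomputable def pairSubmodule : Submodule A (L.prod P) where
  carrier := {u | ∃ (a : A) (f : P), u = WithLp.toLp 2 (a • ψ + ι f, a • e)}
  add_mem' := by
    rintro _ _ ⟨a, f, rfl⟩ ⟨b, g, rfl⟩
    refine ⟨a + b, f + g, WithLp.ofLp_injective 2 (Prod.ext ?_ (add_smul a b e).symm)⟩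
    change (a • ψ + ι f) + (b • ψ + ι g) = (a + b) • ψ + ι (f + g)
    rw [add_smul, map_add]
    abel
  zero_mem' := ⟨0, 0, WithLp.ofLp_injective 2 (Prod.ext (by
    change (0 : L) = (0 : A) • ψ + ι 0
    rw [zero_smul, map_zero, add_zero]) (zero_smul A e).symm)⟩
  smul_mem' := by
    rintro c _ ⟨a, f, rfl⟩
    refine ⟨c * a, c • f, WithLp.ofLp_injective 2 (Prod.ext ?_ (mul_smul c a e).symm)⟩
    change c • (a • ψ + ι f) = (c * a) • ψ + ι (c • f)
    rw [smul_add, mul_smul, map_smul]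

variable {ι e ψ}

/-- Modulo the range of `ι`, the first coordinate is controlled by the second. On a generating pair
the distance to the range is that of `a • ψ`, which `hbound` estimates by testing against the
component orthogonal to the range; the inequality is closed, so it passes to the closure. -/
theorem norm_sub_starProjection_le {C : ℝ} (hC : 0 ≤ C)
    (hbound : ∀ (w : L), (∀ f, inner ℂ (ι f) w = 0) → ∀ a : A,
      ‖inner ℂ w (a • ψ)‖ ≤ C * ‖w‖ * ‖a • e‖)
    (R : Submodule ℂ L) (hR : ∀ x, x ∈ R ↔ ∃ f, ι f = x) [R.HasOrthogonalProjection]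
    {u : L.prod P} (hu : u ∈ (pairSubmodule ι e ψ).topologicalClosure) :
    ‖(WithLp.ofLp u).1 - R.starProjection (WithLp.ofLp u).1‖ ≤ C * ‖(WithLp.ofLp u).2‖ := by
  have hc := WithLp.prod_continuous_ofLp 2 L P
  have hcl : IsClosed {u : WithLp 2 (L × P) |
      ‖(WithLp.ofLp u).1 - R.starProjection (WithLp.ofLp u).1‖ ≤ C * ‖(WithLp.ofLp u).2‖} := by
    refine isClosed_le ?_ ?_
    · exact ((continuous_fst.comp hc).sub
        (R.starProjection.continuous.comp (continuous_fst.comp hc))).norm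
    · exact continuous_const.mul (continuous_snd.comp hc).norm
  refine closure_minimal (t := {u : WithLp 2 (L × P) |
      ‖(WithLp.ofLp u).1 - R.starProjection (WithLp.ofLp u).1‖ ≤ C * ‖(WithLp.ofLp u).2‖})
    ?_ hcl hu
  rintro _ ⟨a, f, rfl⟩
  change ‖(a • ψ + ι f) - R.starProjection (a • ψ + ι f)‖ ≤ C * ‖a • e‖
  have hf : R.starProjection (ι f) = ι f :=
    Submodule.starProjection_eq_self_iff.2 ((hR _).2 ⟨f, rfl⟩)
  have h1 : (a • ψ + ι f) - R.starProjection (a • ψ + ι f) =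
      a • ψ - R.starProjection (a • ψ) := by
    rw [map_add, hf]
    abel
  rw [h1]
  -- The test vector is the orthogonal component itself: its pairing with `a • ψ` is `‖w‖ ^ 2`.
  set w := a • ψ - R.starProjection (a • ψ) with hw
  have hwR : w ∈ Rᗮ := Submodule.sub_starProjection_mem_orthogonal _
  have h2 : inner ℂ w (a • ψ) = (‖w‖ : ℂ) ^ 2 := by
    have h3 : a • ψ = w + R.starProjection (a • ψ) := by rw [hw]; abel
    conv_lhs => rw [h3]
    rw [inner_add_right, Submodule.inner_left_of_mem_orthogonal
      (Submodule.starProjection_apply_mem _ _) hwR, add_zero, inner_self_eq_norm_sq_to_K]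
    rfl
  have h4 := hbound w (fun f => Submodule.inner_right_of_mem_orthogonal ((hR _).2 ⟨f, rfl⟩) hwR) a
  rw [h2, norm_pow, Complex.norm_real, norm_norm] at h4
  rcases (norm_nonneg w).eq_or_lt with h0 | h0
  · rw [← h0]
    positivity
  · have : ‖w‖ * ‖w‖ ≤ ‖w‖ * (C * ‖a • e‖) := by nlinarith
    exact le_of_mul_le_mul_left this h0

/-- `hbound` does double duty: a pair `(x, 0)` in the closure has `x` in the range of `ι`, which
gives exactness in the middle, and convergent second coordinates can be lifted, which gives
surjectivity. A section sends `e` to some `(φ, e)`; module linearity and boundedness give the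
estimate on `a • φ`, and subtracting `(ψ, e)` leaves `(φ - ψ, 0)`, so `φ - ψ` is in the range of
`ι`, against `hlift`. -/
theorem exists_extension_not_splits (C : Category) (hL : L.IsContractive) (hP : P.IsContractive)
    (hPC : C.Mem P) (hι : ∀ f, ‖ι f‖ = ‖f‖) (he : DenseRange fun a : A => a • e) {c : ℝ}
    (hc : 0 ≤ c)
    (hbound : ∀ (w : L), (∀ f, inner ℂ (ι f) w = 0) → ∀ a : A,
      ‖inner ℂ w (a • ψ)‖ ≤ c * ‖w‖ * ‖a • e‖)
    (hlift : ∀ (φ : L) (c' : ℝ), (∀ a : A, ‖a • φ‖ ≤ c' * ‖a • e‖) → ∀ f, ι f ≠ φ - ψ) :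
    ∃ E : Extension (⟨P, hPC⟩ : C.Obj A) ⟨P, hPC⟩, ¬ E.Splits := by
  let ι₀ : P →ₗᵢ[ℂ] L := ⟨(ι : P →ₗ[A] L).restrictScalars ℂ, hι⟩
  let R : Submodule ℂ L := LinearMap.range ι₀.toLinearMap
  have hR : ∀ x, x ∈ R ↔ ∃ f, ι f = x := fun x => Iff.rfl
  have hRc : IsClosed (R : Set L) := by
    have h := ι₀.isometry.isClosedEmbedding.isClosed_range
    rwa [← ι₀.coe_toLinearMap, ← LinearMap.coe_range] at h
  have : CompleteSpace R := hRc.completeSpace_coe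
  let M := (pairSubmodule ι e ψ).topologicalClosure
  have hMc : IsClosed (M : Set (L.prod P)) := Submodule.isClosed_topologicalClosure _
  have hM : ∀ u : L.prod P, u ∈ M → ‖(WithLp.ofLp u).1 - R.starProjection (WithLp.ofLp u).1‖ ≤
      c * ‖(WithLp.ofLp u).2‖ := fun u hu => norm_sub_starProjection_le hc hbound R hR hu
  let pt : L → P → L.prod P := fun x y => WithLp.toLp 2 (x, y)
  have hmem : ∀ (a : A) (f : P), pt (a • ψ + ι f) (a • e) ∈ M :=
    fun a f => Submodule.le_topologicalClosure _ ⟨a, f, rfl⟩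
  have hker : ∀ x : L, pt x 0 ∈ M → ∃ f, ι f = x := by
    intro x hx
    have h := hM _ hx
    change ‖x - R.starProjection x‖ ≤ c * ‖(0 : P)‖ at h
    rw [norm_zero, mul_zero] at h
    rw [← hR, ← Submodule.starProjection_eq_self_iff]
    exact (sub_eq_zero.1 (norm_le_zero_iff.1 h)).symm
  let J := (L.prod P).ofClosed M hMc
  have hJ : J.IsContractive := (hL.prod hP).ofClosed M hMc
  have hJC : C.Mem J := by
    cases C
    · trivial
    · exact hJ.isCramped
  have hmem₀ : ∀ f : P, pt (ι f) 0 ∈ M := fun f => by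
    have h := hmem 0 f
    rwa [zero_smul, zero_smul, zero_add] at h
  let α : P →L[A] J :=
    { toFun := fun f => ⟨pt (ι f) 0, hmem₀ f⟩
      map_add' := fun f g => Subtype.ext (WithLp.ofLp_injective 2
        (Prod.ext (map_add ι f g) (add_zero 0).symm))
      map_smul' := fun a f => Subtype.ext (WithLp.ofLp_injective 2
        (Prod.ext (map_smul ι a f) (smul_zero a).symm))
      cont := Continuous.subtype_mk ((WithLp.prod_continuous_toLp 2 L P).comp
        (ι.continuous.prodMk continuous_const)) hmem₀ }
  let β : J →L[A] P := (HilbertModule.snd L P).comp (HilbertModule.ofClosedSubtype _ M hMc)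
  have hβsurj : Function.Surjective β := by
    intro y
    obtain ⟨u, hu, hlim⟩ := mem_closure_iff_seq_limit.1 (he y)
    choose a ha using hu
    -- Correcting by `ι (f n)` moves the first coordinates into the orthogonal complement of the
    -- range, where `hM` bounds their differences by those of the second coordinates.
    have hx : ∀ n, ∃ f, ι f = -R.starProjection (a n • ψ) := fun n =>
      (hR _).1 (R.neg_mem (Submodule.starProjection_apply_mem _ _))
    choose f hf using hx
    let x : ℕ → L := fun n => a n • ψ + ι (f n)
    have hxc : CauchySeq x := by
      have hx0 : ∀ n, R.starProjection (x n) = 0 := fun n => by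
        simp only [x]
        rw [map_add, hf, map_neg, Submodule.starProjection_eq_self_iff.2
          (Submodule.starProjection_apply_mem _ _), add_neg_cancel]
      have hle : ∀ n k, dist (x n) (x k) ≤ c * dist (u n) (u k) := fun n k => by
        have h := hM _ (M.sub_mem (hmem (a n) (f n)) (hmem (a k) (f k)))
        change ‖(x n - x k) - R.starProjection (x n - x k)‖ ≤ c * ‖a n • e - a k • e‖ at h
        rw [map_sub, hx0, hx0, sub_zero, sub_zero] at h
        rw [dist_eq_norm, dist_eq_norm, ← ha n, ← ha k]
        exact h
      refine Metric.cauchySeq_iff.2 fun ε hε => ?_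
      -- The divisor is `c + 1` because `c` may be zero.
      obtain ⟨N, hN⟩ := Metric.cauchySeq_iff.1 hlim.cauchySeq (ε / (c + 1)) (by positivity)
      refine ⟨N, fun n hn k hk => (hle n k).trans_lt ?_⟩
      have h1 := hN n hn k hk
      rw [lt_div_iff₀ (by positivity)] at h1
      nlinarith [dist_nonneg (x := u n) (y := u k)]
    obtain ⟨x₀, hx₀⟩ := cauchySeq_tendsto_of_complete hxc
    have hmem₁ : pt x₀ y ∈ M := by
      refine hMc.mem_of_tendsto (b := Filter.atTop)
        (f := fun n => pt (x n) (u n)) ?_ (Filter.Eventually.of_forall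
          fun n => ?_)
      · exact ((WithLp.prod_continuous_toLp 2 L P).tendsto _).comp (hx₀.prodMk_nhds hlim)
      · rw [← ha n]
        exact hmem _ _
    exact ⟨⟨_, hmem₁⟩, rfl⟩
  refine ⟨⟨⟨J, hJC⟩, α, β, fun f g h => ?_, fun u => ⟨fun hu => ?_, ?_⟩, hβsurj⟩, ?_⟩
  · have h1 : ι f = ι g := congrArg (fun u : J => (WithLp.ofLp u.1).1) h
    exact ι₀.injective h1
  · have h1 : pt (WithLp.ofLp u.1).1 0 = u.1 :=
      WithLp.ofLp_injective 2 (Prod.ext rfl hu.symm)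
    obtain ⟨f, hf⟩ := hker (WithLp.ofLp u.1).1 (h1 ▸ u.2)
    exact ⟨f, Subtype.ext (WithLp.ofLp_injective 2 (Prod.ext hf hu.symm))⟩
  · rintro ⟨f, rfl⟩
    rfl
  · rintro ⟨s, hs⟩
    have hs' : ∀ y, (WithLp.ofLp (s y).1).2 = y := fun y => congrArg (fun T => T y) hs
    let φ : L := (WithLp.ofLp (s e).1).1
    obtain ⟨c', hc'⟩ : ∃ c' : ℝ, ∀ y, ‖s y‖ ≤ c' * ‖y‖ := by
      let s₀ : P →L[ℂ] J := ⟨(s : P →ₗ[A] J).restrictScalars ℂ, s.continuous⟩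
      exact ⟨‖s₀‖, s₀.le_opNorm⟩
    have hφψ : pt (φ - ψ) 0 ∈ M := by
      have h1 := M.sub_mem (s e).2 (hmem 1 0)
      suffices h2 : pt (φ - ψ) 0 = (s e).1 - pt ((1 : A) • ψ + ι 0) ((1 : A) • e) by rwa [h2]
      refine WithLp.ofLp_injective 2 (Prod.ext ?_ ?_)
      · change φ - ψ = φ - ((1 : A) • ψ + ι 0)
        rw [one_smul, map_zero, add_zero]
      · change (0 : P) = (WithLp.ofLp (s e).1).2 - (1 : A) • e
        rw [hs', one_smul, sub_self]
    obtain ⟨f, hf⟩ := hker (φ - ψ) hφψ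
    refine hlift φ c' (fun a => ?_) f hf
    have h2 : a • φ = (WithLp.ofLp (s (a • e)).1).1 := by
      rw [map_smul]
      rfl
    rw [h2]
    exact (WithLp.norm_fst_le _ _).trans (hc' _)

/-- An equivalence from the direct sum sequence carries the inclusion of the second summand to a
section. -/
theorem Extension.splits_of_mk_eq_zero {C : Category} {K H : C.Obj A} (E : Extension K H)
    (hE : Quotient.mk (Extension.setoid K H) E = (0 : Ext K H)) : E.Splits := by
  obtain ⟨γ, -, h2⟩ : Extension.Equivalent (Extension.trivial K H) E := Quotient.exact hE.symm
  let inr : K.1 →L[A] H.1.prod K.1 :=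
    { toFun := fun k => WithLp.toLp 2 (0, k)
      map_add' := fun x y => WithLp.ofLp_injective 2 (Prod.ext (add_zero 0).symm rfl)
      map_smul' := fun a x => WithLp.ofLp_injective 2 (Prod.ext (smul_zero a).symm rfl)
      cont := (WithLp.prod_continuous_toLp 2 H.1 K.1).comp (by fun_prop) }
  refine ⟨γ.comp inr, ContinuousLinearMap.ext fun k => ?_⟩
  exact congrArg (fun T => T (inr k)) h2

end Abstract

/-! ### Invariant polynomials are polynomials in `θ` -/

section Invariants

open MvPolynomial

variable {m t d : ℕ}

/-- An identity `f(c₁ z₁, …, c_d z_d) = f(z)` constrains the monomials of `f`. -/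
theorem prod_pow_eq_one_of_eval_mul_eq (c : Fin d → ℂ) (f : MvPolynomial (Fin d) ℂ)
    (hf : ∀ z, eval (fun i => c i * z i) f = eval z f) {s : Fin d →₀ ℕ} (hs : s ∈ f.support) :
    ∏ i, c i ^ s i = 1 := by
  have hq : (∑ s ∈ f.support, monomial s ((∏ i, c i ^ s i) * coeff s f)) = f := by
    refine MvPolynomial.funext fun z => ?_
    rw [← hf z, eval_eq' _ f, map_sum]
    refine Finset.sum_congr rfl fun s _ => ?_
    rw [eval_monomial, Finsupp.prod_fintype _ _ (fun _ => pow_zero _)]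
    simp only [mul_pow]
    rw [Finset.prod_mul_distrib]
    ring
  have h1 := congrArg (coeff s) hq
  rw [coeff_sum] at h1
  simp only [coeff_monomial] at h1
  rw [Finset.sum_ite_eq' f.support s, if_pos hs] at h1
  exact mul_right_cancel₀ (mem_support_iff.1 hs) (h1.trans (one_mul _).symm)

/-- A diagonal element of the group multiplies each monomial by a root of unity, which must be `1`
on the monomials of an invariant. -/
theorem dvd_sum_mul_of_mem_support (hm : 0 < m) {f : MvPolynomial (Fin d) ℂ}
    (hf : IsSemiInvariant (1 : G m t d →* ℂˣ) f) {s : Fin d →₀ ℕ} (hs : s ∈ f.support)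
    (ν : Fin d → ℤ) (hν : (t : ℤ) ∣ ∑ i, ν i) : (m : ℤ) ∣ ∑ i, ν i * s i := by
  have hm' : (m : ℂ) ≠ 0 := by exact_mod_cast hm.ne'
  have h1 := prod_pow_eq_one_of_eval_mul_eq
    (fun i => Complex.exp (2 * Real.pi * Complex.I * ν i / m)) f (fun z => by
      have h := hf (mkG m t d 1 ν hν) z
      simpa [mkG] using h) hs
  simp only [← Complex.exp_nat_mul] at h1
  rw [← Complex.exp_sum, Complex.exp_eq_one_iff] at h1
  obtain ⟨n, hn⟩ := h1
  refine ⟨n, ?_⟩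
  have h2 : (∑ i, (s i : ℂ) * (2 * Real.pi * Complex.I * ν i / m)) =
      (2 * Real.pi * Complex.I / m) * ((∑ i, ν i * s i : ℤ) : ℂ) := by
    push_cast
    rw [Finset.mul_sum]
    refine Finset.sum_congr rfl fun i _ => ?_
    ring
  rw [h2] at hn
  have h3 : (((∑ i, ν i * s i : ℤ)) : ℂ) = ((m * n : ℤ) : ℂ) := by
    have := Complex.two_pi_I_ne_zero
    push_cast at hn ⊢
    field_simp at hn
    linear_combination hn
  exact_mod_cast h3

/-- Only the top elementary symmetric polynomial is not itself a component of `θ`: it is the `t`-th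
power of the last one. -/
theorem eval_esymm_pow_eq (htm : t ∣ m) (z : Fin d → ℂ) (i : Fin d) :
    eval (fun j => z j ^ m) (esymm (Fin d) ℂ (i + 1)) =
      if (i : ℕ) + 1 = d then theta m t d z i ^ t else theta m t d z i := by
  unfold theta
  split_ifs with h
  · rw [h, ← pow_mul, Nat.div_mul_cancel htm]
    have h1 : esymm (Fin d) ℂ d = ∏ j, X j := by
      have h2 : Finset.powersetCard d (Finset.univ : Finset (Fin d)) = {Finset.univ} := by
        have := Finset.powersetCard_self (Finset.univ : Finset (Fin d))
        rwa [Finset.card_univ, Fintype.card_fin] at this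
      rw [esymm, h2, Finset.sum_singleton]
    rw [h1, map_prod]
    simp [Finset.prod_pow]
  · rfl

theorem IsSymmetric.exists_eval_theta (htm : t ∣ m) {g : MvPolynomial (Fin d) ℂ}
    (hg : g.IsSymmetric) :
    ∃ q : MvPolynomial (Fin d) ℂ, ∀ z, eval (fun j => z j ^ m) g = eval (theta m t d z) q := by
  obtain ⟨p, hp⟩ := esymmAlgHom_surjective (R := ℂ) (σ := Fin d) (n := d) (by simp) ⟨g, hg⟩
  have hp' : aeval (fun i : Fin d => esymm (Fin d) ℂ (i + 1)) p = g := by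
    rw [← esymmAlgHom_apply, hp]
  refine ⟨aeval (fun i : Fin d => if (i : ℕ) + 1 = d then X i ^ t else X i) p, fun z => ?_⟩
  rw [← hp', ← aeval_eq_eval, ← aeval_eq_eval, ← AlgHom.comp_apply, ← AlgHom.comp_apply]
  congr 1
  ext i
  simp only [AlgHom.comp_apply, aeval_X]
  rw [aeval_eq_eval, eval_esymm_pow_eq htm]
  split_ifs <;> simp

/-- Invariance under diagonal elements forces all exponents to be congruent modulo `m`, with common
residue a multiple `n c` of `n = m / t`. The sum over permutations is therefore `(z_1 ⋯ z_d)^{n c}`,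
a power of the last component of `θ`, times a symmetric polynomial in the `z_j ^ m`. -/
theorem sum_perm_eval_monomial_eq (hm : 0 < m) (ht : 0 < t) (htm : t ∣ m) (hd : 1 < d)
    {f : MvPolynomial (Fin d) ℂ} (hf : IsSemiInvariant (1 : G m t d →* ℂˣ) f) {s : Fin d →₀ ℕ}
    (hs : s ∈ f.support) :
    ∃ q : MvPolynomial (Fin d) ℂ, ∀ z : Fin d → ℂ,
      ∑ σ : Equiv.Perm (Fin d), ∏ i, z (σ i) ^ s i = eval (theta m t d z) q := by
  classical
  obtain ⟨n, rfl⟩ := htm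
  have hn : 0 < n := Nat.pos_of_mul_pos_left hm
  -- The last index serves both as the reference for the residues and as the component of `θ` equal
  -- to `(z_1 ⋯ z_d)^n`.
  let i₀ : Fin d := ⟨d - 1, by omega⟩
  have hmod : ∀ i, s i % (t * n) = s i₀ % (t * n) := by
    intro i
    have h := dvd_sum_mul_of_mem_support hm hf hs (Pi.single i₀ 1 - Pi.single i 1) (by
      simp [Finset.sum_sub_distrib])
    simp only [Pi.sub_apply, sub_mul, Finset.sum_sub_distrib, Pi.single_apply, ite_mul, one_mul,
      zero_mul, Finset.sum_ite_eq', Finset.mem_univ, if_true] at h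
    exact (Nat.modEq_iff_dvd (n := t * n)).2 h
  obtain ⟨c, hc⟩ : n ∣ s i₀ % (t * n) := by
    -- A single exponent `t` is allowed in the group and gives `t * n ∣ t * s i₀`.
    have h := dvd_sum_mul_of_mem_support hm hf hs (Pi.single i₀ (t : ℤ)) (by simp)
    simp only [Pi.single_apply, ite_mul, zero_mul, Finset.sum_ite_eq', Finset.mem_univ,
      if_true] at h
    have h1 : t * n ∣ t * s i₀ := by exact_mod_cast h
    have h2 : n ∣ s i₀ := Nat.dvd_of_mul_dvd_mul_left ht h1
    exact (Nat.dvd_mod_iff (dvd_mul_left n t)).2 h2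
  have hsi : ∀ i, s i = n * c + t * n * (s i / (t * n)) := fun i => by
    rw [← hc, ← hmod i, Nat.mod_add_div]
  let k : Fin d →₀ ℕ := Finsupp.equivFunOnFinite.symm fun i => s i / (t * n)
  let g : MvPolynomial (Fin d) ℂ := ∑ σ : Equiv.Perm (Fin d), rename σ (monomial k 1)
  have hg : g.IsSymmetric := by
    intro τ
    simp only [g, map_sum, rename_rename]
    exact Fintype.sum_equiv (Equiv.mulLeft τ) _ _ fun σ => rfl
  obtain ⟨q, hq⟩ := IsSymmetric.exists_eval_theta (m := t * n) (dvd_mul_right t n) hg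
  refine ⟨X i₀ ^ c * q, fun z => ?_⟩
  rw [map_mul, ← hq, map_pow, eval_X, map_sum, Finset.mul_sum]
  refine Finset.sum_congr rfl fun σ _ => ?_
  rw [eval_rename, eval_monomial, one_mul, Finsupp.prod_fintype _ _ (fun _ => pow_zero _)]
  have h1 : theta (t * n) t d z i₀ = ∏ i, z (σ i) ^ n := by
    rw [theta, if_pos (by simp only [i₀]; omega), Nat.mul_div_cancel_left n ht,
      Finset.prod_pow, Equiv.prod_comp σ z]
  rw [h1, ← Finset.prod_pow, ← Finset.prod_mul_distrib]
  refine Finset.prod_congr rfl fun i _ => ?_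
  conv_lhs => rw [hsi i, pow_add, pow_mul, pow_mul]
  rfl

/-- The `G(m, t, d)`-invariant polynomials are polynomials in the components of `θ`. -/
theorem IsSemiInvariant.exists_eval_theta (hm : 0 < m) (ht : 0 < t) (htm : t ∣ m) (hd : 1 < d)
    {f : MvPolynomial (Fin d) ℂ} (hf : IsSemiInvariant (1 : G m t d →* ℂˣ) f) :
    ∃ q : MvPolynomial (Fin d) ℂ, ∀ z, eval z f = eval (theta m t d z) q := by
  classical
  have h := fun s : f.support => sum_perm_eval_monomial_eq hm ht htm hd hf s.2
  choose q hq using h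
  -- Permutation matrices belong to the group, so `f` is its own average over permutations, a
  -- combination of the orbit sums just treated.
  refine ⟨C ((Fintype.card (Equiv.Perm (Fin d)) : ℂ)⁻¹) *
    ∑ s : f.support, C (coeff s.1 f) * q s, fun z => ?_⟩
  have h1 : ∀ σ : Equiv.Perm (Fin d), eval (fun i => z (σ i)) f = eval z f := by
    intro σ
    have h := hf (mkG m t d σ 0 (by simp)) z
    simpa [mkG] using h
  have h2 : (Fintype.card (Equiv.Perm (Fin d)) : ℂ) * eval z f =
      ∑ σ : Equiv.Perm (Fin d), eval (fun i => z (σ i)) f := by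
    simp [h1]
  have h0 : (Fintype.card (Equiv.Perm (Fin d)) : ℂ) ≠ 0 := by
    exact_mod_cast Fintype.card_ne_zero
  rw [map_mul, eval_C, map_sum, eq_inv_mul_iff_mul_eq₀ h0, h2]
  simp only [map_mul, eval_C, ← hq, Finset.mul_sum]
  rw [Finset.sum_comm]
  refine Finset.sum_congr rfl fun σ _ => ?_
  rw [eval_eq', ← Finset.sum_coe_sort]

end Invariants

/-! ### Fourier analysis on the torus -/

section Torus

variable {d : ℕ}

instance isProbabilityMeasure_haarTorus : IsProbabilityMeasure (haarTorus d) := by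
  unfold haarTorus
  infer_instance

instance isAddHaarMeasure_haarTorus : (haarTorus d).IsAddHaarMeasure := by
  unfold haarTorus
  infer_instance

/-- The mean value property, rescaled from angles in `[0, 2π]` to the circle of length one. -/
theorem integral_toCircle_eq {φ : ℂ → ℂ} (hφ : DiffContOnCl ℂ φ (Metric.ball 0 1)) :
    ∫ y : UnitAddCircle, φ (AddCircle.toCircle y : ℂ) ∂AddCircle.haarAddCircle = φ 0 := by
  have h1 := DiffContOnCl.circleAverage (f := φ) (c := 0) (R := 1) (by rwa [abs_one])
  rw [← h1, Real.circleAverage_def, AddCircle.integral_haarAddCircle, inv_one, one_smul,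
    ← UnitAddCircle.intervalIntegral_preimage 0]
  have h2 := intervalIntegral.integral_comp_mul_left (a := 0) (b := 1)
    (fun θ => φ (circleMap 0 1 θ)) (c := 2 * Real.pi) (by positivity)
  rw [mul_zero, mul_one] at h2
  rw [← h2, zero_add]
  refine intervalIntegral.integral_congr fun x _ => ?_
  simp only [AddCircle.toCircle_apply_mk, circleMap, Circle.coe_exp]
  congr 1
  push_cast
  simp

/-- The integral over the torus of a function that extends holomorphically to the disc along the
orbits of a family of translations is the integral of the values at the centres. -/
theorem integral_haarTorus_eq_of_rotation {f b : UnitAddTorus (Fin d) → ℂ} (hf : Continuous f)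
    {c : UnitAddCircle → UnitAddTorus (Fin d)} (hc : Continuous c)
    (h : ∀ x, ∃ φ : ℂ → ℂ, DiffContOnCl ℂ φ (Metric.ball 0 1) ∧
      (∀ y, f (x + c y) = φ (AddCircle.toCircle y : ℂ)) ∧ φ 0 = b x) :
    ∫ x, f x ∂haarTorus d = ∫ x, b x ∂haarTorus d := by
  have h1 : ∀ y, ∫ x, f (x + c y) ∂haarTorus d = ∫ x, f x ∂haarTorus d := fun y =>
    integral_add_right_eq_self f (c y)
  -- Haar measure is invariant under each translation by `c y`, so averaging over `y` changes
  -- nothing; after exchanging the integrals the mean value property applies on every orbit.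
  have h2 : ∫ x, f x ∂haarTorus d =
      ∫ y, ∫ x, f (x + c y) ∂haarTorus d ∂(AddCircle.haarAddCircle : Measure UnitAddCircle) := by
    simp [h1]
  rw [h2, integral_integral_swap]
  · refine integral_congr_ae (ae_of_all _ fun x => ?_)
    obtain ⟨φ, hφ, hφ1, hφ0⟩ := h x
    simp only [hφ1]
    rw [integral_toCircle_eq hφ, hφ0]
  · refine Continuous.integrable_of_hasCompactSupport ?_ (HasCompactSupport.of_compactSpace _)
    exact hf.comp (continuous_snd.add (hc.comp continuous_fst))

/-- The Fourier coefficients with negative `l`-th index of a function that is analytic in the `l`-th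
variable vanish. -/
theorem integral_conj_mFourier_mul_eq_zero {u : UnitAddTorus (Fin d) → ℂ} (hu : Continuous u)
    (l : Fin d) (h : ∀ x, ∃ φ : ℂ → ℂ, DiffContOnCl ℂ φ (Metric.ball 0 1) ∧
      ∀ y : UnitAddCircle, u (x + (Pi.single l y : UnitAddTorus (Fin d))) =
        φ (AddCircle.toCircle y : ℂ)) {k : Fin d → ℤ} (hk : k l < 0) :
    ∫ x, starRingEnd ℂ (UnitAddTorus.mFourier k x) * u x ∂haarTorus d = 0 := by
  -- Along the `l`-th circle the conjugate monomial becomes `z ^ (n + 1)` up to a constant factor;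
  -- the positive exponent makes the value at the centre vanish.
  obtain ⟨n, hn⟩ : ∃ n : ℕ, k l = -(n + 1 : ℕ) := ⟨(-k l - 1).toNat, by omega⟩
  have hc : Continuous fun y : UnitAddCircle => (Pi.single l y : UnitAddTorus (Fin d)) :=
    continuous_single (A := fun _ : Fin d => UnitAddCircle) l
  rw [integral_haarTorus_eq_of_rotation (b := fun _ => 0) _ hc, integral_zero]
  · intro x
    obtain ⟨φ, hφ, hφ1⟩ := h x
    refine ⟨fun z => starRingEnd ℂ (UnitAddTorus.mFourier k x) * (z ^ (n + 1) * φ z), ?_, ?_, ?_⟩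
    · refine DiffContOnCl.const_smul (c := starRingEnd ℂ (UnitAddTorus.mFourier k x))
        (f := fun z => z ^ (n + 1) * φ z) ?_
      exact DiffContOnCl.smul (c := fun z : ℂ => z ^ (n + 1))
        (Differentiable.diffContOnCl (by fun_prop)) hφ
    · intro y
      beta_reduce
      rw [hφ1, ← UnitAddTorus.mFourier_neg, ← UnitAddTorus.mFourier_neg, ← mul_assoc]
      congr 1
      have h1 : UnitAddTorus.mFourier (-k) (x + Pi.single l y) =
          UnitAddTorus.mFourier (-k) x * UnitAddTorus.mFourier (-k) (Pi.single l y) := by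
        simp only [UnitAddTorus.mFourier, ContinuousMap.coe_mk, Pi.add_apply, fourier_apply,
          smul_add, AddCircle.toCircle_add, Circle.coe_mul, Finset.prod_mul_distrib]
      rw [h1]
      congr 1
      simp only [UnitAddTorus.mFourier, ContinuousMap.coe_mk]
      rw [Finset.prod_eq_single l]
      · rw [Pi.single_eq_same, Pi.neg_apply, hn, neg_neg, fourier_apply]
        rw [natCast_zsmul, AddCircle.toCircle_nsmul, Circle.coe_pow]
      · intro j _ hj
        rw [Pi.single_eq_of_ne hj, fourier_eval_zero]
      · simp
    · simp
  · exact (Complex.continuous_conj.comp (UnitAddTorus.mFourier k).continuous).mul hu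

/-- Fourier monomials as elements of `L²(𝕋^d)`. -/
noncomputable def fourierTorus (k : Fin d → ℤ) : Lp ℂ 2 (haarTorus d) :=
  UnitAddTorus.mFourierBasis k

theorem coeFn_fourierTorus (k : Fin d → ℤ) :
    fourierTorus k =ᵐ[haarTorus d] UnitAddTorus.mFourier k := by
  rw [fourierTorus, UnitAddTorus.coe_mFourierBasis]
  exact UnitAddTorus.coeFn_mFourierLp 2 k

theorem inner_fourierTorus (k : Fin d → ℤ) (u : Lp ℂ 2 (haarTorus d)) :
    inner ℂ (fourierTorus k) u =
      ∫ x, starRingEnd ℂ (UnitAddTorus.mFourier k x) * u x ∂haarTorus d := by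
  rw [MeasureTheory.L2.inner_def]
  refine integral_congr_ae ?_
  filter_upwards [coeFn_fourierTorus k] with x hx
  rw [hx, RCLike.inner_apply, mul_comm]

/-- Let `W₁` be the part of `W` with frequencies `k i ≥ 0`. Since `W` has no frequencies in the
positive orthant, each frequency of `W₁` is negative in some direction other than `i`, where `U` has
none; so `W₁ ⊥ U`. Also `W - W₁ ⊥ V`, because `V` is analytic in the `i`-th variable. Hence `⟪W, U⟫
= ⟪W - W₁, U - V⟫`. -/
theorem norm_inner_le_mul_norm_sub (i : Fin d) {W U V : Lp ℂ 2 (haarTorus d)}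
    (hW : ∀ k : Fin d → ℤ, (∀ l, 0 ≤ k l) → inner ℂ (fourierTorus k) W = 0)
    (hU : ∀ (k : Fin d → ℤ) (l : Fin d), l ≠ i → k l < 0 → inner ℂ (fourierTorus k) U = 0)
    (hV : ∀ k : Fin d → ℤ, k i < 0 → inner ℂ (fourierTorus k) V = 0) :
    ‖inner ℂ W U‖ ≤ ‖W‖ * ‖U - V‖ := by
  let b : HilbertBasis (Fin d → ℤ) ℂ (Lp ℂ 2 (haarTorus d)) := UnitAddTorus.mFourierBasis
  let N : Submodule ℂ (Lp ℂ 2 (haarTorus d)) :=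
    ⨅ k : {k : Fin d → ℤ // k i < 0}, (ℂ ∙ fourierTorus k.1)ᗮ
  have hN : ∀ u, u ∈ N ↔ ∀ k : Fin d → ℤ, k i < 0 → inner ℂ (fourierTorus k) u = 0 := by
    intro u
    simp [N, Submodule.mem_iInf, Submodule.mem_orthogonal_singleton_iff_inner_right]
  have hNc : IsClosed (N : Set (Lp ℂ 2 (haarTorus d))) := by
    simp only [N, Submodule.coe_iInf]
    exact isClosed_iInter fun k => Submodule.isClosed_orthogonal _
  have : CompleteSpace N := hNc.completeSpace_coe
  set W₁ := N.starProjection W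
  have hW₁ : W₁ ∈ N := Submodule.starProjection_apply_mem _ _
  have hW₂ : W - W₁ ∈ Nᗮ := Submodule.sub_starProjection_mem_orthogonal _
  have h1 : inner ℂ W₁ U = 0 := by
    have h := b.hasSum_inner_mul_inner W₁ U
    have h0 : (fun k => inner ℂ W₁ (b k) * inner ℂ (b k) U) = fun _ => 0 := by
      funext k
      change inner ℂ W₁ (fourierTorus k) * inner ℂ (fourierTorus k) U = 0
      rw [mul_eq_zero, inner_eq_zero_symm]
      by_cases hki : k i < 0
      · exact Or.inl ((hN _).1 hW₁ k hki)
      by_cases hkl : ∃ l, l ≠ i ∧ k l < 0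
      · obtain ⟨l, hl, hkl⟩ := hkl
        exact Or.inr (hU k l hl hkl)
      · left
        have hk : ∀ l, 0 ≤ k l := by
          intro l
          by_cases hl : l = i
          · rw [hl]
            exact not_lt.1 hki
          · by_contra! hlt
            exact hkl ⟨l, hl, hlt⟩
        -- In the positive orthant, `W` has no coefficient and `W - W₁` is orthogonal to this basis
        -- vector, so `W₁` has no coefficient either.
        have h2 : fourierTorus k ∈ N := by
          refine (hN _).2 fun k' hk' => ?_
          have hne : k' ≠ k := by
            rintro rfl
            exact hki hk'
          exact b.orthonormal.2 hne
        have h3 := Submodule.inner_right_of_mem_orthogonal h2 hW₂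
        rw [inner_sub_right, hW k hk, zero_sub, neg_eq_zero] at h3
        exact h3
    rw [h0] at h
    exact h.unique hasSum_zero
  have h2 : inner ℂ (W - W₁) V = 0 :=
    Submodule.inner_left_of_mem_orthogonal ((hN _).2 hV) hW₂
  have h3 : inner ℂ W U = inner ℂ (W - W₁) (U - V) := by
    rw [inner_sub_right, h2, sub_zero, inner_sub_left, h1, sub_zero]
  rw [h3]
  refine (norm_inner_le_norm _ _).trans (mul_le_mul_of_nonneg_right ?_ (norm_nonneg _))
  have h4 : W - W₁ = Nᗮ.starProjection W := by
    rw [Submodule.starProjection_orthogonal_val]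
  rw [h4]
  exact Submodule.norm_starProjection_apply_le _ _

end Torus

/-! ### The logarithm attached to a pair of variables -/

section PairLog

variable {d : ℕ}

/-- The function `log (1 - s (z̄_i z_j)^m)`. -/
noncomputable def pairLog (m : ℕ) (s : ℝ) (i j : Fin d) (z : Fin d → ℂ) : ℂ :=
  Complex.log (1 - s * (starRingEnd ℂ (z i) ^ m * z j ^ m))

theorem one_sub_mem_slitPlane {w : ℂ} (hw : ‖w‖ < 1) : 1 - w ∈ Complex.slitPlane := by
  left
  have := (Complex.abs_re_le_norm w).trans_lt hw
  rw [abs_lt] at this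
  simp only [Complex.sub_re, Complex.one_re]
  linarith

theorem norm_pairLog_arg_lt (m : ℕ) {s : ℝ} (hs : s ∈ Set.Ico (0 : ℝ) 1) {a b : ℂ} (ha : ‖a‖ ≤ 1)
    (hb : ‖b‖ ≤ 1) : ‖(s : ℂ) * (a ^ m * b ^ m)‖ < 1 := by
  rw [norm_mul, norm_mul, norm_pow, norm_pow, Complex.norm_real, Real.norm_of_nonneg hs.1]
  have h1 : ‖a‖ ^ m * ‖b‖ ^ m ≤ 1 :=
    mul_le_one₀ (pow_le_one₀ (norm_nonneg _) ha) (by positivity) (pow_le_one₀ (norm_nonneg _) hb)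
  nlinarith [hs.1, hs.2, mul_nonneg (pow_nonneg (norm_nonneg a) m) (pow_nonneg (norm_nonneg b) m)]

theorem conj_pairLog (m : ℕ) {s : ℝ} (hs : s ∈ Set.Ico (0 : ℝ) 1) (i j : Fin d) {z : Fin d → ℂ}
    (hz : ∀ i, ‖z i‖ ≤ 1) : starRingEnd ℂ (pairLog m s i j z) = pairLog m s j i z := by
  unfold pairLog
  rw [← Complex.log_conj]
  · congr 1
    simp only [map_sub, map_one, map_mul, map_pow, Complex.conj_conj, Complex.conj_ofReal]
    ring
  · exact Complex.slitPlane_arg_ne_pi (one_sub_mem_slitPlane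
      (norm_pairLog_arg_lt m hs (by simpa using hz i) (hz j)))

/-- Exchanging the indices conjugates the logarithm, so the difference is `2i` times an argument.
The bound is uniform in `s`, although the logarithms themselves are not bounded uniformly. -/
theorem norm_pairLog_sub_le (m : ℕ) {s : ℝ} (hs : s ∈ Set.Ico (0 : ℝ) 1) (i j : Fin d)
    {z : Fin d → ℂ} (hz : ∀ i, ‖z i‖ ≤ 1) :
    ‖pairLog m s i j z - pairLog m s j i z‖ ≤ 2 * Real.pi := by
  rw [← conj_pairLog m hs i j hz, Complex.sub_conj, norm_mul, Complex.norm_I, mul_one,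
    Complex.norm_real, Real.norm_eq_abs, abs_mul, abs_two, pairLog, Complex.log_im]
  have := Complex.abs_arg_le_pi (1 - s * (starRingEnd ℂ (z i) ^ m * z j ^ m))
  linarith

theorem continuous_pairLog_torusPt (m : ℕ) {s : ℝ} (hs : s ∈ Set.Ico (0 : ℝ) 1) (i j : Fin d) :
    Continuous fun x : UnitAddTorus (Fin d) => pairLog m s i j (torusPt x) := by
  have h (i : Fin d) : Continuous fun x : UnitAddTorus (Fin d) => torusPt x i :=
    (continuous_apply i).comp continuous_torusPt
  refine Continuous.clog ?_ fun x => one_sub_mem_slitPlane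
    (norm_pairLog_arg_lt m hs (by simp [norm_torusPt]) (norm_torusPt x j).le)
  have h1 := Complex.continuous_conj.comp (h i)
  have h2 := h j
  exact continuous_const.sub (continuous_const.mul ((h1.pow m).mul (h2.pow m)))

theorem torusPt_add_single (x : UnitAddTorus (Fin d)) (l : Fin d) (y : UnitAddCircle) :
    torusPt (x + (Pi.single l y : UnitAddTorus (Fin d))) =
      Function.update (torusPt x) l ((AddCircle.toCircle y : ℂ) * torusPt x l) := by
  ext k
  by_cases hk : k = l
  · subst hk
    simp [torusPt, AddCircle.toCircle_add, mul_comm]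
  · simp [torusPt, hk]

theorem norm_update_torusPt_le (x : UnitAddTorus (Fin d)) (l : Fin d) {w : ℂ} (hw : ‖w‖ ≤ 1)
    (k : Fin d) : ‖Function.update (torusPt x) l (w * torusPt x l) k‖ ≤ 1 := by
  by_cases hk : k = l
  · subst hk
    simpa [norm_torusPt] using hw
  · simp [hk, norm_torusPt]

theorem continuous_comp_torusPt {R : ℝ} (hR : 1 < R) {g : (Fin d → ℂ) → ℂ}
    (hg : DifferentiableOn ℂ g (Metric.ball 0 R)) :
    Continuous fun x : UnitAddTorus (Fin d) => g (torusPt x) := by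
  refine hg.continuousOn.comp_continuous continuous_torusPt fun x => ?_
  rw [mem_ball_zero_iff]
  refine lt_of_le_of_lt ?_ hR
  exact (pi_norm_le_iff_of_nonneg zero_le_one).2 fun i => (norm_torusPt x i).le

/-- The only conjugated variable in the symbol is the `i`-th, which stays fixed when the `l`-th one
moves; so the product is holomorphic along the `l`-th disc. -/
theorem integral_conj_mFourier_mul_pairLog {m : ℕ} {s : ℝ} (hs : s ∈ Set.Ico (0 : ℝ) 1)
    {i j l : Fin d} (hl : l ≠ i) {R : ℝ} (hR : 1 < R) {g : (Fin d → ℂ) → ℂ}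
    (hg : DifferentiableOn ℂ g (Metric.ball 0 R)) {k : Fin d → ℤ} (hk : k l < 0) :
    ∫ x, starRingEnd ℂ (UnitAddTorus.mFourier k x) *
      (pairLog m s i j (torusPt x) * g (torusPt x)) ∂haarTorus d = 0 := by
  refine integral_conj_mFourier_mul_eq_zero ((continuous_pairLog_torusPt m hs i j).mul
    (continuous_comp_torusPt hR hg)) l (fun x => ?_) hk
  let up : ℂ → Fin d → ℂ := fun w => Function.update (torusPt x) l (w * torusPt x l)
  have hup : Differentiable ℂ up := by
    refine differentiable_pi.2 fun k => ?_
    by_cases hk : k = l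
    · subst hk
      simp only [up, Function.update_self]
      fun_prop
    · simp only [up, Function.update_of_ne hk]
      fun_prop
  have hupi : ∀ w, up w i = torusPt x i := fun w => Function.update_of_ne hl.symm _ _
  refine ⟨fun w => pairLog m s i j (up w) * g (up w), DifferentiableOn.diffContOnCl ?_,
    fun y => by rw [Pi.mul_apply, torusPt_add_single]⟩
  rw [closure_ball _ one_ne_zero]
  have hle : ∀ w ∈ Metric.closedBall (0 : ℂ) 1, ∀ k, ‖up w k‖ ≤ 1 := fun w hw k =>
    norm_update_torusPt_le x l (by simpa using hw) k
  refine DifferentiableOn.mul ?_ ?_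
  · unfold pairLog
    simp only [hupi]
    refine DifferentiableOn.clog ?_ fun w hw => one_sub_mem_slitPlane
      (norm_pairLog_arg_lt m hs (by simp [norm_torusPt]) (hle w hw j))
    have h1 : Differentiable ℂ fun w => up w j := differentiable_pi.1 hup j
    exact (((h1.pow m).const_mul _).const_mul _ |>.const_sub 1).differentiableOn
  · refine hg.comp hup.differentiableOn fun w hw => ?_
    rw [mem_ball_zero_iff]
    exact lt_of_le_of_lt ((pi_norm_le_iff_of_nonneg zero_le_one).2 (hle w hw)) hR

/-- The Hankel operator with the unbounded symbol `log (1 - (z̄_i z_j)^m)` is bounded: the imaginary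
part of the symbol is. -/
theorem norm_integral_mul_pairLog_le {m : ℕ} {s : ℝ} (hs : s ∈ Set.Ico (0 : ℝ) 1)
    {i j : Fin d} (hij : i ≠ j) {R : ℝ} (hR : 1 < R) {g : (Fin d → ℂ) → ℂ}
    (hg : DifferentiableOn ℂ g (Metric.ball 0 R)) {W gL : Lp ℂ 2 (haarTorus d)}
    (hgL : gL =ᵐ[haarTorus d] fun x => g (torusPt x))
    (hW : ∀ k : Fin d → ℤ, (∀ l, 0 ≤ k l) → inner ℂ (fourierTorus k) W = 0) :
    ‖∫ x, starRingEnd ℂ (W x) * (pairLog m s i j (torusPt x) * g (torusPt x)) ∂haarTorus d‖ ≤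
      2 * Real.pi * ‖W‖ * ‖gL‖ := by
  have hc : ∀ i j, Continuous fun x => pairLog m s i j (torusPt x) * g (torusPt x) := fun i j =>
    (continuous_pairLog_torusPt m hs i j).mul (continuous_comp_torusPt hR hg)
  have hmem : ∀ i j, MemLp (fun x => pairLog m s i j (torusPt x) * g (torusPt x)) 2
      (haarTorus d) := fun i j => (hc i j).memLp_of_hasCompactSupport
        (HasCompactSupport.of_compactSpace _)
  have h0 : ∀ i j l : Fin d, l ≠ i → ∀ k : Fin d → ℤ, k l < 0 →
      inner ℂ (fourierTorus k) ((hmem i j).toLp _) = 0 := by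
    intro i j l hl k hk
    rw [inner_fourierTorus, ← integral_conj_mFourier_mul_pairLog (m := m) hs (j := j) hl hR hg hk]
    refine integral_congr_ae ?_
    filter_upwards [(hmem i j).coeFn_toLp] with x hx
    rw [hx]
  -- `V` is the product with the indices exchanged: it fails to be analytic only in the `j`-th
  -- variable, so it is analytic in the `i`-th.
  have h1 := norm_inner_le_mul_norm_sub i hW (U := (hmem i j).toLp _) (V := (hmem j i).toLp _)
    (fun k l hl hk => h0 i j l hl k hk) (fun k hk => h0 j i i hij k hk)
  have h2 : inner ℂ W ((hmem i j).toLp _) =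
      ∫ x, starRingEnd ℂ (W x) * (pairLog m s i j (torusPt x) * g (torusPt x)) ∂haarTorus d := by
    rw [MeasureTheory.L2.inner_def]
    refine integral_congr_ae ?_
    filter_upwards [(hmem i j).coeFn_toLp] with x hx
    rw [hx, RCLike.inner_apply, mul_comm]
  have h3 : ‖(hmem i j).toLp _ - (hmem j i).toLp _‖ ≤ 2 * Real.pi * ‖gL‖ := by
    refine Lp.norm_le_mul_norm_of_ae_le_mul ?_
    filter_upwards [(hmem i j).coeFn_toLp, (hmem j i).coeFn_toLp, hgL,
      Lp.coeFn_sub ((hmem i j).toLp _) ((hmem j i).toLp _)] with x hx1 hx2 hx3 hx4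
    rw [hx4, Pi.sub_apply, hx1, hx2, hx3, ← sub_mul, norm_mul]
    exact mul_le_mul_of_nonneg_right
      (norm_pairLog_sub_le m hs i j fun i => (norm_torusPt x i).le) (norm_nonneg _)
  rw [← h2]
  refine h1.trans ((mul_le_mul_of_nonneg_left h3 (norm_nonneg _)).trans_eq ?_)
  ring

end PairLog

/-! ### Square integrability of the logarithm on the circle -/

section LogIntegrability

/-- With `σ = τ / 2 ≤ 1`, one has `|log σ| σ^{1/4} < 4`, and `log 2 ≤ 1` raises the constant to `5`;
the `25` is its square. The exponent `-1/2` is integrable at the origin. -/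
theorem sq_log_le_rpow {τ : ℝ} (h0 : 0 < τ) (h2 : τ ≤ 2) :
    Real.log τ ^ 2 ≤ 25 * (τ / 2) ^ (-(1 / 2) : ℝ) := by
  set σ := τ / 2 with hσ
  have hσ0 : 0 < σ := by positivity
  have hσ1 : σ ≤ 1 := by rw [hσ]; linarith
  have h1 := Real.abs_log_mul_self_rpow_lt σ (1 / 4) hσ0 hσ1 (by norm_num)
  have hp : 0 < σ ^ (1 / 4 : ℝ) := Real.rpow_pos_of_pos hσ0 _
  have hp1 : σ ^ (1 / 4 : ℝ) ≤ 1 := Real.rpow_le_one hσ0.le hσ1 (by norm_num)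
  rw [abs_mul, abs_of_pos hp] at h1
  have h3 : Real.log τ = Real.log σ + Real.log 2 := by
    rw [← Real.log_mul hσ0.ne' two_ne_zero, hσ]
    congr 1
    ring
  have h4 : |Real.log τ| * σ ^ (1 / 4 : ℝ) ≤ 5 := by
    have h5 : |Real.log τ| ≤ |Real.log σ| + 1 := by
      rw [h3]
      refine (abs_add_le _ _).trans ?_
      rw [abs_of_pos (Real.log_pos one_lt_two)]
      linarith [Real.log_two_lt_d9]
    nlinarith
  have h7 : σ ^ (-(1 / 2) : ℝ) * (σ ^ (1 / 4 : ℝ)) ^ 2 = 1 := by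
    rw [← Real.rpow_natCast, ← Real.rpow_mul hσ0.le, ← Real.rpow_add hσ0]
    norm_num
  have h8 : Real.log τ ^ 2 * (σ ^ (1 / 4 : ℝ)) ^ 2 ≤ 25 := by
    rw [← mul_pow, ← sq_abs, abs_mul, abs_of_pos hp]
    have := abs_nonneg (Real.log τ)
    nlinarith [mul_nonneg this hp.le]
  have h9 : 0 < σ ^ (-(1 / 2) : ℝ) := Real.rpow_pos_of_pos hσ0 _
  calc Real.log τ ^ 2 = (Real.log τ ^ 2 * (σ ^ (1 / 4 : ℝ)) ^ 2) * σ ^ (-(1 / 2) : ℝ) := by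
        rw [mul_assoc, mul_comm ((σ ^ (1 / 4 : ℝ)) ^ 2), h7, mul_one]
    _ ≤ 25 * σ ^ (-(1 / 2) : ℝ) := mul_le_mul_of_nonneg_right h8 h9.le

/-- The norm is `2 |sin (π x)|`, and `|sin (π x)| ≥ 2 |x|` on this interval by concavity of the
sine. -/
theorem sq_log_norm_one_sub_toCircle_le {x : ℝ} (hx : |x| ≤ 1 / 2) :
    Real.log ‖(1 : ℂ) - (AddCircle.toCircle (x : UnitAddCircle) : ℂ)‖ ^ 2 ≤
      25 * |x| ^ (-(1 / 2) : ℝ) := by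
  have hnorm : ‖(1 : ℂ) - (AddCircle.toCircle (x : UnitAddCircle) : ℂ)‖ =
      2 * |Real.sin (Real.pi * x)| := by
    rw [norm_sub_rev, AddCircle.toCircle_apply_mk, Circle.coe_exp, mul_comm _ Complex.I,
      Complex.norm_exp_I_mul_ofReal_sub_one, norm_mul, Real.norm_eq_abs, Real.norm_eq_abs, abs_two]
    congr 3
    ring
  rw [hnorm]
  -- At `x = 0` both sides vanish by the conventions for `log 0` and for negative powers of `0`.
  rcases eq_or_ne x 0 with rfl | hx0
  · simp
  have hx1 : 0 < |x| := abs_pos.2 hx0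
  have h1 : 2 * |x| ≤ |Real.sin (Real.pi * x)| := by
    have h := Real.mul_abs_le_abs_sin (x := Real.pi * x) (by
      rw [abs_mul, abs_of_pos Real.pi_pos]
      nlinarith [Real.pi_pos])
    rw [abs_mul, abs_of_pos Real.pi_pos] at h
    have h2 : 2 / Real.pi * (Real.pi * |x|) = 2 * |x| := by
      have := Real.pi_pos.ne'
      field_simp
    rwa [h2] at h
  have h2 := Real.abs_sin_le_one (Real.pi * x)
  refine (sq_log_le_rpow (by linarith) (by linarith)).trans ?_
  rw [mul_div_cancel_left₀ _ (two_ne_zero)]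
  refine mul_le_mul_of_nonneg_left ?_ (by norm_num)
  exact Real.rpow_le_rpow_of_nonpos hx1 (by linarith) (by norm_num)

theorem memLp_log_norm_one_sub_toCircle :
    MemLp (fun y : UnitAddCircle => Real.log ‖(1 : ℂ) - (AddCircle.toCircle y : ℂ)‖) 2
      AddCircle.haarAddCircle := by
  have hmeas : Measurable fun y : UnitAddCircle =>
      Real.log ‖(1 : ℂ) - (AddCircle.toCircle y : ℂ)‖ :=
    Real.measurable_log.comp (continuous_const.sub
      (continuous_subtype_val.comp AddCircle.continuous_toCircle)).norm.measurable
  have hvol : (AddCircle.haarAddCircle : Measure UnitAddCircle) = volume := by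
    rw [AddCircle.volume_eq_smul_haarAddCircle]
    simp
  have hmp := UnitAddCircle.measurePreserving_mk (-(1 / 2))
  rw [hvol, ← hmp.map_eq, memLp_map_measure_iff hmeas.aestronglyMeasurable
    hmp.measurable.aemeasurable]
  have hcomp := (hmeas.comp hmp.measurable).aestronglyMeasurable
    (μ := volume.restrict (Set.Ioc (-(1 / 2) : ℝ) (-(1 / 2) + 1)))
  rw [memLp_two_iff_integrable_sq hcomp]
  have hintg : IntegrableOn (fun x : ℝ => 25 * |x| ^ (-(1 / 2) : ℝ))
      (Set.Ioc (-(1 / 2)) (-(1 / 2) + 1)) := by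
    refine ((intervalIntegrable_of_even (f := fun x : ℝ => |x| ^ (-(1 / 2) : ℝ))
      (fun x => by rw [abs_neg]) (fun x hx => ?_)).const_mul 25).1
    refine (intervalIntegral.intervalIntegrable_rpow' (r := -(1 / 2)) (by norm_num)).congr ?_
    intro y hy
    rw [Set.uIoc_of_le hx.le] at hy
    simp only [abs_of_pos hy.1]
  refine Integrable.mono' hintg (hcomp.pow 2) ?_
  refine (ae_restrict_mem measurableSet_Ioc).mono fun x hx => ?_
  rw [Real.norm_of_nonneg (by positivity)]
  refine sq_log_norm_one_sub_toCircle_le (abs_le.2 ⟨hx.1.le, ?_⟩)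
  have := hx.2
  linarith

end LogIntegrability

/-! ### Transfer from the circle to pairs of torus variables -/

section PairHom

variable {d : ℕ}

/-- The homomorphism `x ↦ m (x_j - x_i)` from the torus to the circle. -/
def pairHom (m : ℕ) (i j : Fin d) : UnitAddTorus (Fin d) →+ UnitAddCircle where
  toFun x := m • (x j - x i)
  map_zero' := by simp
  map_add' x y := by
    rw [← smul_add]
    congr 1
    simp only [Pi.add_apply]
    abel

/-- A continuous surjective homomorphism of compact groups carries normalized Haar measure to
normalized Haar measure; surjectivity already holds on the `j`-th coordinate circle, by division by
`m`. -/
theorem measurePreserving_pairHom {m : ℕ} (hm : 0 < m) {i j : Fin d} (hij : i ≠ j) :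
    MeasurePreserving (pairHom m i j) (haarTorus d) AddCircle.haarAddCircle := by
  refine AddMonoidHom.measurePreserving ?_ ?_ (by simp)
  · exact ((continuous_apply j).sub (continuous_apply i)).nsmul m
  · intro y
    induction y using QuotientAddGroup.induction_on with
    | H r =>
      refine ⟨Pi.single j ((r / m : ℝ) : UnitAddCircle), ?_⟩
      change m • ((Pi.single j ((r / m : ℝ) : UnitAddCircle) : UnitAddTorus (Fin d)) j -
        (Pi.single j ((r / m : ℝ) : UnitAddCircle) : UnitAddTorus (Fin d)) i) = (r : UnitAddCircle)
      rw [Pi.single_eq_same, Pi.single_eq_of_ne hij, sub_zero, ← AddCircle.coe_nsmul]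
      congr 1
      rw [nsmul_eq_mul, mul_div_cancel₀]
      exact_mod_cast hm.ne'

theorem toCircle_pairHom (m : ℕ) (i j : Fin d) (x : UnitAddTorus (Fin d)) :
    (AddCircle.toCircle (pairHom m i j x) : ℂ) =
      starRingEnd ℂ (torusPt x i) ^ m * torusPt x j ^ m := by
  change (AddCircle.toCircle (m • (x j - x i)) : ℂ) = _
  rw [AddCircle.toCircle_nsmul, sub_eq_add_neg, AddCircle.toCircle_add, AddCircle.toCircle_neg,
    Circle.coe_pow, Circle.coe_mul, Circle.coe_inv_eq_conj, ← mul_pow, mul_comm]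
  rfl

/-- The exceptional set is the preimage of a point of the circle under a measure preserving map. -/
theorem ae_conj_mul_ne_one {m : ℕ} (hm : 0 < m) {i j : Fin d} (hij : i ≠ j) :
    ∀ᵐ x ∂haarTorus d, starRingEnd ℂ (torusPt x i) ^ m * torusPt x j ^ m ≠ 1 := by
  have h : ∀ᵐ y : UnitAddCircle ∂AddCircle.haarAddCircle, y ≠ 0 := by
    have hvol : (AddCircle.haarAddCircle : Measure UnitAddCircle) = volume := by
      rw [AddCircle.volume_eq_smul_haarAddCircle]
      simp
    rw [ae_iff]
    simp only [not_not, Set.ofPred_eq_eq_singleton, hvol]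
    have h1 := AddCircle.volume_closedBall (T := 1) (x := 0) 0
    rw [Metric.closedBall_zero] at h1
    rw [h1]
    simp
  have h1 := (measurePreserving_pairHom hm hij).quasiMeasurePreserving.ae h
  filter_upwards [h1] with x hx
  rw [← toCircle_pairHom]
  intro h2
  apply hx
  have h3 : AddCircle.toCircle (pairHom m i j x) = AddCircle.toCircle (0 : UnitAddCircle) := by
    rw [AddCircle.toCircle_zero]
    exact Circle.ext h2
  exact AddCircle.injective_toCircle one_ne_zero h3

theorem memLp_log_norm_pair {m : ℕ} (hm : 0 < m) {i j : Fin d} (hij : i ≠ j) :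
    MemLp (fun x : UnitAddTorus (Fin d) =>
      Real.log ‖1 - starRingEnd ℂ (torusPt x i) ^ m * torusPt x j ^ m‖) 2 (haarTorus d) := by
  have h := memLp_log_norm_one_sub_toCircle.comp_measurePreserving
    (measurePreserving_pairHom hm hij)
  refine MemLp.ae_eq (ae_of_all _ fun x => ?_) h
  rw [Function.comp_apply, toCircle_pairHom]

end PairHom

theorem norm_sq_eq_integral {α : Type*} [MeasurableSpace α] {μ : Measure α} (u : Lp ℂ 2 μ) :
    ‖u‖ ^ 2 = ∫ x, ‖u x‖ ^ 2 ∂μ := by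
  have h := @inner_self_eq_norm_sq ℂ _ _ _ _ u
  rw [MeasureTheory.L2.inner_def, ← integral_re (MeasureTheory.L2.integrable_inner u u)] at h
  rw [← h]
  exact integral_congr_ae (ae_of_all _ fun x => inner_self_eq_norm_sq (𝕜 := ℂ) (u x))

/-! ### The logarithm of the discriminant as a Hankel symbol -/

section LogSum

variable {d : ℕ}

/-- `∑_{i ≠ j} log |1 - s (z̄_i z_j)^m|`. -/
noncomputable def logSum (m : ℕ) (s : ℝ) (z : Fin d → ℂ) : ℝ :=
  ∑ p ∈ (Finset.univ : Finset (Fin d)).offDiag,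
    Real.log ‖1 - s * (starRingEnd ℂ (z p.1) ^ m * z p.2 ^ m)‖

/-- Exchanging the two indices conjugates each summand, so the sum over ordered pairs is real and
equals its real part. -/
theorem sum_pairLog_eq (m : ℕ) {s : ℝ} (hs : s ∈ Set.Ico (0 : ℝ) 1) {z : Fin d → ℂ}
    (hz : ∀ i, ‖z i‖ ≤ 1) :
    ∑ p ∈ (Finset.univ : Finset (Fin d)).offDiag, pairLog m s p.1 p.2 z = logSum m s z := by
  have h1 : ∑ p ∈ (Finset.univ : Finset (Fin d)).offDiag, pairLog m s p.1 p.2 z =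
      ∑ p ∈ (Finset.univ : Finset (Fin d)).offDiag, starRingEnd ℂ (pairLog m s p.1 p.2 z) := by
    refine Finset.sum_nbij' Prod.swap Prod.swap ?_ ?_ (fun _ _ => rfl) (fun _ _ => rfl) ?_
    · intro p hp
      simpa [eq_comm] using hp
    · intro p hp
      simpa [eq_comm] using hp
    · intro p _
      rw [conj_pairLog m hs _ _ hz]
      rfl
  have h2 : ∀ p : Fin d × Fin d, (pairLog m s p.1 p.2 z).re =
      Real.log ‖1 - s * (starRingEnd ℂ (z p.1) ^ m * z p.2 ^ m)‖ := fun p => Complex.log_re _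
  have h3 : (∑ p ∈ (Finset.univ : Finset (Fin d)).offDiag, pairLog m s p.1 p.2 z).re =
      logSum m s z := by
    rw [Complex.re_sum]
    exact Finset.sum_congr rfl fun p _ => h2 p
  rw [← map_sum] at h1
  rw [← h3]
  exact (Complex.conj_eq_iff_re.1 h1.symm).symm

/-- Supplies a majorant independent of `s`: since `1 - s ≤ ‖1 - s w‖`, the triangle inequality gives
`‖1 - w‖ ≤ 2 ‖1 - s w‖`, so the logarithm cannot be much more negative than at `s = 1`. -/
theorem abs_log_norm_one_sub_le {s : ℝ} (hs : s ∈ Set.Ico (0 : ℝ) 1) {w : ℂ} (hw : ‖w‖ = 1)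
    (hw1 : w ≠ 1) :
    |Real.log ‖1 - (s : ℂ) * w‖| ≤ Real.log 2 + |Real.log ‖1 - w‖| := by
  have hsw : ‖(s : ℂ) * w‖ = s := by
    rw [norm_mul, hw, mul_one, Complex.norm_real, Real.norm_of_nonneg hs.1]
  have h1 : 1 - s ≤ ‖1 - (s : ℂ) * w‖ := by
    have := norm_sub_norm_le 1 ((s : ℂ) * w)
    rwa [norm_one, hsw] at this
  have h2 : ‖1 - (s : ℂ) * w‖ ≤ 2 := by
    have := norm_sub_le 1 ((s : ℂ) * w)
    rw [norm_one, hsw] at this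
    linarith [hs.2]
  have h3 : ‖1 - w‖ ≤ 2 * ‖1 - (s : ℂ) * w‖ := by
    have h4 : 1 - w = (1 - (s : ℂ) * w) - ((1 - s : ℝ) : ℂ) * w := by push_cast; ring
    have h5 := norm_sub_le (1 - (s : ℂ) * w) (((1 - s : ℝ) : ℂ) * w)
    rw [← h4, norm_mul, hw, mul_one, Complex.norm_real,
      Real.norm_of_nonneg (by linarith [hs.2])] at h5
    linarith
  have h0 : 0 < ‖1 - w‖ := norm_pos_iff.2 (sub_ne_zero.2 hw1.symm)
  have h0' : 0 < ‖1 - (s : ℂ) * w‖ := by linarith [hs.2]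
  have h6 := Real.log_le_log h0 h3
  rw [Real.log_mul two_ne_zero h0'.ne'] at h6
  have h7 := Real.log_le_log h0' h2
  have h8 := neg_abs_le (Real.log ‖1 - w‖)
  have h9 := abs_nonneg (Real.log ‖1 - w‖)
  rw [abs_le]
  constructor <;> linarith

theorem norm_conj_pow_mul_pow (m : ℕ) (i j : Fin d) (x : UnitAddTorus (Fin d)) :
    ‖starRingEnd ℂ (torusPt x i) ^ m * torusPt x j ^ m‖ = 1 := by
  simp [norm_torusPt]

theorem ae_forall_offDiag_ne_one {m : ℕ} (hm : 0 < m) : ∀ᵐ x ∂haarTorus d,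
    ∀ p ∈ (Finset.univ : Finset (Fin d)).offDiag,
      starRingEnd ℂ (torusPt x p.1) ^ m * torusPt x p.2 ^ m ≠ 1 := by
  rw [Finset.eventually_all]
  intro p hp
  exact ae_conj_mul_ne_one hm (Finset.mem_offDiag.1 hp).2.2

theorem memLp_sum_abs_log {m : ℕ} (hm : 0 < m) :
    MemLp (fun x : UnitAddTorus (Fin d) => ∑ p ∈ (Finset.univ : Finset (Fin d)).offDiag,
      (Real.log 2 + |Real.log ‖1 - starRingEnd ℂ (torusPt x p.1) ^ m * torusPt x p.2 ^ m‖|)) 2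
      (haarTorus d) := by
  refine memLp_finsetSum _ fun p hp => ?_
  exact MemLp.add (f := fun _ => Real.log 2) (memLp_const _)
    (memLp_log_norm_pair hm (Finset.mem_offDiag.1 hp).2.2).norm

theorem abs_logSum_le {m : ℕ} {s : ℝ} (hs : s ∈ Set.Ico (0 : ℝ) 1) {x : UnitAddTorus (Fin d)}
    (hx : ∀ p ∈ (Finset.univ : Finset (Fin d)).offDiag,
      starRingEnd ℂ (torusPt x p.1) ^ m * torusPt x p.2 ^ m ≠ 1) :
    |logSum m s (torusPt x)| ≤ ∑ p ∈ (Finset.univ : Finset (Fin d)).offDiag,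
      (Real.log 2 + |Real.log ‖1 - starRingEnd ℂ (torusPt x p.1) ^ m * torusPt x p.2 ^ m‖|) :=
  (Finset.abs_sum_le_sum_abs _ _).trans (Finset.sum_le_sum fun p hp =>
    abs_log_norm_one_sub_le hs (norm_conj_pow_mul_pow m p.1 p.2 x) (hx p hp))

theorem measurable_logSum (m : ℕ) (s : ℝ) :
    Measurable fun x : UnitAddTorus (Fin d) => logSum m s (torusPt x) := by
  unfold logSum
  refine Finset.measurable_fun_sum _ fun p _ => Real.measurable_log.comp (Continuous.measurable ?_)
  have h (i : Fin d) : Continuous fun x : UnitAddTorus (Fin d) => torusPt x i :=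
    (continuous_apply i).comp continuous_torusPt
  exact (continuous_const.sub (continuous_const.mul
    (((Complex.continuous_conj.comp (h p.1)).pow m).mul ((h p.2).pow m)))).norm

theorem memLp_logSum {m : ℕ} (hm : 0 < m) :
    MemLp (fun x : UnitAddTorus (Fin d) => logSum m 1 (torusPt x)) 2 (haarTorus d) := by
  refine (memLp_sum_abs_log hm).mono (measurable_logSum m 1).aestronglyMeasurable
    (ae_of_all _ fun x => ?_)
  rw [Real.norm_eq_abs, Real.norm_eq_abs]
  refine ((Finset.abs_sum_le_sum_abs _ _).trans (Finset.sum_le_sum fun p _ => ?_)).trans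
    (le_abs_self _)
  rw [Complex.ofReal_one, one_mul]
  linarith [Real.log_pos one_lt_two]

theorem tendsto_logSum {m : ℕ} {x : UnitAddTorus (Fin d)}
    (hx : ∀ p ∈ (Finset.univ : Finset (Fin d)).offDiag,
      starRingEnd ℂ (torusPt x p.1) ^ m * torusPt x p.2 ^ m ≠ 1) :
    Tendsto (fun s : ℝ => logSum m s (torusPt x)) (𝓝[<] 1) (𝓝 (logSum m 1 (torusPt x))) := by
  unfold logSum
  refine tendsto_finsetSum _ fun p hp => ?_
  have h0 : ‖1 - ((1 : ℝ) : ℂ) * (starRingEnd ℂ (torusPt x p.1) ^ m * torusPt x p.2 ^ m)‖ ≠ 0 := by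
    rw [Complex.ofReal_one, one_mul, norm_ne_zero_iff, sub_ne_zero]
    exact (hx p hp).symm
  refine Tendsto.log ?_ h0
  refine Tendsto.mono_left ?_ (nhdsWithin_le_nhds (s := Set.Iio 1))
  exact (continuous_const.sub (Complex.continuous_ofReal.mul continuous_const)).norm.tendsto 1

/-- The Hankel operator whose symbol is the logarithm of the discriminant is bounded. -/
theorem norm_integral_mul_logSum_le {m : ℕ} (hm : 0 < m) {W G : Lp ℂ 2 (haarTorus d)}
    (hW : ∀ k : Fin d → ℤ, (∀ l, 0 ≤ k l) → inner ℂ (fourierTorus k) W = 0)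
    {g : ℝ → (Fin d → ℂ) → ℂ} {B : ℝ}
    (hg : ∀ r ∈ Set.Ioo (0 : ℝ) 1, DifferentiableOn ℂ (g r) (Metric.ball 0 r⁻¹))
    (hgB : ∀ r ∈ Set.Ioo (0 : ℝ) 1, ∀ x : UnitAddTorus (Fin d), ‖g r (torusPt x)‖ ≤ B)
    {g₁ : UnitAddTorus (Fin d) → ℂ}
    (hg₁ : ∀ x, Tendsto (fun r => g r (torusPt x)) (𝓝[<] 1) (𝓝 (g₁ x)))
    (hG : G =ᵐ[haarTorus d] g₁) :
    ‖∫ x, starRingEnd ℂ (W x) * ((logSum m 1 (torusPt x) : ℂ) * g₁ x) ∂haarTorus d‖ ≤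
      (Finset.univ : Finset (Fin d)).offDiag.card * (2 * Real.pi) * ‖W‖ * ‖G‖ := by
  have hev : ∀ᶠ r : ℝ in 𝓝[<] 1, r ∈ Set.Ioo (0 : ℝ) 1 := Ioo_mem_nhdsLT zero_lt_one
  have hcont : ∀ r ∈ Set.Ioo (0 : ℝ) 1,
      Continuous fun x : UnitAddTorus (Fin d) => g r (torusPt x) := fun r hr =>
    continuous_comp_torusPt ((one_lt_inv₀ hr.1).2 hr.2) (hg r hr)
  have hmem : ∀ r ∈ Set.Ioo (0 : ℝ) 1, MemLp (fun x => g r (torusPt x)) 2 (haarTorus d) :=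
    fun r hr => (hcont r hr).memLp_of_hasCompactSupport (HasCompactSupport.of_compactSpace _)
  -- The same `r` regularizes the symbol and indexes `g`, so the estimate for pairs applies termwise
  -- and only one limit remains to be taken.
  have hbound : ∀ r ∈ Set.Ioo (0 : ℝ) 1,
      ‖∫ x, starRingEnd ℂ (W x) * ((logSum m r (torusPt x) : ℂ) * g r (torusPt x)) ∂haarTorus d‖ ≤
      (Finset.univ : Finset (Fin d)).offDiag.card * (2 * Real.pi) * ‖W‖ *
        Real.sqrt (∫ x, ‖g r (torusPt x)‖ ^ 2 ∂haarTorus d) := by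
    intro r hr
    have hr' : r ∈ Set.Ico (0 : ℝ) 1 := ⟨hr.1.le, hr.2⟩
    have hnorm : ‖(hmem r hr).toLp _‖ = Real.sqrt (∫ x, ‖g r (torusPt x)‖ ^ 2 ∂haarTorus d) := by
      rw [← Real.sqrt_sq (norm_nonneg ((hmem r hr).toLp _)), norm_sq_eq_integral]
      congr 1
      refine integral_congr_ae ?_
      filter_upwards [(hmem r hr).coeFn_toLp] with x hx
      rw [hx]
    have hsum : ∀ x : UnitAddTorus (Fin d),
        starRingEnd ℂ (W x) * ((logSum m r (torusPt x) : ℂ) * g r (torusPt x)) =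
        ∑ p ∈ (Finset.univ : Finset (Fin d)).offDiag, starRingEnd ℂ (W x) *
          (pairLog m r p.1 p.2 (torusPt x) * g r (torusPt x)) := fun x => by
      rw [← sum_pairLog_eq m hr' fun i => (norm_torusPt x i).le, Finset.sum_mul, Finset.mul_sum]
    simp only [hsum]
    rw [integral_finsetSum]
    · refine (norm_sum_le _ _).trans ?_
      rw [← hnorm, mul_assoc, mul_assoc, ← nsmul_eq_mul]
      refine Finset.sum_le_card_nsmul _ _ _ fun p hp => ?_
      rw [← mul_assoc]
      exact norm_integral_mul_pairLog_le hr' (Finset.mem_offDiag.1 hp).2.2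
        ((one_lt_inv₀ hr.1).2 hr.2) (hg r hr) (hmem r hr).coeFn_toLp hW
    · intro p hp
      have h1 : MemLp (fun x => pairLog m r p.1 p.2 (torusPt x) * g r (torusPt x)) 2
          (haarTorus d) := ((continuous_pairLog_torusPt m hr' p.1 p.2).mul
            (hcont r hr)).memLp_of_hasCompactSupport (HasCompactSupport.of_compactSpace _)
      exact (Lp.memLp W).star.integrable_mul h1
  have hB : 0 ≤ B := (norm_nonneg _).trans (hgB (1 / 2) ⟨by norm_num, by norm_num⟩ 0)
  -- The majorant is a product of two square integrable functions, `‖W‖` and a sum of logarithms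
  -- times `B`.
  have hlim1 : Tendsto (fun r : ℝ => ∫ x, starRingEnd ℂ (W x) *
      ((logSum m r (torusPt x) : ℂ) * g r (torusPt x)) ∂haarTorus d) (𝓝[<] 1)
      (𝓝 (∫ x, starRingEnd ℂ (W x) * ((logSum m 1 (torusPt x) : ℂ) * g₁ x) ∂haarTorus d)) := by
    refine tendsto_integral_filter_of_dominated_convergence
      (fun x => ‖W x‖ * ((∑ p ∈ (Finset.univ : Finset (Fin d)).offDiag, (Real.log 2 +
        |Real.log ‖1 - starRingEnd ℂ (torusPt x p.1) ^ m * torusPt x p.2 ^ m‖|)) * B)) ?_ ?_ ?_ ?_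
    · filter_upwards [hev] with r hr
      exact (Lp.memLp W).star.aestronglyMeasurable.mul
        ((Complex.measurable_ofReal.comp (measurable_logSum m r)).aestronglyMeasurable.mul
          (hcont r hr).aestronglyMeasurable)
    · filter_upwards [hev] with r hr
      filter_upwards [ae_forall_offDiag_ne_one hm] with x hx
      rw [norm_mul, RCLike.norm_conj, norm_mul, Complex.norm_real, Real.norm_eq_abs]
      refine mul_le_mul_of_nonneg_left ?_ (norm_nonneg _)
      exact mul_le_mul (abs_logSum_le ⟨hr.1.le, hr.2⟩ hx) (hgB r hr x) (norm_nonneg _)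
        ((abs_nonneg _).trans (abs_logSum_le ⟨hr.1.le, hr.2⟩ hx))
    · exact (Lp.memLp W).norm.integrable_mul ((memLp_sum_abs_log hm).mul_const B)
    · filter_upwards [ae_forall_offDiag_ne_one hm] with x hx
      refine Tendsto.const_mul _ (Tendsto.mul ?_ (hg₁ x))
      exact (Complex.continuous_ofReal.tendsto _).comp (tendsto_logSum hx)
  have hlim2 : Tendsto (fun r : ℝ => ∫ x, ‖g r (torusPt x)‖ ^ 2 ∂haarTorus d) (𝓝[<] 1)
      (𝓝 (∫ x, ‖g₁ x‖ ^ 2 ∂haarTorus d)) := by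
    refine tendsto_integral_filter_of_dominated_convergence (fun _ => B ^ 2) ?_ ?_
      (integrable_const _) ?_
    · filter_upwards [hev] with r hr
      exact ((hcont r hr).norm.pow 2).aestronglyMeasurable
    · filter_upwards [hev] with r hr
      refine ae_of_all _ fun x => ?_
      rw [Real.norm_of_nonneg (by positivity)]
      exact pow_le_pow_left₀ (norm_nonneg _) (hgB r hr x) 2
    · exact ae_of_all _ fun x => (hg₁ x).norm.pow 2
  have hGn : ‖G‖ = Real.sqrt (∫ x, ‖g₁ x‖ ^ 2 ∂haarTorus d) := by
    rw [← Real.sqrt_sq (norm_nonneg G), norm_sq_eq_integral]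
    congr 1
    refine integral_congr_ae ?_
    filter_upwards [hG] with x hx
    rw [hx]
  rw [hGn]
  refine le_of_tendsto_of_tendsto hlim1.norm
    (((Real.continuous_sqrt.tendsto _).comp hlim2).const_mul _) ?_
  filter_upwards [hev] with r hr
  exact hbound r hr

end LogSum

/-! ### Lifting from `μ_{ρ,θ}` to the torus -/

section Mu

variable {d : ℕ} (m t : ℕ) (ℓ : MvPolynomial (Fin d) ℂ)

theorem continuous_eval_torusPt :
    Continuous fun x : UnitAddTorus (Fin d) => MvPolynomial.eval (torusPt x) ℓ :=
  (MvPolynomial.continuous_eval ℓ).comp continuous_torusPt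

theorem continuous_theta_torusPt :
    Continuous fun x : UnitAddTorus (Fin d) => theta m t d (torusPt x) :=
  (continuous_theta m t d).comp continuous_torusPt

theorem measurable_density :
    Measurable fun x : UnitAddTorus (Fin d) => ‖MvPolynomial.eval (torusPt x) ℓ‖ₑ ^ 2 :=
  (continuous_eval_torusPt ℓ).measurable.enorm.pow_const 2

instance isFiniteMeasure_weightedTorus : IsFiniteMeasure (weightedTorus ℓ) := by
  refine isFiniteMeasure_withDensity ?_
  have h : Integrable (fun x => MvPolynomial.eval (torusPt x) ℓ ^ 2) (haarTorus d) :=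
    ((continuous_eval_torusPt ℓ).pow 2).integrable_of_hasCompactSupport
      (HasCompactSupport.of_compactSpace _)
  have := h.2.ne
  simpa [HasFiniteIntegral, enorm_pow] using this

variable {m t}

theorem card_G_ne_zero (hm : 0 < m) : Nat.card (G m t d) ≠ 0 := by
  have := finite_G (t := t) (d := d) hm
  exact Nat.card_pos.ne'

theorem isFiniteMeasure_mu (hm : 0 < m) : IsFiniteMeasure (mu m t ℓ) := by
  unfold mu
  exact Measure.smul_finite _ (ENNReal.inv_ne_top.2 (by exact_mod_cast card_G_ne_zero hm))

variable {E : Type*} [NormedAddCommGroup E] [NormedSpace ℝ E]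

theorem integrable_mu_iff (hm : 0 < m) {f : (Fin d → ℂ) → E} (hf : StronglyMeasurable f) :
    Integrable f (mu m t ℓ) ↔ Integrable (fun x =>
      ‖MvPolynomial.eval (torusPt x) ℓ‖ ^ 2 • f (theta m t d (torusPt x))) (haarTorus d) := by
  have hc : (Nat.card (G m t d) : ℝ≥0∞) ≠ 0 := by exact_mod_cast card_G_ne_zero hm
  rw [mu, integrable_smul_measure (ENNReal.inv_ne_zero.2 (ENNReal.natCast_ne_top _))
    (ENNReal.inv_ne_top.2 hc), integrable_map_measure hf.aestronglyMeasurable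
    (continuous_theta_torusPt m t).aemeasurable, weightedTorus,
    integrable_withDensity_iff_integrable_smul' (measurable_density ℓ)
      (ae_of_all _ fun x => by finiteness)]
  simp

theorem integral_mu {f : (Fin d → ℂ) → E} (hf : StronglyMeasurable f) :
    ∫ p, f p ∂mu m t ℓ = (Nat.card (G m t d) : ℝ)⁻¹ • ∫ x,
      ‖MvPolynomial.eval (torusPt x) ℓ‖ ^ 2 • f (theta m t d (torusPt x)) ∂haarTorus d := by
  rw [mu, integral_smul_measure, integral_map (continuous_theta_torusPt m t).aemeasurable
    hf.aestronglyMeasurable, weightedTorus,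
    integral_withDensity_eq_integral_toReal_smul (measurable_density ℓ)
      (ae_of_all _ fun x => by finiteness)]
  simp

theorem memLp_mu_iff (hm : 0 < m) {f : (Fin d → ℂ) → ℂ} (hf : StronglyMeasurable f) :
    MemLp f 2 (mu m t ℓ) ↔ MemLp (fun x =>
      MvPolynomial.eval (torusPt x) ℓ * f (theta m t d (torusPt x))) 2 (haarTorus d) := by
  have hm' : AEStronglyMeasurable (fun x =>
      MvPolynomial.eval (torusPt x) ℓ * f (theta m t d (torusPt x))) (haarTorus d) :=
    ((continuous_eval_torusPt ℓ).stronglyMeasurable.mul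
      (hf.comp_measurable (continuous_theta_torusPt m t).measurable)).aestronglyMeasurable
  rw [memLp_two_iff_integrable_sq_norm hf.aestronglyMeasurable,
    memLp_two_iff_integrable_sq_norm hm',
    integrable_mu_iff ℓ hm (f := fun x => ‖f x‖ ^ 2) (hf.norm.pow 2)]
  simp [mul_pow]

/-- The function `ℓ · (w ∘ θ)` in `L²(𝕋^d)`, for `w ∈ L²(μ_{ρ,θ})`. -/
noncomputable def liftLp (hm : 0 < m) (w : Lp ℂ 2 (mu m t ℓ)) : Lp ℂ 2 (haarTorus d) :=
  MemLp.toLp _ ((memLp_mu_iff ℓ hm (Lp.stronglyMeasurable w)).1 (Lp.memLp w))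

theorem coeFn_liftLp (hm : 0 < m) (w : Lp ℂ 2 (mu m t ℓ)) :
    liftLp ℓ hm w =ᵐ[haarTorus d] fun x =>
      MvPolynomial.eval (torusPt x) ℓ * w (theta m t d (torusPt x)) := MemLp.coeFn_toLp _

theorem inner_mu_eq (w v : Lp ℂ 2 (mu m t ℓ)) :
    inner ℂ w v = (Nat.card (G m t d) : ℂ)⁻¹ * ∫ x,
      starRingEnd ℂ (MvPolynomial.eval (torusPt x) ℓ * w (theta m t d (torusPt x))) *
        (MvPolynomial.eval (torusPt x) ℓ * v (theta m t d (torusPt x))) ∂haarTorus d := by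
  rw [MeasureTheory.L2.inner_def, integral_mu ℓ
    ((Lp.stronglyMeasurable w).inner (Lp.stronglyMeasurable v)), Complex.real_smul]
  push_cast
  congr 1
  refine integral_congr_ae (ae_of_all _ fun x => ?_)
  simp only [RCLike.inner_apply, Complex.real_smul]
  rw [map_mul, Complex.ofReal_pow, ← Complex.conj_mul']
  ring

/-- The weight `|ℓ|²` of the measure is absorbed into the two lifts, and the factor undoes the
normalization by `|G|⁻¹`. -/
theorem inner_liftLp (hm : 0 < m) (w v : Lp ℂ 2 (mu m t ℓ)) :
    inner ℂ (liftLp ℓ hm w) (liftLp ℓ hm v) = (Nat.card (G m t d) : ℂ) * inner ℂ w v := by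
  have hc : (Nat.card (G m t d) : ℂ) ≠ 0 := by exact_mod_cast card_G_ne_zero hm
  rw [inner_mu_eq, ← mul_assoc, mul_inv_cancel₀ hc, one_mul, MeasureTheory.L2.inner_def]
  refine integral_congr_ae ?_
  filter_upwards [coeFn_liftLp ℓ hm w, coeFn_liftLp ℓ hm v] with x h1 h2
  rw [h1, h2, RCLike.inner_apply, mul_comm]

theorem norm_sq_liftLp (hm : 0 < m) (w : Lp ℂ 2 (mu m t ℓ)) :
    ‖liftLp ℓ hm w‖ ^ 2 = Nat.card (G m t d) * ‖w‖ ^ 2 := by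
  have h := inner_liftLp ℓ hm w w
  rw [inner_self_eq_norm_sq_to_K, inner_self_eq_norm_sq_to_K] at h
  have h1 : ((‖liftLp ℓ hm w‖ ^ 2 : ℝ) : ℂ) = ((Nat.card (G m t d) * ‖w‖ ^ 2 : ℝ) : ℂ) := by
    push_cast
    exact h
  exact_mod_cast h1

/-- Almost everywhere equal functions for `μ_{ρ,θ}` have lifts that agree almost everywhere. -/
theorem ae_haarTorus_of_ae_mu {P : (Fin d → ℂ) → Prop} (h : ∀ᵐ p ∂mu m t ℓ, P p) :
    ∀ᵐ x ∂haarTorus d, MvPolynomial.eval (torusPt x) ℓ ≠ 0 → P (theta m t d (torusPt x)) := by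
  have h1 := ae_weightedTorus_of_ae_mu m t ℓ h
  rw [weightedTorus, ae_withDensity_iff (measurable_density ℓ)] at h1
  filter_upwards [h1] with x hx h0
  exact hx (by simpa using h0)

end Mu

/-- A closed subspace of `L²` contains the almost everywhere limits of its bounded sequences. -/
theorem mem_of_tendsto_ae_of_norm_le {α : Type*} [MeasurableSpace α] {μ : Measure α}
    [IsFiniteMeasure μ] {M : Submodule ℂ (Lp ℂ 2 μ)} (hM : IsClosed (M : Set (Lp ℂ 2 μ)))
    {u : ℕ → Lp ℂ 2 μ} (hu : ∀ n, u n ∈ M) {B : ℝ} (hB : ∀ n, ‖u n‖ ≤ B) {F : Lp ℂ 2 μ}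
    (h : ∀ᵐ x ∂μ, Tendsto (fun n => u n x) atTop (𝓝 (F x))) : F ∈ M := by
  have : CompleteSpace M := hM.completeSpace_coe
  -- It suffices that every `w ⊥ M` annihilates the limit, so the boundedness of the sequence has to
  -- yield only convergence of the pairings with `w`.
  rw [← Submodule.orthogonal_orthogonal M, Submodule.mem_orthogonal]
  intro w hw
  have hB0 : 0 ≤ B := (norm_nonneg _).trans (hB 0)
  let f : ℕ → α → ℂ := fun n x => starRingEnd ℂ (w x) * u n x
  have hwm : MemLp (fun x => starRingEnd ℂ (w x)) 2 μ := (Lp.memLp w).star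
  have hf : ∀ n, Integrable (f n) μ := fun n => hwm.integrable_mul (Lp.memLp (u n))
  have hF : Integrable (fun x => starRingEnd ℂ (w x) * F x) μ := hwm.integrable_mul (Lp.memLp F)
  have hinner : ∀ v : Lp ℂ 2 μ, inner ℂ w v = ∫ x, starRingEnd ℂ (w x) * v x ∂μ := fun v => by
    rw [MeasureTheory.L2.inner_def]
    exact integral_congr_ae (ae_of_all _ fun x => by simp only [RCLike.inner_apply, mul_comm])
  -- By Cauchy–Schwarz the integral of `|w u_n|` over a small set is at most `B` times the norm of
  -- `w` there; Vitali's theorem then applies. The divisor `B + 1` covers `B = 0`.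
  have hui : UnifIntegrable f 1 μ := by
    intro ε hε
    obtain ⟨δ, hδ, hδs⟩ := hwm.eLpNorm_indicator_le (p := 2) (by norm_num) (by norm_num)
      (ε := ε / (B + 1)) (by positivity)
    refine ⟨δ, hδ, fun n s hs hμs => ?_⟩
    have h1 : s.indicator (f n) = (s.indicator fun x => starRingEnd ℂ (w x)) • (u n : α → ℂ) := by
      ext x
      by_cases hx : x ∈ s <;> simp [hx, f]
    rw [h1]
    refine (eLpNorm_smul_le_mul_eLpNorm (p := 2) (q := 2) (Lp.aestronglyMeasurable _)
      (hwm.aestronglyMeasurable.indicator hs)).trans ?_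
    have h2 : eLpNorm (u n) 2 μ ≤ ENNReal.ofReal B := by
      rw [← ENNReal.ofReal_toReal (Lp.eLpNorm_ne_top (u n)), ← Lp.norm_def]
      exact ENNReal.ofReal_le_ofReal (hB n)
    refine (mul_le_mul' (hδs s hs hμs) h2).trans ?_
    rw [← ENNReal.ofReal_mul (by positivity)]
    refine ENNReal.ofReal_le_ofReal ?_
    rw [div_mul_eq_mul_div, div_le_iff₀ (by positivity)]
    nlinarith
  have hlim : Tendsto (fun n => ∫ x, f n x ∂μ) atTop (𝓝 (∫ x, starRingEnd ℂ (w x) * F x ∂μ)) := by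
    refine tendsto_integral_of_L1' _ hF.aestronglyMeasurable (Eventually.of_forall hf) ?_
    refine tendsto_Lp_finite_of_tendsto_ae le_rfl (by norm_num)
      (fun n => (hf n).aestronglyMeasurable) (memLp_one_iff_integrable.2 hF) hui ?_
    filter_upwards [h] with x hx
    exact hx.const_mul _
  have h0 : ∀ n, ∫ x, f n x ∂μ = 0 := fun n => by
    rw [← hinner]
    exact Submodule.inner_left_of_mem_orthogonal (hu n) hw
  simp only [h0] at hlim
  rw [hinner]
  exact (tendsto_nhds_unique hlim tendsto_const_nhds)

/-! ### Dilations of the quotient domain and elements of the algebra -/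

section Dilation

variable {d : ℕ} (m t : ℕ)

/-- The quasi-homogeneous dilations of `ℂ^d` that correspond under `θ` to the scalar
multiplications. -/
def dilation (c : ℂ) (p : Fin d → ℂ) : Fin d → ℂ := fun i =>
  if (i : ℕ) + 1 = d then c ^ (d * (m / t)) * p i else c ^ (m * (i + 1)) * p i

theorem differentiable_dilation (c : ℂ) : Differentiable ℂ (dilation (d := d) m t c) := by
  refine differentiable_pi.2 fun i => ?_
  unfold dilation
  split_ifs <;> fun_prop

/-- Each component of `θ` is homogeneous, so scalar multiplication upstairs descends to a diagonal
map of the quotient. -/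
theorem theta_smul (c : ℂ) (z : Fin d → ℂ) :
    theta m t d (c • z) = dilation m t c (theta m t d z) := by
  ext i
  unfold dilation theta
  split_ifs with h
  · simp only [Pi.smul_apply, smul_eq_mul, Finset.prod_mul_distrib, Finset.prod_const,
      Finset.card_univ, Fintype.card_fin, mul_pow, pow_mul]
  · simp only [Pi.smul_apply, smul_eq_mul, MvPolynomial.esymm, map_sum, map_prod,
      MvPolynomial.eval_X, Finset.mul_sum]
    refine Finset.sum_congr rfl fun s hs => ?_
    rw [Finset.mem_powersetCard] at hs
    simp only [mul_pow, Finset.prod_mul_distrib, Finset.prod_const, hs.2, ← pow_mul]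

theorem differentiable_theta : Differentiable ℂ (theta m t d) := by
  refine differentiable_pi.2 fun i => ?_
  unfold theta
  split_ifs
  · fun_prop
  · simp only [MvPolynomial.esymm, map_sum, map_prod, MvPolynomial.eval_X]
    fun_prop

theorem closure_quotientDomain_subset :
    closure (quotientDomain m t d) ⊆ theta m t d '' Metric.closedBall 0 1 :=
  closure_minimal (Set.image_mono (polydisc_subset d))
    ((isCompact_closedBall 0 1).image (continuous_theta m t d)).isClosed

theorem smul_mem_polydisc {z : Fin d → ℂ} {c : ℂ} {R : ℝ} (hz : ‖z‖ ≤ R)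
    (hc : ‖c‖ * R < 1) : c • z ∈ polydisc d := fun i => by
  have h1 := (norm_le_pi_norm z i).trans hz
  rw [Pi.smul_apply, norm_smul]
  exact (mul_le_mul_of_nonneg_left h1 (norm_nonneg c)).trans_lt hc

/-- A point of the closure is the image of a point of the closed polydisc, by compactness, and
multiplication by `c` moves that point into the open one. -/
theorem dilation_mem_quotientDomain {c : ℂ} (hc : ‖c‖ < 1) {p : Fin d → ℂ}
    (hp : p ∈ closure (quotientDomain m t d)) : dilation m t c p ∈ quotientDomain m t d := by
  obtain ⟨z, hz, rfl⟩ := closure_quotientDomain_subset m t hp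
  refine ⟨c • z, smul_mem_polydisc (by simpa using hz) (by simpa using hc), ?_⟩
  rw [theta_smul]

variable {m t}

/-- The dilates of a holomorphic function on `θ(𝔻^d)` belong to `𝒜(θ(𝔻^d))`. -/
noncomputable def dilate {f : (Fin d → ℂ) → ℂ} (hf : DifferentiableOn ℂ f (quotientDomain m t d))
    {c : ℂ} (hc : ‖c‖ < 1) : algA m t d :=
  ⟨⟨fun p => f (dilation m t c p.1), hf.continuousOn.comp_continuous
      ((differentiable_dilation m t c).continuous.comp continuous_subtype_val)
      fun p => dilation_mem_quotientDomain m t hc p.2⟩,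
    fun p => f (dilation m t c p), hf.comp (differentiable_dilation m t c).differentiableOn
      fun _ hp => dilation_mem_quotientDomain m t hc (subset_closure hp), fun _ _ => rfl⟩

theorem extendFun_dilate {f : (Fin d → ℂ) → ℂ} (hf : DifferentiableOn ℂ f (quotientDomain m t d))
    {c : ℂ} (hc : ‖c‖ < 1) (x : UnitAddTorus (Fin d)) :
    extendFun (dilate hf hc) (theta m t d (torusPt x)) = f (theta m t d (c • torusPt x)) := by
  rw [extendFun_apply _ (theta_torusPt_mem m t x), theta_smul]
  rfl

theorem differentiable_eval (q : MvPolynomial (Fin d) ℂ) :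
    Differentiable ℂ fun p : Fin d → ℂ => MvPolynomial.eval p q := by
  induction q using MvPolynomial.induction_on with
  | C a => simp
  | add p q hp hq =>
    simp only [map_add]
    exact hp.add hq
  | mul_X p i hp =>
    simp only [map_mul, MvPolynomial.eval_X]
    exact hp.mul (differentiable_apply i)

variable (m t) in
/-- Polynomials, as elements of `𝒜(θ(𝔻^d))`. -/
noncomputable def polyA (q : MvPolynomial (Fin d) ℂ) : algA m t d :=
  ⟨⟨fun p => MvPolynomial.eval p.1 q, (MvPolynomial.continuous_eval q).comp continuous_subtype_val⟩,
    fun p => MvPolynomial.eval p q, (differentiable_eval q).differentiableOn, fun _ _ => rfl⟩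

theorem extendFun_polyA (q : MvPolynomial (Fin d) ℂ) (x : UnitAddTorus (Fin d)) :
    extendFun (polyA m t q) (theta m t d (torusPt x)) =
      MvPolynomial.eval (theta m t d (torusPt x)) q :=
  extendFun_apply _ (theta_torusPt_mem m t x)

end Dilation

/-! ### The group acting on the torus -/

section GroupAction

variable {m t d : ℕ}

theorem exp_two_pi_pow_eq_one (hm : 0 < m) (n : ℤ) :
    Complex.exp (2 * Real.pi * Complex.I * n / m) ^ m = 1 := by
  have hm' : (m : ℂ) ≠ 0 := by exact_mod_cast hm.ne'
  rw [← Complex.exp_nat_mul, mul_div_cancel₀ _ hm', mul_comm]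
  exact Complex.exp_int_mul_two_pi_mul_I n

theorem theta_mkG (hm : 0 < m) (ht : 0 < t) (htm : t ∣ m) (σ : Equiv.Perm (Fin d)) (ν : Fin d → ℤ)
    (h : (t : ℤ) ∣ ∑ i, ν i) (z : Fin d → ℂ) :
    theta m t d ((mkG m t d σ ν h).1 z) = theta m t d z := by
  have hg : ∀ i, (mkG m t d σ ν h).1 z i =
      Complex.exp (2 * Real.pi * Complex.I * ν i / m) * z (σ i) := fun i => rfl
  ext i
  unfold theta
  split_ifs with hi
  · simp only [hg]
    rw [Finset.prod_mul_distrib, Equiv.prod_comp σ z, mul_pow, ← Complex.exp_sum]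
    obtain ⟨c, hc⟩ := h
    obtain ⟨n, rfl⟩ := htm
    have ht' : (t : ℂ) ≠ 0 := by exact_mod_cast ht.ne'
    have hn' : (n : ℂ) ≠ 0 := by
      have := (Nat.pos_of_mul_pos_left hm).ne'
      exact_mod_cast this
    rw [Nat.mul_div_cancel_left n ht, ← Complex.exp_nat_mul]
    have h1 : (n : ℂ) * ∑ i, 2 * Real.pi * Complex.I * (ν i : ℂ) / ((t * n : ℕ) : ℂ) =
        c * (2 * Real.pi * Complex.I) := by
      have h2 : (∑ i, (ν i : ℂ)) = t * c := by exact_mod_cast hc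
      rw [← Finset.sum_div, ← Finset.mul_sum, h2]
      push_cast
      field_simp
    rw [h1, Complex.exp_int_mul_two_pi_mul_I, one_mul]
  · simp only [hg, mul_pow, exp_two_pi_pow_eq_one hm, one_mul]
    have h1 := MvPolynomial.esymm_isSymmetric (Fin d) ℂ (i + 1) σ
    conv_rhs => rw [← h1, MvPolynomial.eval_rename]
    rfl

theorem theta_G (hm : 0 < m) (ht : 0 < t) (htm : t ∣ m) (g : G m t d) (z : Fin d → ℂ) :
    theta m t d (g.1 z) = theta m t d z := by
  obtain ⟨σ, ν, h, rfl⟩ := eq_mkG g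
  exact theta_mkG hm ht htm σ ν h z

/-- The action of `G(m, t, d)` on the torus preserves Haar measure. -/
theorem exists_measurePreserving_torusPt (g : G m t d) :
    ∃ T : UnitAddTorus (Fin d) → UnitAddTorus (Fin d),
      MeasurePreserving T (haarTorus d) (haarTorus d) ∧ ∀ x, torusPt (T x) = g.1 (torusPt x) := by
  obtain ⟨σ, ν, h, rfl⟩ := eq_mkG g
  let S : UnitAddTorus (Fin d) →+ UnitAddTorus (Fin d) :=
    { toFun := fun x i => x (σ i)
      map_zero' := rfl
      map_add' := fun _ _ => rfl }
  have hS : MeasurePreserving S (haarTorus d) (haarTorus d) := by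
    refine AddMonoidHom.measurePreserving ?_ (fun y => ⟨fun i => y (σ.symm i), ?_⟩) rfl
    · exact continuous_pi fun i => continuous_apply (σ i)
    · funext i
      change y (σ.symm (σ i)) = y i
      rw [Equiv.symm_apply_apply]
  let c : UnitAddTorus (Fin d) := fun i => ((ν i / m : ℝ) : UnitAddCircle)
  refine ⟨fun x => S x + c, (measurePreserving_add_right (haarTorus d) c).comp hS, fun x => ?_⟩
  ext i
  change (AddCircle.toCircle (x (σ i) + ((ν i / m : ℝ) : UnitAddCircle)) : ℂ) =
    Complex.exp (2 * Real.pi * Complex.I * ν i / m) * torusPt x (σ i)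
  rw [AddCircle.toCircle_add, Circle.coe_mul, mul_comm, AddCircle.toCircle_apply_mk, Circle.coe_exp]
  congr 2
  push_cast
  ring

theorem norm_character_eq_one (hm : 0 < m) (ρ : G m t d →* ℂˣ) (g : G m t d) :
    ‖(ρ g : ℂ)‖ = 1 := by
  have := finite_G (t := t) (d := d) hm
  refine Complex.norm_eq_one_of_pow_eq_one (n := Nat.card (G m t d)) ?_ (card_G_ne_zero hm)
  rw [← Units.val_pow_eq_pow_val, ← map_pow, pow_card_eq_one', map_one, Units.val_one]

/-- Polynomials pair with a semi-invariant function through their semi-invariant parts. -/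
theorem exists_semiInvariant_integral_eq (hm : 0 < m) (ρ : G m t d →* ℂˣ)
    {W : UnitAddTorus (Fin d) → ℂ} (hWi : MemLp W 2 (haarTorus d))
    (hW : ∀ (g : G m t d) (T : UnitAddTorus (Fin d) → UnitAddTorus (Fin d)),
      (∀ x, torusPt (T x) = g.1 (torusPt x)) → ∀ x, W (T x) = ρ g * W x)
    (q : MvPolynomial (Fin d) ℂ) :
    ∃ q', IsSemiInvariant ρ q' ∧
      ∫ x, starRingEnd ℂ (MvPolynomial.eval (torusPt x) q) * W x ∂haarTorus d =
      ∫ x, starRingEnd ℂ (MvPolynomial.eval (torusPt x) q') * W x ∂haarTorus d := by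
  have := finite_G (t := t) (d := d) hm
  have := Fintype.ofFinite (G m t d)
  have hc : (Nat.card (G m t d) : ℂ) ≠ 0 := by exact_mod_cast card_G_ne_zero hm
  -- The sum of the `s g` is the projection of `q` to the `ρ`-isotypic part.
  let s : G m t d → MvPolynomial (Fin d) ℂ := fun g =>
    MvPolynomial.C ((Nat.card (G m t d) : ℂ)⁻¹ * (ρ g : ℂ)⁻¹) *
      substPoly (g.1 : (Fin d → ℂ) →ₗ[ℂ] (Fin d → ℂ)) q
  have hs : ∀ g z, MvPolynomial.eval z (s g) =
      (Nat.card (G m t d) : ℂ)⁻¹ * (ρ g : ℂ)⁻¹ * MvPolynomial.eval (g.1 z) q := fun g z => by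
    simp [s, eval_substPoly]
  refine ⟨∑ g, s g, fun g z => ?_, ?_⟩
  · simp only [map_sum, hs]
    rw [Finset.mul_sum]
    refine Fintype.sum_equiv (Equiv.mulRight g) _ _ fun h => ?_
    simp only [Equiv.coe_mulRight, map_mul, Units.val_mul, Subgroup.coe_mul, LinearEquiv.mul_apply]
    have := (ρ g).ne_zero
    field_simp
  · have hintg : ∀ p : MvPolynomial (Fin d) ℂ, Integrable (fun x =>
        starRingEnd ℂ (MvPolynomial.eval (torusPt x) p) * W x) (haarTorus d) := fun p => by
      have h1 : MemLp (fun x => starRingEnd ℂ (MvPolynomial.eval (torusPt x) p)) 2 (haarTorus d) :=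
        (Complex.continuous_conj.comp (continuous_eval_torusPt p)).memLp_of_hasCompactSupport
          (HasCompactSupport.of_compactSpace _)
      exact h1.integrable_mul hWi
    have h1 : ∀ g, ∫ x, starRingEnd ℂ (MvPolynomial.eval (torusPt x) (s g)) * W x ∂haarTorus d =
        (Nat.card (G m t d) : ℂ)⁻¹ *
          ∫ x, starRingEnd ℂ (MvPolynomial.eval (torusPt x) q) * W x ∂haarTorus d := by
      intro g
      obtain ⟨T, hT, hTg⟩ := exists_measurePreserving_torusPt g
      have h2 : ∫ x, starRingEnd ℂ (MvPolynomial.eval (torusPt x) q) * W x ∂haarTorus d =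
          ∫ x, starRingEnd ℂ (MvPolynomial.eval (torusPt (T x)) q) * W (T x) ∂haarTorus d := by
        conv_lhs => rw [← hT.map_eq]
        rw [integral_map hT.measurable.aemeasurable]
        rw [hT.map_eq]
        exact (hintg q).aestronglyMeasurable
      rw [h2, ← integral_const_mul]
      refine integral_congr_ae (ae_of_all _ fun x => ?_)
      simp only [hs, hTg, hW g T hTg, map_mul, map_inv₀, Complex.conj_natCast]
      -- As `ρ g` has modulus one, the factor from `s g` is the same `ρ g` by which `W` transforms.
      have h3 : (starRingEnd ℂ (ρ g : ℂ))⁻¹ = ρ g := by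
        have h4 := Complex.conj_mul' (ρ g : ℂ)
        rw [norm_character_eq_one hm, Complex.ofReal_one, one_pow] at h4
        exact inv_eq_of_mul_eq_one_right h4
      rw [h3]
      ring
    simp only [map_sum, Finset.sum_mul]
    rw [integral_finsetSum _ fun g _ => hintg (s g)]
    simp only [h1, Finset.sum_const, Finset.card_univ, nsmul_eq_mul]
    rw [← Nat.card_eq_fintype_card, ← mul_assoc, mul_inv_cancel₀ hc, one_mul]

end GroupAction

theorem eval_smul_of_isHomogeneous {d n : ℕ} {ℓ : MvPolynomial (Fin d) ℂ}
    (hn : ℓ.IsHomogeneous n) (c : ℂ) (z : Fin d → ℂ) :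
    MvPolynomial.eval (c • z) ℓ = c ^ n * MvPolynomial.eval z ℓ := by
  rw [MvPolynomial.eval_eq', MvPolynomial.eval_eq', Finset.mul_sum]
  refine Finset.sum_congr rfl fun s hs => ?_
  have h := hn (MvPolynomial.mem_support_iff.1 hs)
  have h' : ∑ i, s i = n := by
    rw [← h, Finsupp.weight_apply, Finsupp.sum_fintype _ _ (by simp)]
    simp
  simp only [Pi.smul_apply, smul_eq_mul, mul_pow, Finset.prod_mul_distrib,
    Finset.prod_pow_eq_pow_sum, h']
  ring

/-- Stated for a bare function because the action on `Lp` is a term and not an instance; it gives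
joint continuity of the action and continuity of each multiplication. -/
theorem continuous_of_biadditive_of_norm_le {A N : Type*} [NormedRing A]
    [NormedAddCommGroup N] (f : A → N → N) (hr : ∀ a x y, f a (x + y) = f a x + f a y)
    (hl : ∀ a b x, f (a + b) x = f a x + f b x) (hf : ∀ a x, ‖f a x‖ ≤ ‖a‖ * ‖x‖) :
    Continuous fun q : A × N => f q.1 q.2 := by
  rw [continuous_iff_continuousAt]
  rintro ⟨a, x⟩
  rw [ContinuousAt, tendsto_iff_norm_sub_tendsto_zero]
  have hlim : Tendsto (fun q : A × N => ‖q.1‖ * ‖q.2 - x‖ + ‖q.1 - a‖ * ‖x‖) (𝓝 (a, x))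
      (𝓝 0) := by
    have h : Continuous fun q : A × N => ‖q.1‖ * ‖q.2 - x‖ + ‖q.1 - a‖ * ‖x‖ := by fun_prop
    simpa using h.tendsto (a, x)
  refine squeeze_zero (fun _ => norm_nonneg _) (fun q => ?_) hlim
  have h1 : f q.1 q.2 = f q.1 (q.2 - x) + f q.1 x := by rw [← hr, sub_add_cancel]
  have h2 : f q.1 x = f (q.1 - a) x + f a x := by rw [← hl, sub_add_cancel]
  rw [h1, h2, ← add_assoc, add_sub_cancel_right]
  exact (norm_add_le _ _).trans (add_le_add (hf _ _) (hf _ _))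

/-! ### The ambient `L²` module and cyclicity of the constant function -/

section Ambient

variable {d : ℕ} (m t : ℕ) (ℓ : MvPolynomial (Fin d) ℂ)

/-- The action of `𝒜(θ(𝔻^d))` on `L²(μ_{ρ,θ})` by multiplication. -/
noncomputable abbrev lpModule : Module (algA m t d) (Lp ℂ 2 (mu m t ℓ)) where
  smul a F := mulLp ℓ a F
  one_smul F := by
    have := algebraMap_mulLp (m := m) (t := t) ℓ 1 F
    rwa [map_one, one_smul] at this
  mul_smul a b F := mul_mulLp ℓ a b F
  smul_zero a := mulLp_zero ℓ a
  smul_add a F F' := mulLp_add ℓ a F F'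
  add_smul a b F := add_mulLp ℓ a b F
  zero_smul F := zero_mulLp ℓ F

theorem continuousSMul_lp :
    @ContinuousSMul (algA m t d) (Lp ℂ 2 (mu m t ℓ)) (lpModule m t ℓ).toSMul _ _ :=
  @ContinuousSMul.mk _ _ (lpModule m t ℓ).toSMul _ _
    (continuous_of_biadditive_of_norm_le (fun a F => mulLp ℓ a F) (mulLp_add ℓ) (add_mulLp ℓ)
      (norm_mulLp_le ℓ))

/-- The Hilbert module `L²(μ_{ρ,θ})`. -/
noncomputable def ambient : HilbertModule (algA m t d) where
  carrier := Lp ℂ 2 (mu m t ℓ)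
  module := lpModule m t ℓ
  isScalarTower := @IsScalarTower.mk _ _ _ _ (lpModule m t ℓ).toSMul _ fun c a F => by
    change mulLp ℓ (c • a) F = c • mulLp ℓ a F
    rw [Algebra.smul_def c a, mul_mulLp, algebraMap_mulLp]
  continuousSMul := continuousSMul_lp m t ℓ

theorem isContractive_ambient : (ambient m t ℓ).IsContractive := norm_mulLp_le ℓ

/-- The inclusion of the Hardy module in `L²(μ_{ρ,θ})`. -/
noncomputable def hardyInclusion : hardy m t ℓ →L[algA m t d] ambient m t ℓ where
  toFun F := F.1
  map_add' _ _ := rfl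
  map_smul' _ _ := rfl
  cont := continuous_subtype_val

variable {m t}

theorem memLp_one (hm : 0 < m) : MemLp (fun _ => (1 : ℂ)) 2 (mu m t ℓ) :=
  have := isFiniteMeasure_mu (t := t) ℓ hm
  memLp_const 1

/-- The constant function `1` in `L²(μ_{ρ,θ})`. -/
noncomputable def oneLp (hm : 0 < m) : Lp ℂ 2 (mu m t ℓ) := (memLp_one ℓ hm).toLp _

theorem coeFn_oneLp (hm : 0 < m) : oneLp (t := t) ℓ hm =ᵐ[mu m t ℓ] fun _ => 1 :=
  MemLp.coeFn_toLp _

theorem oneLp_mem (hm : 0 < m) : oneLp ℓ hm ∈ hardySubspace m t ℓ := by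
  refine Submodule.le_topologicalClosure _ ⟨fun _ => 1, ⟨differentiableOn_const _, ?_⟩, ?_⟩
  · simp only [mul_one]
    refine ⟨(differentiable_eval ℓ).differentiableOn, ?_⟩
    obtain ⟨B, hB⟩ := (isCompact_closedBall (0 : Fin d → ℂ) 1).exists_bound_of_continuousOn
      (MvPolynomial.continuous_eval ℓ).continuousOn
    refine lt_of_le_of_lt (b := ENNReal.ofReal B ^ 2) (iSup₂_le fun r hr => ?_) (by finiteness)
    calc ∫⁻ x, ‖MvPolynomial.eval ((r : ℂ) • torusPt x) ℓ‖ₑ ^ 2 ∂haarTorus d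
        ≤ ∫⁻ _, ENNReal.ofReal B ^ 2 ∂haarTorus d := lintegral_mono fun x => by
          gcongr
          rw [← ofReal_norm]
          exact ENNReal.ofReal_le_ofReal (hB _ (polydisc_subset d (smul_torusPt_mem x hr.1 hr.2)))
      _ = _ := by simp
  · filter_upwards [ae_weightedTorus_of_ae_mu m t ℓ (coeFn_oneLp ℓ hm)] with x hx
    rw [hx]
    exact tendsto_const_nhds

/-- The constant function `1` in the Hardy module. -/
noncomputable def oneHardy (hm : 0 < m) : hardy m t ℓ := ⟨oneLp ℓ hm, oneLp_mem ℓ hm⟩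

theorem coeFn_mulLp_one (hm : 0 < m) (a : algA m t d) :
    mulLp ℓ a (oneLp ℓ hm) =ᵐ[mu m t ℓ] extendFun a := by
  filter_upwards [coeFn_mulLp ℓ a (oneLp ℓ hm), coeFn_oneLp ℓ hm] with p h1 h2
  rw [h1, h2, mul_one]

theorem ae_mul_eq_of_ae_eq_mu {f g : (Fin d → ℂ) → ℂ} (h : f =ᵐ[mu m t ℓ] g) :
    ∀ᵐ x ∂haarTorus d,
      MvPolynomial.eval (torusPt x) ℓ * f (theta m t d (torusPt x)) =
      MvPolynomial.eval (torusPt x) ℓ * g (theta m t d (torusPt x)) := by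
  filter_upwards [ae_haarTorus_of_ae_mu ℓ h] with x hx
  by_cases h0 : MvPolynomial.eval (torusPt x) ℓ = 0
  · rw [h0, zero_mul, zero_mul]
  · rw [hx h0]

theorem coeFn_liftLp_mulLp_one (hm : 0 < m) (a : algA m t d) :
    liftLp ℓ hm (mulLp ℓ a (oneLp ℓ hm)) =ᵐ[haarTorus d] fun x =>
      MvPolynomial.eval (torusPt x) ℓ * extendFun a (theta m t d (torusPt x)) := by
  filter_upwards [coeFn_liftLp ℓ hm (mulLp ℓ a (oneLp ℓ hm)),
    ae_mul_eq_of_ae_eq_mu ℓ (coeFn_mulLp_one ℓ hm a)] with x h1 h2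
  rw [h1, h2]

theorem norm_sq_mulLp_one (hm : 0 < m) (a : algA m t d) :
    ‖mulLp ℓ a (oneLp ℓ hm)‖ ^ 2 = (Nat.card (G m t d) : ℝ)⁻¹ * ∫ x,
      ‖MvPolynomial.eval (torusPt x) ℓ * extendFun a (theta m t d (torusPt x))‖ ^ 2
        ∂haarTorus d := by
  have hc : (Nat.card (G m t d) : ℝ) ≠ 0 := by exact_mod_cast card_G_ne_zero hm
  rw [eq_inv_mul_iff_mul_eq₀ hc, ← norm_sq_liftLp ℓ hm, norm_sq_eq_integral]
  refine integral_congr_ae ?_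
  filter_upwards [coeFn_liftLp_mulLp_one ℓ hm a] with x hx
  rw [hx]

/-- The dilates of `f` lie in the algebra, are bounded in norm by the Hardy condition, and converge
almost everywhere to `F`; by `mem_of_tendsto_ae_of_norm_le` this puts `F` in the closed span. -/
theorem boundaryValues_le_closure (hm : 0 < m) (hhom : ∃ n, ℓ.IsHomogeneous n)
    {F : Lp ℂ 2 (mu m t ℓ)} (hF : F ∈ boundaryValues m t ℓ) :
    F ∈ closure (Set.range fun a : algA m t d => mulLp ℓ a (oneLp ℓ hm)) := by
  have := isFiniteMeasure_mu (t := t) ℓ hm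
  obtain ⟨f, ⟨hf, hf2⟩, hlim⟩ := hF
  obtain ⟨n, hn⟩ := hhom
  let M : Submodule ℂ (Lp ℂ 2 (mu m t ℓ)) :=
    { carrier := Set.range fun a : algA m t d => mulLp ℓ a (oneLp ℓ hm)
      add_mem' := by
        rintro _ _ ⟨a, rfl⟩ ⟨b, rfl⟩
        exact ⟨a + b, add_mulLp ℓ a b _⟩
      zero_mem' := ⟨0, zero_mulLp ℓ _⟩
      smul_mem' := by
        rintro c _ ⟨a, rfl⟩
        refine ⟨algebraMap ℂ (algA m t d) c * a, ?_⟩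
        change mulLp ℓ (algebraMap ℂ (algA m t d) c * a) (oneLp ℓ hm) = _
        rw [mul_mulLp, algebraMap_mulLp] }
  -- The radii stay above `1 / 2`: replacing `ℓ(z)` by `ℓ(r z) = r ^ n ℓ(z)` in the norm then costs
  -- at most the factor `2 ^ n`.
  let r : ℕ → ℝ := fun k => 1 - (1 / 2) ^ (k + 1)
  have hr : ∀ k, r k ∈ Set.Ico (1 / 2 : ℝ) 1 := fun k => by
    have h1 : (1 / 2 : ℝ) ^ (k + 1) ≤ 1 / 2 := by
      rw [pow_succ]
      have : (1 / 2 : ℝ) ^ k ≤ 1 := pow_le_one₀ (by norm_num) (by norm_num)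
      linarith
    have h2 : (0 : ℝ) < (1 / 2) ^ (k + 1) := by positivity
    constructor <;> simp only [r] <;> linarith
  have hrlim : Tendsto r atTop (𝓝[<] 1) := by
    refine tendsto_nhdsWithin_iff.2 ⟨?_, Eventually.of_forall fun k => (hr k).2⟩
    have h := (tendsto_pow_atTop_nhds_zero_of_lt_one (r := (1 / 2 : ℝ)) (by norm_num)
      (by norm_num)).comp (tendsto_add_atTop_nat 1)
    simpa [r] using h.const_sub 1
  have hrc : ∀ k, ‖((r k : ℝ) : ℂ)‖ < 1 := fun k => by
    rw [Complex.norm_real, Real.norm_of_nonneg (by linarith [(hr k).1])]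
    exact (hr k).2
  let u : ℕ → Lp ℂ 2 (mu m t ℓ) := fun k => mulLp ℓ (dilate hf (hrc k)) (oneLp ℓ hm)
  have hbd : ∃ B, ∀ k, ‖u k‖ ≤ B := by
    set S := ⨆ r ∈ Set.Ico (0 : ℝ) 1, ∫⁻ x, ‖MvPolynomial.eval ((r : ℂ) • torusPt x) ℓ *
      f (theta m t d ((r : ℂ) • torusPt x))‖ₑ ^ 2 ∂haarTorus d with hS
    have hS' : S ≠ ⊤ := hf2.2.ne
    refine ⟨Real.sqrt ((Nat.card (G m t d) : ℝ)⁻¹ * (((2 : ℝ) ^ n) ^ 2 * S.toReal)), fun k => ?_⟩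
    refine Real.le_sqrt_of_sq_le ?_
    rw [norm_sq_mulLp_one]
    refine mul_le_mul_of_nonneg_left ?_ (by positivity)
    have hrk : r k ∈ Set.Ico (0 : ℝ) 1 := ⟨by linarith [(hr k).1], (hr k).2⟩
    have hcont : Continuous fun x : UnitAddTorus (Fin d) =>
        MvPolynomial.eval (((r k : ℝ) : ℂ) • torusPt x) ℓ *
          f (theta m t d (((r k : ℝ) : ℂ) • torusPt x)) :=
      hf2.1.continuousOn.comp_continuous
        ((continuous_const_smul ((r k : ℝ) : ℂ)).comp continuous_torusPt)
        fun x => smul_torusPt_mem x hrk.1 hrk.2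
    have h1 : ∫ x, ‖MvPolynomial.eval (((r k : ℝ) : ℂ) • torusPt x) ℓ *
        f (theta m t d (((r k : ℝ) : ℂ) • torusPt x))‖ ^ 2 ∂haarTorus d ≤ S.toReal := by
      rw [integral_eq_lintegral_of_nonneg_ae (f := fun x =>
          ‖MvPolynomial.eval (((r k : ℝ) : ℂ) • torusPt x) ℓ *
            f (theta m t d (((r k : ℝ) : ℂ) • torusPt x))‖ ^ 2)
        (ae_of_all _ fun x => by positivity) (hcont.norm.pow 2).aestronglyMeasurable]
      refine ENNReal.toReal_mono hS' ?_
      have h2 : ∀ x, ENNReal.ofReal (‖MvPolynomial.eval (((r k : ℝ) : ℂ) • torusPt x) ℓ *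
          f (theta m t d (((r k : ℝ) : ℂ) • torusPt x))‖ ^ 2) =
          ‖MvPolynomial.eval (((r k : ℝ) : ℂ) • torusPt x) ℓ *
          f (theta m t d (((r k : ℝ) : ℂ) • torusPt x))‖ₑ ^ 2 := fun x => by
        rw [ENNReal.ofReal_pow (norm_nonneg _), ofReal_norm]
      simp only [h2]
      exact le_iSup₂ (f := fun (r : ℝ) (_ : r ∈ Set.Ico (0 : ℝ) 1) =>
        ∫⁻ x, ‖MvPolynomial.eval ((r : ℂ) • torusPt x) ℓ *
          f (theta m t d ((r : ℂ) • torusPt x))‖ₑ ^ 2 ∂haarTorus d) (r k) hrk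
    refine le_trans ?_ (mul_le_mul_of_nonneg_left h1 (by positivity))
    rw [← integral_const_mul]
    have hintg : Integrable (fun x => ((2 : ℝ) ^ n) ^ 2 *
        ‖MvPolynomial.eval (((r k : ℝ) : ℂ) • torusPt x) ℓ *
          f (theta m t d (((r k : ℝ) : ℂ) • torusPt x))‖ ^ 2) (haarTorus d) :=
      (continuous_const.mul (hcont.norm.pow 2)).integrable_of_hasCompactSupport
        (HasCompactSupport.of_compactSpace _)
    refine integral_mono_of_nonneg (ae_of_all _ fun x => by positivity) hintg
      (ae_of_all _ fun x => ?_)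
    beta_reduce
    rw [extendFun_dilate, ← mul_pow]
    refine pow_le_pow_left₀ (norm_nonneg _) ?_ 2
    have h3 : MvPolynomial.eval (((r k : ℝ) : ℂ) • torusPt x) ℓ =
        ((r k : ℝ) : ℂ) ^ n * MvPolynomial.eval (torusPt x) ℓ :=
      eval_smul_of_isHomogeneous hn _ _
    rw [h3, norm_mul, norm_mul, norm_mul, norm_pow, Complex.norm_real,
      Real.norm_of_nonneg hrk.1, mul_assoc, ← mul_assoc (2 ^ n), ← mul_pow]
    refine le_mul_of_one_le_left (by positivity) (one_le_pow₀ ?_)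
    linarith [(hr k).1]
  obtain ⟨B, hB⟩ := hbd
  have hmem : F ∈ M.topologicalClosure := by
    refine mem_of_tendsto_ae_of_norm_le (Submodule.isClosed_topologicalClosure M) (u := u)
      (fun k => Submodule.le_topologicalClosure M ⟨_, rfl⟩) hB ?_
    have hae : ∀ᵐ p ∂mu m t ℓ, ∀ k, u k p = extendFun (dilate hf (hrc k)) p :=
      ae_all_iff.2 fun k => coeFn_mulLp_one ℓ hm _
    have hlim' : ∀ᵐ p ∂mu m t ℓ,
        Tendsto (fun k => extendFun (dilate hf (hrc k)) p) atTop (𝓝 (F p)) := by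
      refine Measure.ae_smul_measure ?_ _
      rw [ae_map_iff (continuous_theta_torusPt m t).aemeasurable
        (measurableSet_tendsto_fun (fun k => measurable_extendFun _)
          (Lp.stronglyMeasurable F).measurable)]
      filter_upwards [hlim] with x hx
      simp only [extendFun_dilate]
      exact hx.comp hrlim
    filter_upwards [hae, hlim'] with p h1 h2
    simpa only [h1] using h2
  exact hmem

theorem denseRange_smul_oneHardy (hm : 0 < m) (hhom : ∃ n, ℓ.IsHomogeneous n) :
    DenseRange fun a : algA m t d => a • oneHardy (t := t) ℓ hm := by
  intro y
  have hy : y.1 ∈ closure (Set.range fun a : algA m t d => mulLp ℓ a (oneLp ℓ hm)) :=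
    closure_minimal (fun F hF => boundaryValues_le_closure ℓ hm hhom hF) isClosed_closure y.2
  have h : Topology.IsInducing (Subtype.val : hardySubspace m t ℓ → Lp ℂ 2 (mu m t ℓ)) :=
    Topology.IsInducing.subtypeVal
  change y ∈ closure (Set.range fun a : algA m t d =>
    (⟨mulLp ℓ a (oneLp ℓ hm), mulLp_mem ℓ a (oneLp_mem ℓ hm)⟩ : hardySubspace m t ℓ))
  rw [h.closure_eq_preimage_closure_image]
  change y.1 ∈ closure (_ '' _)
  rw [← Set.range_comp]
  exact hy

end Ambient

/-! ### Boundedness of the Hankel operator on the Hardy module -/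

section Bound

variable {m t d : ℕ} {ℓ : MvPolynomial (Fin d) ℂ}

theorem mFourier_eq_eval {k : Fin d → ℤ} (hk : ∀ l, 0 ≤ k l) (x : UnitAddTorus (Fin d)) :
    UnitAddTorus.mFourier k x = MvPolynomial.eval (torusPt x)
      (∏ l, (MvPolynomial.X l : MvPolynomial (Fin d) ℂ) ^ (k l).toNat) := by
  simp only [map_prod, map_pow, MvPolynomial.eval_X]
  change ∏ l, fourier (k l) (x l) = _
  refine Finset.prod_congr rfl fun l _ => ?_
  rw [fourier_apply, AddCircle.toCircle_zsmul]
  conv_lhs => rw [← Int.toNat_of_nonneg (hk l)]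
  rw [zpow_natCast, Circle.coe_pow]
  rfl

/-- Functions orthogonal to the Hardy space have lifts orthogonal to the analytic monomials. -/
theorem inner_fourierTorus_liftLp_eq_zero (hm : 0 < m) (ht : 0 < t) (htm : t ∣ m) (hd : 1 < d)
    {ρ : G m t d →* ℂˣ} (hℓ : IsSemiInvariantGenerator ρ ℓ) {w : Lp ℂ 2 (mu m t ℓ)}
    (hw : ∀ F ∈ hardySubspace m t ℓ, inner ℂ F w = 0) {k : Fin d → ℤ} (hk : ∀ l, 0 ≤ k l) :
    inner ℂ (fourierTorus k) (liftLp ℓ hm w) = 0 := by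
  have h1 : inner ℂ (fourierTorus k) (liftLp ℓ hm w) = ∫ x, starRingEnd ℂ
      (MvPolynomial.eval (torusPt x) (∏ l, (MvPolynomial.X l : MvPolynomial (Fin d) ℂ) ^
        (k l).toNat)) * (MvPolynomial.eval (torusPt x) ℓ * w (theta m t d (torusPt x)))
        ∂haarTorus d := by
    rw [inner_fourierTorus]
    refine integral_congr_ae ?_
    filter_upwards [coeFn_liftLp ℓ hm w] with x hx
    rw [hx, mFourier_eq_eval hk]
  -- The lift of `w` is semi-invariant, so the monomial may be replaced by its semi-invariant part,
  -- which is `ℓ` times a polynomial in `θ`; this comes from an element of the Hardy module.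
  obtain ⟨q, hq, h2⟩ := exists_semiInvariant_integral_eq hm ρ
    ((memLp_mu_iff ℓ hm (Lp.stronglyMeasurable w)).1 (Lp.memLp w))
    (fun g T hT x => by rw [hT, theta_G hm ht htm, hℓ.semiInvariant, mul_assoc])
    (∏ l, (MvPolynomial.X l : MvPolynomial (Fin d) ℂ) ^ (k l).toNat)
  obtain ⟨f, hf, rfl⟩ := hℓ.generates q hq
  obtain ⟨q', hqθ⟩ := hf.exists_eval_theta hm ht htm hd
  have h3 := hw _ (mulLp_mem ℓ (polyA m t q') (oneLp_mem ℓ hm))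
  have hc : (Nat.card (G m t d) : ℂ) ≠ 0 := by exact_mod_cast card_G_ne_zero hm
  rw [inner_mu_eq, mul_eq_zero, or_iff_right (inv_ne_zero hc)] at h3
  rw [h1, h2, ← h3]
  refine integral_congr_ae ?_
  filter_upwards [ae_mul_eq_of_ae_eq_mu ℓ (coeFn_mulLp_one ℓ hm (polyA m t q'))] with x hx
  rw [hx, extendFun_polyA, map_mul, hqθ]

/-- The discriminant of the `m`-th powers of the variables. -/
noncomputable def discPoly (m d : ℕ) : MvPolynomial (Fin d) ℂ :=
  ∏ p ∈ (Finset.univ : Finset (Fin d)).offDiag,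
    (MvPolynomial.X p.1 ^ m - MvPolynomial.X p.2 ^ m)

/-- The product runs over ordered pairs, so a permutation only reorders the factors and produces no
sign. -/
theorem isSemiInvariant_discPoly (hm : 0 < m) :
    IsSemiInvariant (1 : G m t d →* ℂˣ) (discPoly m d) := by
  intro g z
  obtain ⟨σ, ν, -, hg⟩ := g.2
  have h : ∀ i, g.1 z i ^ m = z (σ i) ^ m := fun i => by
    rw [hg, mul_pow, exp_two_pi_pow_eq_one hm, one_mul]
  simp only [discPoly, map_prod, map_sub, map_pow, MvPolynomial.eval_X, h, MonoidHom.one_apply,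
    Units.val_one, one_mul]
  refine Finset.prod_equiv (Equiv.prodCongr σ σ) (fun p => ?_) fun p _ => rfl
  simp [Finset.mem_offDiag]

theorem norm_sub_eq_norm_one_sub {a b : ℂ} (ha : ‖a‖ = 1) :
    ‖a - b‖ = ‖1 - starRingEnd ℂ a * b‖ := by
  have h : starRingEnd ℂ a * a = 1 := by rw [Complex.conj_mul', ha]; simp
  rw [← h, ← mul_sub, norm_mul, RCLike.norm_conj, ha, one_mul]

theorem norm_eval_discPoly (m : ℕ) (x : UnitAddTorus (Fin d)) :
    ‖MvPolynomial.eval (torusPt x) (discPoly m d)‖ =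
      ∏ p ∈ (Finset.univ : Finset (Fin d)).offDiag,
        ‖1 - starRingEnd ℂ (torusPt x p.1) ^ m * torusPt x p.2 ^ m‖ := by
  simp only [discPoly, map_prod, map_sub, map_pow, MvPolynomial.eval_X, norm_prod]
  refine Finset.prod_congr rfl fun p _ => ?_
  rw [norm_sub_eq_norm_one_sub (by rw [norm_pow, norm_torusPt, one_pow]), map_pow]

theorem ae_log_norm_discPoly (hm : 0 < m) : ∀ᵐ x ∂haarTorus d,
    Real.log ‖MvPolynomial.eval (torusPt x) (discPoly m d)‖ = logSum m 1 (torusPt x) := by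
  filter_upwards [ae_forall_offDiag_ne_one hm] with x hx
  rw [norm_eval_discPoly, logSum, Real.log_prod]
  · simp
  · intro p hp
    rw [norm_ne_zero_iff, sub_ne_zero]
    exact (hx p hp).symm

variable {D : MvPolynomial (Fin d) ℂ}

/-- The lift is `logSum` times the bounded function `ℓ`, almost everywhere on the torus. -/
theorem memLp_logDisc (hm : 0 < m)
    (hD : ∀ z, MvPolynomial.eval z (discPoly m d) = MvPolynomial.eval (theta m t d z) D) :
    MemLp (fun p => ((Real.log ‖MvPolynomial.eval p D‖ : ℝ) : ℂ)) 2 (mu m t ℓ) := by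
  have hmeas : StronglyMeasurable fun p => ((Real.log ‖MvPolynomial.eval p D‖ : ℝ) : ℂ) :=
    (Complex.measurable_ofReal.comp (Real.measurable_log.comp
      (MvPolynomial.continuous_eval D).norm.measurable)).stronglyMeasurable
  rw [memLp_mu_iff ℓ hm hmeas]
  obtain ⟨B, hB⟩ := isCompact_univ.exists_bound_of_continuousOn
    (continuous_eval_torusPt ℓ).continuousOn
  have h1 : MemLp (fun x => ((logSum m 1 (torusPt x) : ℝ) : ℂ)) 2 (haarTorus d) :=
    (memLp_logSum hm).ofReal
  refine h1.of_le_mul (c := B) ((continuous_eval_torusPt ℓ).aestronglyMeasurable.mul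
    (hmeas.comp_measurable (continuous_theta_torusPt m t).measurable).aestronglyMeasurable) ?_
  filter_upwards [ae_log_norm_discPoly hm] with x hx
  rw [norm_mul, ← hD, hx]
  exact mul_le_mul_of_nonneg_right (hB x trivial) (norm_nonneg _)

/-- The function `log |D|` in `L²(μ_{ρ,θ})`, where `D ∘ θ` is the discriminant. -/
noncomputable def logDisc (ℓ : MvPolynomial (Fin d) ℂ) (hm : 0 < m)
    (hD : ∀ z, MvPolynomial.eval z (discPoly m d) = MvPolynomial.eval (theta m t d z) D) :
    Lp ℂ 2 (mu m t ℓ) :=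
  (memLp_logDisc hm hD).toLp _

theorem coeFn_logDisc (hm : 0 < m)
    (hD : ∀ z, MvPolynomial.eval z (discPoly m d) = MvPolynomial.eval (theta m t d z) D) :
    logDisc ℓ hm hD =ᵐ[mu m t ℓ] fun p => ((Real.log ‖MvPolynomial.eval p D‖ : ℝ) : ℂ) :=
  MemLp.coeFn_toLp _

theorem continuousOn_extendFun (a : algA m t d) :
    ContinuousOn (extendFun a) (closure (quotientDomain m t d)) := by
  rw [continuousOn_iff_continuous_domRestrict]
  exact a.1.continuous.congr fun p => (extendFun_apply a p.2).symm

theorem tendsto_extendFun (a : algA m t d) {f : (Fin d → ℂ) → ℂ}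
    (haf : ∀ p : closure (quotientDomain m t d), p.1 ∈ quotientDomain m t d → a.1 p = f p)
    (x : UnitAddTorus (Fin d)) :
    Tendsto (fun r : ℝ => f (theta m t d ((r : ℂ) • torusPt x))) (𝓝[<] 1)
      (𝓝 (extendFun a (theta m t d (torusPt x)))) := by
  have h3 : Tendsto (fun r : ℝ => theta m t d ((r : ℂ) • torusPt x)) (𝓝[<] 1)
      (𝓝[closure (quotientDomain m t d)] (theta m t d (torusPt x))) :=
    tendsto_nhdsWithin_iff.2 ⟨tendsto_theta m t x,
      (eventually_mem m t x).mono fun _ h => subset_closure h⟩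
  refine ((continuousOn_extendFun a _ (theta_torusPt_mem m t x)).tendsto.comp h3).congr' ?_
  filter_upwards [eventually_mem m t x] with r hr
  rw [Function.comp_apply, extendFun_apply a (subset_closure hr)]
  exact haf _ hr

/-- Multiplication by `log |D|` is bounded from the Hardy space to its orthogonal complement. -/
theorem norm_inner_mulLp_logDisc_le (hm : 0 < m) (ht : 0 < t) (htm : t ∣ m) (hd : 1 < d)
    {ρ : G m t d →* ℂˣ} (hℓ : IsSemiInvariantGenerator ρ ℓ)
    (hD : ∀ z, MvPolynomial.eval z (discPoly m d) = MvPolynomial.eval (theta m t d z) D)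
    {w : Lp ℂ 2 (mu m t ℓ)} (hw : ∀ F ∈ hardySubspace m t ℓ, inner ℂ F w = 0)
    (a : algA m t d) :
    ‖inner ℂ w (mulLp ℓ a (logDisc ℓ hm hD))‖ ≤
      (Finset.univ : Finset (Fin d)).offDiag.card * (2 * Real.pi) * ‖w‖ *
        ‖mulLp ℓ a (oneLp ℓ hm)‖ := by
  obtain ⟨f, hf, haf⟩ := a.2
  obtain ⟨B, hB⟩ := isCompact_univ.exists_bound_of_continuousOn
    (continuous_eval_torusPt ℓ).continuousOn
  have hmem : ∀ r ∈ Set.Ioo (0 : ℝ) 1, ∀ z : Fin d → ℂ, ‖z‖ < r⁻¹ → (r : ℂ) • z ∈ polydisc d :=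
    fun r hr z hz => by
      refine smul_mem_polydisc le_rfl ?_
      rw [Complex.norm_real, Real.norm_of_nonneg hr.1.le]
      calc r * ‖z‖ < r * r⁻¹ := mul_lt_mul_of_pos_left hz hr.1
        _ = 1 := mul_inv_cancel₀ hr.1.ne'
  -- Only the argument of `f` is dilated: `ℓ(z) f(θ(r z))` is holomorphic on a ball of radius `r⁻¹ >
  -- 1` and tends, as `r → 1`, to the lift of `a · 1`.
  have h := norm_integral_mul_logSum_le (W := liftLp ℓ hm w)
    (G := liftLp ℓ hm (mulLp ℓ a (oneLp ℓ hm))) hm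
    (g := fun r z => MvPolynomial.eval z ℓ * f (theta m t d ((r : ℂ) • z)))
    (B := B * ‖a‖)
    (g₁ := fun x => MvPolynomial.eval (torusPt x) ℓ * extendFun a (theta m t d (torusPt x)))
    (fun k hk => inner_fourierTorus_liftLp_eq_zero hm ht htm hd hℓ hw hk)
    (fun r hr => (differentiable_eval ℓ).differentiableOn.mul (hf.comp
      ((differentiable_theta m t).comp (differentiable_id.const_smul (r : ℂ))).differentiableOn
      fun z hz => ⟨_, hmem r hr z (by simpa using hz), rfl⟩))
    (fun r hr x => by
      have hq : theta m t d ((r : ℂ) • torusPt x) ∈ quotientDomain m t d :=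
        ⟨_, smul_torusPt_mem x hr.1.le hr.2, rfl⟩
      rw [norm_mul, ← haf ⟨_, subset_closure hq⟩ hq]
      exact mul_le_mul (hB x trivial) (a.1.norm_coe_le_norm _) (norm_nonneg _)
        ((norm_nonneg _).trans (hB x trivial)))
    (fun x => (tendsto_extendFun a haf x).const_mul _)
    (coeFn_liftLp_mulLp_one ℓ hm a)
  have hcard : (0 : ℝ) < Nat.card (G m t d) := by
    exact_mod_cast Nat.pos_of_ne_zero (card_G_ne_zero hm)
  have hnorm : ∀ u : Lp ℂ 2 (mu m t ℓ),
      ‖liftLp ℓ hm u‖ = Real.sqrt (Nat.card (G m t d)) * ‖u‖ := fun u => by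
    rw [← Real.sqrt_sq (norm_nonneg (liftLp ℓ hm u)), norm_sq_liftLp,
      Real.sqrt_mul hcard.le, Real.sqrt_sq (norm_nonneg u)]
  have hintg : ∫ x, starRingEnd ℂ (liftLp ℓ hm w x) * ((logSum m 1 (torusPt x) : ℂ) *
      (MvPolynomial.eval (torusPt x) ℓ * extendFun a (theta m t d (torusPt x)))) ∂haarTorus d =
      (Nat.card (G m t d) : ℂ) * inner ℂ w (mulLp ℓ a (logDisc ℓ hm hD)) := by
    rw [← inner_liftLp ℓ hm, MeasureTheory.L2.inner_def]
    refine integral_congr_ae ?_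
    filter_upwards [coeFn_liftLp ℓ hm (mulLp ℓ a (logDisc ℓ hm hD)),
      ae_mul_eq_of_ae_eq_mu ℓ (coeFn_mulLp ℓ a (logDisc ℓ hm hD)),
      ae_mul_eq_of_ae_eq_mu ℓ (coeFn_logDisc hm hD), ae_log_norm_discPoly hm] with x h1 h2 h3 h4
    rw [RCLike.inner_apply, h1, h2, ← h4, hD]
    linear_combination (-starRingEnd ℂ (liftLp ℓ hm w x) *
      extendFun a (theta m t d (torusPt x))) * h3
  rw [hintg, norm_mul, Complex.norm_natCast, hnorm, hnorm] at h
  have h5 : (Nat.card (G m t d) : ℝ) * ‖inner ℂ w (mulLp ℓ a (logDisc ℓ hm hD))‖ ≤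
      Nat.card (G m t d) * ((Finset.univ : Finset (Fin d)).offDiag.card * (2 * Real.pi) * ‖w‖ *
        ‖mulLp ℓ a (oneLp ℓ hm)‖) := by
    refine h.trans (le_of_eq ?_)
    have := Real.mul_self_sqrt hcard.le
    linear_combination ((Finset.univ : Finset (Fin d)).offDiag.card * (2 * Real.pi) * ‖w‖ *
        ‖mulLp ℓ a (oneLp ℓ hm)‖) * this
  exact le_of_mul_le_mul_left h5 hcard

end Bound

/-! ### Mean values along scalar rotations -/

section Rotation

variable {m t d : ℕ} {ℓ : MvPolynomial (Fin d) ℂ}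

theorem theta_mem_closure {z : Fin d → ℂ} (hz : ‖z‖ ≤ 1) :
    theta m t d z ∈ closure (quotientDomain m t d) := by
  have h1 : Metric.ball (0 : Fin d → ℂ) 1 ⊆ polydisc d := fun w hw i =>
    (norm_le_pi_norm w i).trans_lt (by simpa using hw)
  have h2 : z ∈ closure (polydisc d) := by
    refine closure_mono h1 ?_
    rw [closure_ball _ one_ne_zero]
    simpa using hz
  exact image_closure_subset_closure_image (continuous_theta m t d) ⟨z, h2, rfl⟩

theorem norm_torusPt_le (x : UnitAddTorus (Fin d)) : ‖torusPt x‖ ≤ 1 :=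
  (pi_norm_le_iff_of_nonneg zero_le_one).2 fun i => (norm_torusPt x i).le

theorem diffContOnCl_extendFun_theta (a : algA m t d) (x : UnitAddTorus (Fin d)) :
    DiffContOnCl ℂ (fun c : ℂ => extendFun a (theta m t d (c • torusPt x)))
      (Metric.ball 0 1) := by
  have hθ : Differentiable ℂ fun c : ℂ => theta m t d (c • torusPt x) :=
    (differentiable_theta m t).comp (differentiable_id.smul_const (torusPt x))
  obtain ⟨f, hf, haf⟩ := a.2
  refine ⟨?_, ?_⟩
  · have hmem : ∀ c ∈ Metric.ball (0 : ℂ) 1, theta m t d (c • torusPt x) ∈ quotientDomain m t d :=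
      fun c hc => ⟨_, smul_mem_polydisc (norm_torusPt_le x) (by simpa using hc), rfl⟩
    refine (hf.comp hθ.differentiableOn hmem).congr fun c hc => ?_
    rw [extendFun_apply a (subset_closure (hmem c hc))]
    exact haf _ (hmem c hc)
  · rw [closure_ball _ one_ne_zero]
    refine (continuousOn_extendFun a).comp hθ.continuous.continuousOn fun c hc =>
      theta_mem_closure ?_
    rw [norm_smul]
    exact mul_le_one₀ (by simpa using hc) (norm_nonneg _) (norm_torusPt_le x)

theorem torusPt_add_const (x : UnitAddTorus (Fin d)) (y : UnitAddCircle) :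
    torusPt (x + fun _ => y) = (AddCircle.toCircle y : ℂ) • torusPt x := by
  ext i
  change (AddCircle.toCircle (x i + y) : ℂ) = _
  rw [AddCircle.toCircle_add, Circle.coe_mul, mul_comm]
  rfl

/-- The mean value property with respect to a rotation invariant weight. -/
theorem inner_mulLp_polyA (hm : 0 < m) (hhom : ∃ n, ℓ.IsHomogeneous n)
    {q : MvPolynomial (Fin d) ℂ}
    (hq : ∀ (c : ℂ) (z : Fin d → ℂ), ‖c‖ = 1 →
      ‖MvPolynomial.eval (theta m t d (c • z)) q‖ = ‖MvPolynomial.eval (theta m t d z) q‖)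
    (a : algA m t d) :
    inner ℂ (mulLp ℓ (polyA m t q) (oneLp ℓ hm))
      (mulLp ℓ (polyA m t q) (mulLp ℓ a (oneLp ℓ hm))) =
    extendFun a (theta m t d 0) * (‖mulLp ℓ (polyA m t q) (oneLp ℓ hm)‖ ^ 2 : ℝ) := by
  obtain ⟨n, hn⟩ := hhom
  -- The weight is constant along the orbits of scalar rotations, by homogeneity of `ℓ` and by `hq`;
  -- only `a ∘ θ` varies, and its mean over each orbit is its value at the origin.
  let v : UnitAddTorus (Fin d) → ℝ := fun x =>
    ‖MvPolynomial.eval (torusPt x) ℓ * MvPolynomial.eval (theta m t d (torusPt x)) q‖ ^ 2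
  have hv : Continuous v := ((continuous_eval_torusPt ℓ).mul
    ((MvPolynomial.continuous_eval q).comp (continuous_theta_torusPt m t))).norm.pow 2
  have hvr : ∀ x (y : UnitAddCircle), v (x + fun _ => y) = v x := fun x y => by
    simp only [v, torusPt_add_const, norm_mul, hq _ _ (Circle.norm_coe (AddCircle.toCircle y)),
      eval_smul_of_isHomogeneous hn, norm_pow, Circle.norm_coe, one_pow, one_mul]
  have hnorm : ‖mulLp ℓ (polyA m t q) (oneLp ℓ hm)‖ ^ 2 =
      (Nat.card (G m t d) : ℝ)⁻¹ * ∫ x, v x ∂haarTorus d := by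
    rw [norm_sq_mulLp_one]
    simp only [extendFun_polyA, v]
  have hinner : inner ℂ (mulLp ℓ (polyA m t q) (oneLp ℓ hm))
      (mulLp ℓ (polyA m t q) (mulLp ℓ a (oneLp ℓ hm))) = (Nat.card (G m t d) : ℂ)⁻¹ *
      ∫ x, (v x : ℂ) * extendFun a (theta m t d (torusPt x)) ∂haarTorus d := by
    rw [inner_mu_eq]
    congr 1
    refine integral_congr_ae ?_
    filter_upwards [ae_mul_eq_of_ae_eq_mu ℓ (coeFn_mulLp_one ℓ hm (polyA m t q)),
      ae_mul_eq_of_ae_eq_mu ℓ (coeFn_mulLp ℓ (polyA m t q) (mulLp ℓ a (oneLp ℓ hm))),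
      ae_mul_eq_of_ae_eq_mu ℓ (coeFn_mulLp_one ℓ hm a)] with x h1 h2 h3
    rw [h1, h2, extendFun_polyA, mul_left_comm _ _ (mulLp ℓ a (oneLp ℓ hm) _), h3]
    simp only [v]
    rw [Complex.ofReal_pow, ← Complex.conj_mul']
    ring
  have hcont : Continuous fun x : UnitAddTorus (Fin d) =>
      (v x : ℂ) * extendFun a (theta m t d (torusPt x)) :=
    (Complex.continuous_ofReal.comp hv).mul ((continuousOn_extendFun a).comp_continuous
      (continuous_theta_torusPt m t) fun x => theta_torusPt_mem m t x)
  rw [hinner, hnorm, integral_haarTorus_eq_of_rotation hcont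
    (b := fun x => (v x : ℂ) * extendFun a (theta m t d 0)) (c := fun y _ => y)
    (continuous_pi fun _ => continuous_id) (fun x => ⟨fun c => (v x : ℂ) *
      extendFun a (theta m t d (c • torusPt x)), ?_, fun y => ?_, ?_⟩)]
  · have hof : ∫ x, (v x : ℂ) ∂haarTorus d = ((∫ x, v x ∂haarTorus d : ℝ) : ℂ) := integral_ofReal
    rw [integral_mul_const, hof]
    push_cast
    ring
  · exact (diffContOnCl_const (c := (v x : ℂ))).smul (diffContOnCl_extendFun_theta a x)
  · rw [hvr, torusPt_add_const]
  · beta_reduce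
    rw [zero_smul]

theorem continuous_mulLp (a : algA m t d) : Continuous (mulLp ℓ a) :=
  (continuous_of_biadditive_of_norm_le (fun a F => mulLp ℓ a F) (mulLp_add ℓ) (add_mulLp ℓ)
    (norm_mulLp_le ℓ)).comp (continuous_const.prodMk continuous_id)

/-- For `F = a · 1` both quotients `⟪q, q F⟫ / ‖q‖²` are the value of `a` at `θ(0)`. The
cross-multiplied form needs no point value of `F`, and is a closed condition, so it extends from the
dense set of these `F`. -/
theorem inner_mulLp_polyA_mul_eq (hm : 0 < m) (hhom : ∃ n, ℓ.IsHomogeneous n)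
    {q q' : MvPolynomial (Fin d) ℂ}
    (hq : ∀ (c : ℂ) (z : Fin d → ℂ), ‖c‖ = 1 →
      ‖MvPolynomial.eval (theta m t d (c • z)) q‖ = ‖MvPolynomial.eval (theta m t d z) q‖)
    (hq' : ∀ (c : ℂ) (z : Fin d → ℂ), ‖c‖ = 1 →
      ‖MvPolynomial.eval (theta m t d (c • z)) q'‖ = ‖MvPolynomial.eval (theta m t d z) q'‖)
    {F : Lp ℂ 2 (mu m t ℓ)} (hF : F ∈ hardySubspace m t ℓ) :
    inner ℂ (mulLp ℓ (polyA m t q) (oneLp ℓ hm)) (mulLp ℓ (polyA m t q) F) *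
      (‖mulLp ℓ (polyA m t q') (oneLp ℓ hm)‖ ^ 2 : ℝ) =
    inner ℂ (mulLp ℓ (polyA m t q') (oneLp ℓ hm)) (mulLp ℓ (polyA m t q') F) *
      (‖mulLp ℓ (polyA m t q) (oneLp ℓ hm)‖ ^ 2 : ℝ) := by
  have hF' : F ∈ closure (Set.range fun a : algA m t d => mulLp ℓ a (oneLp ℓ hm)) :=
    closure_minimal (fun F hF => boundaryValues_le_closure ℓ hm hhom hF) isClosed_closure hF
  have hcl : IsClosed {F : Lp ℂ 2 (mu m t ℓ) |
      inner ℂ (mulLp ℓ (polyA m t q) (oneLp ℓ hm)) (mulLp ℓ (polyA m t q) F) *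
        (‖mulLp ℓ (polyA m t q') (oneLp ℓ hm)‖ ^ 2 : ℝ) =
      inner ℂ (mulLp ℓ (polyA m t q') (oneLp ℓ hm)) (mulLp ℓ (polyA m t q') F) *
        (‖mulLp ℓ (polyA m t q) (oneLp ℓ hm)‖ ^ 2 : ℝ)} :=
    isClosed_eq
      (((continuous_const (y := mulLp ℓ (polyA m t q) (oneLp ℓ hm))).inner
        (continuous_mulLp (polyA m t q))).mul continuous_const)
      (((continuous_const (y := mulLp ℓ (polyA m t q') (oneLp ℓ hm))).inner
        (continuous_mulLp (polyA m t q'))).mul continuous_const)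
  refine closure_minimal ?_ hcl hF'
  rintro _ ⟨a, rfl⟩
  change _ = _
  rw [inner_mulLp_polyA hm hhom hq, inner_mulLp_polyA hm hhom hq']
  ring

end Rotation

/-! ### Concentration of weights where the discriminant vanishes -/

section Peak

variable {m t d : ℕ} {ℓ : MvPolynomial (Fin d) ℂ}

/-- Weights concentrating where `L` tends to `-∞` make its averages tend to `-∞`. -/
theorem exists_mul_integral_lt {α : Type*} [MeasurableSpace α] {μ : Measure α} [IsFiniteMeasure μ]
    {S L : α → ℝ} {s₀ M : ℝ} (hs₀ : 0 < s₀) (hS : Measurable S) (hS0 : ∀ p, 0 ≤ S p)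
    (hM : 0 ≤ M) (hLM : ∀ᵐ p ∂μ, L p ≤ M) (hSs : ∀ᵐ p ∂μ, S p ≤ s₀) (hL : Integrable L μ)
    (hpeak : ∀ R : ℝ, ∃ s < s₀, ∀ᵐ p ∂μ, s < S p → L p ≤ -R)
    (hpos : ∀ s < s₀, 0 < μ {p | s < S p}) {K : ℝ} (hK : 0 ≤ K) :
    ∃ N : ℕ, K * ∫ p, S p ^ (2 * N) ∂μ < |∫ p, S p ^ (2 * N) * L p ∂μ| := by
  -- Above the level `s` one has `L ≤ -(K + 1)`; below it the weight is at most `s ^ (2 * N)`,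
  -- negligible against the mass above a second level `s' > s`. The maximum with `s₀ / 2` keeps `s`
  -- positive.
  obtain ⟨s₁, hs₁, h₁⟩ := hpeak (K + 1)
  set s := max s₁ (s₀ / 2) with hs
  have hss₀ : s < s₀ := max_lt hs₁ (by linarith)
  have hs0 : 0 < s := lt_of_lt_of_le (by linarith) (le_max_right _ _)
  obtain ⟨s', hss', hs's₀⟩ := exists_between hss₀
  have hs'0 : 0 < s' := hs0.trans hss'
  have hSb : ∀ N : ℕ, ∀ᵐ p ∂μ, ‖S p ^ (2 * N)‖ ≤ s₀ ^ (2 * N) := fun N => by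
    filter_upwards [hSs] with p hp
    rw [Real.norm_of_nonneg (pow_nonneg (hS0 p) _)]
    exact pow_le_pow_left₀ (hS0 p) hp _
  have hSi : ∀ N : ℕ, Integrable (fun p => S p ^ (2 * N)) μ := fun N =>
    Integrable.of_bound (hS.pow_const _).aestronglyMeasurable _ (hSb N)
  have hSLi : ∀ N : ℕ, Integrable (fun p => S p ^ (2 * N) * L p) μ := fun N =>
    hL.bdd_mul (hS.pow_const _).aestronglyMeasurable (hSb N)
  have hκ : 0 < μ.real {p | s' < S p} :=
    ENNReal.toReal_pos (hpos s' hs's₀).ne' (measure_ne_top _ _)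
  have hlow : ∀ N : ℕ, s' ^ (2 * N) * μ.real {p | s' < S p} ≤ ∫ p, S p ^ (2 * N) ∂μ := fun N => by
    have hms : MeasurableSet {p | s' < S p} := measurableSet_lt measurable_const hS
    calc s' ^ (2 * N) * μ.real {p | s' < S p}
        = ∫ p in {p | s' < S p}, s' ^ (2 * N) ∂μ := by
          rw [setIntegral_const, smul_eq_mul, mul_comm]
      _ ≤ ∫ p in {p | s' < S p}, S p ^ (2 * N) ∂μ :=
          setIntegral_mono_on (integrable_const _).integrableOn (hSi N).integrableOn hms
            fun p hp => pow_le_pow_left₀ hs'0.le (le_of_lt hp) _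
      _ ≤ _ := setIntegral_le_integral (hSi N) (ae_of_all _ fun p => pow_nonneg (hS0 p) _)
  have hup : ∀ N : ℕ, ∫ p, S p ^ (2 * N) * L p ∂μ ≤
      -(K + 1) * ∫ p, S p ^ (2 * N) ∂μ + (K + 1 + M) * s ^ (2 * N) * μ.real Set.univ := fun N => by
    have h2 : ∫ p, (-(K + 1) * S p ^ (2 * N) + (K + 1 + M) * s ^ (2 * N)) ∂μ =
        -(K + 1) * ∫ p, S p ^ (2 * N) ∂μ + (K + 1 + M) * s ^ (2 * N) * μ.real Set.univ := by
      rw [integral_add ((hSi N).const_mul _) (integrable_const _), integral_const_mul,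
        integral_const, smul_eq_mul, mul_comm (μ.real _)]
    rw [← h2]
    refine integral_mono_ae (hSLi N) (((hSi N).const_mul _).add (integrable_const _)) ?_
    filter_upwards [h₁, hLM] with p hp1 hp2
    have hnn : 0 ≤ S p ^ (2 * N) := pow_nonneg (hS0 p) _
    by_cases hsp : s < S p
    · have h3 := mul_le_mul_of_nonneg_left (hp1 ((le_max_left _ _).trans_lt hsp)) hnn
      have h4 : 0 ≤ (K + 1 + M) * s ^ (2 * N) := by positivity
      linarith
    · have h3 : S p ^ (2 * N) ≤ s ^ (2 * N) := pow_le_pow_left₀ (hS0 p) (not_lt.1 hsp) _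
      have h4 := mul_le_mul_of_nonneg_left hp2 hnn
      have h5 := mul_le_mul_of_nonneg_left h3 (show 0 ≤ K + 1 + M by positivity)
      linarith
  by_contra! hcon
  -- If all averages were at least `-K`, the surplus `1` in `K + 1` would bound the whole mass by a
  -- constant times `s ^ (2 * N)`, while it is at least a constant times `s' ^ (2 * N)`.
  have hle : ∀ N : ℕ, ((s' / s) ^ 2) ^ N ≤
      (K + 1 + M) * μ.real Set.univ / μ.real {p | s' < S p} := fun N => by
    have h1 := hcon N
    have h2 := neg_le_of_abs_le h1
    have h3 := hup N
    have h4 := hlow N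
    have h5 : 0 < s ^ (2 * N) := by positivity
    rw [← pow_mul, div_pow, div_le_div_iff₀ h5 hκ]
    linarith
  have h1 : 1 < (s' / s) ^ 2 := one_lt_pow₀ ((one_lt_div hs0).2 hss') two_ne_zero
  obtain ⟨N, hN⟩ := pow_unbounded_of_one_lt
    ((K + 1 + M) * μ.real Set.univ / μ.real {p | s' < S p}) h1
  exact absurd (hle N) (not_le.2 hN)

theorem theta_zero_eq_sum (hd : 1 < d) (z : Fin d → ℂ) :
    theta m t d z ⟨0, by omega⟩ = ∑ j, z j ^ m := by
  unfold theta
  rw [if_neg (by simp; omega)]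
  simp [MvPolynomial.esymm_one]

theorem norm_sum_pow_le (x : UnitAddTorus (Fin d)) : ‖∑ j, torusPt x j ^ m‖ ≤ d := by
  refine (norm_sum_le _ _).trans ?_
  simp [norm_torusPt]

/-- Equality in the triangle inequality for unit vectors forces any two of them to agree: the other
`d - 2` terms contribute at most `d - 2`, so the sum of the two has norm `2`. -/
theorem norm_sum_pow_lt {x : UnitAddTorus (Fin d)} {i j : Fin d} (hij : i ≠ j)
    (h : torusPt x i ^ m ≠ torusPt x j ^ m) : ‖∑ k, torusPt x k ^ m‖ < d := by
  refine lt_of_le_of_ne (norm_sum_pow_le x) fun heq => h ?_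
  have hn : ∀ k, ‖torusPt x k ^ m‖ = 1 := fun k => by rw [norm_pow, norm_torusPt, one_pow]
  refine eq_of_norm_eq_of_norm_add_eq (by rw [hn, hn]) (le_antisymm (norm_add_le _ _) ?_)
  have hj : j ∈ Finset.univ.erase i := Finset.mem_erase.2 ⟨hij.symm, Finset.mem_univ j⟩
  rw [← Finset.add_sum_erase _ _ (Finset.mem_univ i), ← Finset.add_sum_erase _ _ hj,
    ← add_assoc] at heq
  have h1 : ‖∑ k ∈ (Finset.univ.erase i).erase j, torusPt x k ^ m‖ ≤ (d : ℝ) - 2 := by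
    refine (norm_sum_le _ _).trans ?_
    simp only [hn, Finset.sum_const, nsmul_eq_mul, mul_one]
    have hc := Finset.card_erase_add_one hj
    have hc' := Finset.card_erase_add_one (Finset.mem_univ i)
    rw [Finset.card_univ, Fintype.card_fin] at hc'
    have : (((Finset.univ.erase i).erase j).card : ℝ) + 1 + 1 = d := by
      exact_mod_cast (by omega)
    linarith
  rw [hn, hn]
  have h2 := norm_add_le (torusPt x i ^ m + torusPt x j ^ m)
    (∑ k ∈ (Finset.univ.erase i).erase j, torusPt x k ^ m)
  rw [heq] at h2
  linarith

/-- On the compact set where the discriminant is at least `exp (-R)` the sum of powers attains its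
maximum, and there two of the powers differ, so the maximum is less than `d`. -/
theorem exists_bound_norm_sum_pow (hd : 1 < d) (R : ℝ) : ∃ s < (d : ℝ), ∀ x : UnitAddTorus (Fin d),
    s < ‖∑ k, torusPt x k ^ m‖ →
      ‖MvPolynomial.eval (torusPt x) (discPoly m d)‖ < Real.exp (-R) := by
  have hS : Continuous fun x : UnitAddTorus (Fin d) => ‖∑ k, torusPt x k ^ m‖ :=
    (continuous_finsetSum _ fun k _ => ((continuous_apply k).comp continuous_torusPt).pow m).norm
  have hcl : IsCompact {x : UnitAddTorus (Fin d) |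
      Real.exp (-R) ≤ ‖MvPolynomial.eval (torusPt x) (discPoly m d)‖} :=
    (isClosed_le continuous_const (continuous_eval_torusPt _).norm).isCompact
  rcases Set.eq_empty_or_nonempty {x : UnitAddTorus (Fin d) |
      Real.exp (-R) ≤ ‖MvPolynomial.eval (torusPt x) (discPoly m d)‖} with he | hne
  · refine ⟨0, by positivity, fun x _ => ?_⟩
    by_contra! h
    exact (he ▸ h : x ∈ (∅ : Set _))
  · obtain ⟨x₀, hx₀, hmax⟩ := hcl.exists_isMaxOn hne hS.continuousOn
    refine ⟨‖∑ k, torusPt x₀ k ^ m‖, ?_, fun x hx => ?_⟩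
    · refine norm_sum_pow_lt (i := ⟨0, by omega⟩) (j := ⟨1, hd⟩) (by simp) fun heq => ?_
      have h0 : MvPolynomial.eval (torusPt x₀) (discPoly m d) = 0 := by
        simp only [discPoly, map_prod, map_sub, map_pow, MvPolynomial.eval_X]
        refine Finset.prod_eq_zero (i := (⟨0, by omega⟩, ⟨1, hd⟩)) (by simp) ?_
        rw [heq, sub_self]
      have h1 : Real.exp (-R) ≤ ‖MvPolynomial.eval (torusPt x₀) (discPoly m d)‖ := hx₀
      rw [h0, norm_zero] at h1
      exact absurd h1 (not_le.2 (Real.exp_pos _))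
    · by_contra! h
      exact absurd hx (not_lt.2 (hmax h))

theorem infinite_of_mem_nhds_unitAddCircle {V : Set UnitAddCircle}
    (hV : V ∈ 𝓝 (0 : UnitAddCircle)) : V.Infinite := by
  have h1 : (fun y : ℝ => (y : UnitAddCircle)) ⁻¹' V ∈ 𝓝 (0 : ℝ) :=
    (AddCircle.continuous_mk' (p := (1 : ℝ))).continuousAt.preimage_mem_nhds (by simpa using hV)
  obtain ⟨ε, hε, hεV⟩ := Metric.mem_nhds_iff.1 h1
  have h2 : (Set.Ico (0 : ℝ) (min ε 1)).Infinite := Set.Ico_infinite (lt_min hε one_pos)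
  have h3 : Set.InjOn (fun y : ℝ => (y : UnitAddCircle)) (Set.Ico (0 : ℝ) (min ε 1)) := by
    intro y hy y' hy' h
    refine (AddCircle.coe_eq_coe_iff_of_mem_Ico (p := (1 : ℝ)) (a := 0) ?_ ?_).1 h
    · exact ⟨hy.1, by linarith [hy.2.trans_le (min_le_right ε 1)]⟩
    · exact ⟨hy'.1, by linarith [hy'.2.trans_le (min_le_right ε 1)]⟩
  refine (h2.image h3).mono ?_
  rintro _ ⟨y, hy, rfl⟩
  refine hεV ?_
  rw [mem_ball_zero_iff, Real.norm_of_nonneg hy.1]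
  exact hy.2.trans_le (min_le_left ε 1)

/-- A nonzero polynomial cannot vanish on a product of infinite sets, so `ℓ` is nonzero somewhere in
`U`, hence on a nonempty open subset, which Haar measure charges. -/
theorem weightedTorus_pos_of_mem_nhds (hℓ : ℓ ≠ 0) {U : Set (UnitAddTorus (Fin d))}
    (hU : IsOpen U) (h0 : (0 : UnitAddTorus (Fin d)) ∈ U) : 0 < weightedTorus ℓ U := by
  obtain ⟨x, hxU, hx⟩ : ∃ x ∈ U, MvPolynomial.eval (torusPt x) ℓ ≠ 0 := by
    by_contra! hcon
    refine hℓ ?_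
    have hmem : U ∈ Filter.pi fun _ : Fin d => 𝓝 (0 : UnitAddCircle) := by
      have := hU.mem_nhds h0
      rwa [nhds_pi] at this
    obtain ⟨I, -, V, hV, hVU⟩ := Filter.mem_pi.1 hmem
    refine MvPolynomial.funext_set
      (fun i => (fun y : UnitAddCircle => (AddCircle.toCircle y : ℂ)) '' V i) (fun i => ?_) ?_
    · refine (infinite_of_mem_nhds_unitAddCircle (hV i)).image
        (Function.Injective.injOn fun y y' h => ?_)
      exact AddCircle.injective_toCircle one_ne_zero (Circle.coe_injective h)
    · intro z hz
      choose y hy hyz using fun i => hz i trivial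
      have hz' : z = torusPt y := funext fun i => (hyz i).symm
      rw [map_zero, hz']
      exact hcon y (hVU fun i _ => hy i)
  rw [pos_iff_ne_zero, weightedTorus, Ne, withDensity_apply_eq_zero'
    (measurable_density ℓ).aemeasurable]
  have hopen : IsOpen ({x : UnitAddTorus (Fin d) |
      ‖MvPolynomial.eval (torusPt x) ℓ‖ₑ ^ 2 ≠ 0} ∩ U) := by
    refine IsOpen.inter ?_ hU
    have : {x : UnitAddTorus (Fin d) | ‖MvPolynomial.eval (torusPt x) ℓ‖ₑ ^ 2 ≠ 0} =
        {x | MvPolynomial.eval (torusPt x) ℓ ≠ 0} := by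
      ext x
      simp
    rw [this]
    exact isOpen_ne_fun (continuous_eval_torusPt ℓ) continuous_const
  exact (hopen.measure_pos (haarTorus d) ⟨x, by simpa using hx, hxU⟩).ne'

/-- At the torus point `(1, …, 1)` the first component of `θ` equals `d`, and a neighbourhood of
that point has positive measure. -/
theorem mu_pos_of_lt (hm : 0 < m) (hd : 1 < d) (hℓ : ℓ ≠ 0) {s : ℝ} (hs : s < d) :
    0 < mu m t ℓ {p | s < ‖p ⟨0, by omega⟩‖} := by
  have hopen : IsOpen {p : Fin d → ℂ | s < ‖p ⟨0, by omega⟩‖} :=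
    isOpen_lt continuous_const (continuous_apply _).norm
  have hG := finite_G (t := t) (d := d) hm
  rw [mu, Measure.smul_apply, smul_eq_mul, Measure.map_apply
    (continuous_theta_torusPt m t).measurable hopen.measurableSet]
  refine ENNReal.mul_pos (ENNReal.inv_ne_zero.2 (ENNReal.natCast_ne_top _)) (ne_of_gt ?_)
  refine weightedTorus_pos_of_mem_nhds hℓ (hopen.preimage (continuous_theta_torusPt m t)) ?_
  change s < ‖theta m t d (torusPt 0) ⟨0, by omega⟩‖
  rw [theta_zero_eq_sum hd]
  simpa [torusPt] using hs

theorem ae_mu_of_ae_haarTorus {P : (Fin d → ℂ) → Prop} (hP : MeasurableSet {p | P p})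
    (h : ∀ᵐ x ∂haarTorus d, P (theta m t d (torusPt x))) : ∀ᵐ p ∂mu m t ℓ, P p := by
  refine Measure.ae_smul_measure ?_ _
  rw [ae_map_iff (continuous_theta_torusPt m t).aemeasurable hP]
  exact (withDensity_absolutelyContinuous _ _).ae_le h

end Peak

/-! ### The symbol is not bounded modulo the Hardy module -/

section NoLift

variable {m t d : ℕ} {ℓ D : MvPolynomial (Fin d) ℂ}

theorem ae_extendFun_polyA (q : MvPolynomial (Fin d) ℂ) :
    ∀ᵐ p ∂mu m t ℓ, extendFun (polyA m t q) p = MvPolynomial.eval p q := by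
  filter_upwards [ae_mem_closure m t ℓ] with p hp
  exact extendFun_apply _ hp

theorem norm_sq_mulLp_polyA (hm : 0 < m) (i : Fin d) (N : ℕ) :
    ‖mulLp ℓ (polyA m t (MvPolynomial.X i ^ N)) (oneLp ℓ hm)‖ ^ 2 =
      ∫ p, ‖p i‖ ^ (2 * N) ∂mu m t ℓ := by
  rw [norm_sq_eq_integral]
  refine integral_congr_ae ?_
  filter_upwards [coeFn_mulLp_one ℓ hm (polyA m t (MvPolynomial.X i ^ N)),
    ae_extendFun_polyA (MvPolynomial.X i ^ N)] with p h1 h2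
  rw [h1, h2, map_pow, MvPolynomial.eval_X, norm_pow, ← pow_mul, mul_comm]

theorem inner_mulLp_polyA_logDisc (hm : 0 < m)
    (hD : ∀ z, MvPolynomial.eval z (discPoly m d) = MvPolynomial.eval (theta m t d z) D)
    (i : Fin d) (N : ℕ) :
    inner ℂ (mulLp ℓ (polyA m t (MvPolynomial.X i ^ N)) (oneLp ℓ hm))
      (mulLp ℓ (polyA m t (MvPolynomial.X i ^ N)) (logDisc ℓ hm hD)) =
    ((∫ p, ‖p i‖ ^ (2 * N) * Real.log ‖MvPolynomial.eval p D‖ ∂mu m t ℓ : ℝ) : ℂ) := by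
  have hof : ∫ p, ((‖p i‖ ^ (2 * N) * Real.log ‖MvPolynomial.eval p D‖ : ℝ) : ℂ) ∂mu m t ℓ =
      ((∫ p, ‖p i‖ ^ (2 * N) * Real.log ‖MvPolynomial.eval p D‖ ∂mu m t ℓ : ℝ) : ℂ) :=
    integral_ofReal
  rw [← hof, MeasureTheory.L2.inner_def]
  refine integral_congr_ae ?_
  filter_upwards [coeFn_mulLp_one ℓ hm (polyA m t (MvPolynomial.X i ^ N)),
    ae_extendFun_polyA (MvPolynomial.X i ^ N), coeFn_logDisc hm hD,
    coeFn_mulLp ℓ (polyA m t (MvPolynomial.X i ^ N)) (logDisc ℓ hm hD)] with p h1 h2 h3 h4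
  rw [h1, h4, h2, h3, RCLike.inner_apply, map_pow, MvPolynomial.eval_X, pow_mul, map_pow,
    Complex.ofReal_mul, Complex.ofReal_pow, Complex.ofReal_pow, ← Complex.conj_mul', mul_pow]
  ring

/-- No function whose multiplication operator is bounded on the Hardy space differs from `log |D|`
by a function of the Hardy space. -/
theorem sub_logDisc_notMem_hardySubspace (hm : 0 < m) (hd : 1 < d) (hℓ : ℓ ≠ 0)
    (hhom : ∃ n, ℓ.IsHomogeneous n)
    (hD : ∀ z, MvPolynomial.eval z (discPoly m d) = MvPolynomial.eval (theta m t d z) D)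
    {φ : Lp ℂ 2 (mu m t ℓ)} {c : ℝ}
    (hφ : ∀ a : algA m t d, ‖mulLp ℓ a φ‖ ≤ c * ‖mulLp ℓ a (oneLp ℓ hm)‖) :
    φ - logDisc ℓ hm hD ∉ hardySubspace m t ℓ := by
  intro hF
  have := isFiniteMeasure_mu (t := t) ℓ hm
  let i : Fin d := ⟨0, by omega⟩
  let A : ℕ → algA m t d := fun N => polyA m t (MvPolynomial.X i ^ N)
  have hrot : ∀ (N : ℕ) (c : ℂ) (z : Fin d → ℂ), ‖c‖ = 1 →
      ‖MvPolynomial.eval (theta m t d (c • z)) (MvPolynomial.X i ^ N)‖ =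
        ‖MvPolynomial.eval (theta m t d z) (MvPolynomial.X i ^ N)‖ := fun N c z hc => by
    simp only [map_pow, MvPolynomial.eval_X, i, theta_zero_eq_sum hd, Pi.smul_apply, smul_eq_mul,
      mul_pow, ← Finset.mul_sum, norm_mul, norm_pow, hc, one_pow, one_mul]
  have hintg : Integrable (fun p => Real.log ‖MvPolynomial.eval p D‖) (mu m t ℓ) := by
    have h := ((memLp_logDisc (ℓ := ℓ) hm hD).integrable (by norm_num)).re
    exact h
  obtain ⟨B, hB⟩ := isCompact_univ.exists_bound_of_continuousOn
    (continuous_eval_torusPt (discPoly m d)).continuousOn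
  have hB0 : 0 ≤ B := (norm_nonneg _).trans (hB 0 trivial)
  have hDne : ∀ᵐ p ∂mu m t ℓ, MvPolynomial.eval p D ≠ 0 := by
    refine ae_mu_of_ae_haarTorus
      (isOpen_ne_fun (MvPolynomial.continuous_eval D) continuous_const).measurableSet ?_
    filter_upwards [ae_forall_offDiag_ne_one hm] with x hx
    rw [← hD, ← norm_ne_zero_iff, norm_eval_discPoly, Finset.prod_ne_zero_iff]
    intro p hp
    rw [norm_ne_zero_iff, sub_ne_zero]
    exact (hx p hp).symm
  have hrange : ∀ᵐ p ∂mu m t ℓ, p ∈ Set.range fun x => theta m t d (torusPt x) :=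
    ae_mu_of_ae_haarTorus (isCompact_range (continuous_theta_torusPt m t)).isClosed.measurableSet
      (ae_of_all _ fun x => ⟨x, rfl⟩)
  -- `K` bounds every normalized average of `log |D|`: `|c|` accounts for `φ`, and the second term
  -- is the modulus of the quotient for `φ - log |D|`, which does not depend on `N` and is read off
  -- at `N = 0`.
  let K : ℝ := |c| + ‖inner ℂ (mulLp ℓ (A 0) (oneLp ℓ hm))
    (mulLp ℓ (A 0) (φ - logDisc ℓ hm hD))‖ / ‖mulLp ℓ (A 0) (oneLp ℓ hm)‖ ^ 2
  have hd0 : (0 : ℝ) < d := by positivity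
  have hpos : 0 < ‖mulLp ℓ (A 0) (oneLp ℓ hm)‖ ^ 2 := by
    rw [norm_sq_mulLp_polyA]
    simp only [mul_zero, pow_zero, integral_const, smul_eq_mul, mul_one]
    refine ENNReal.toReal_pos (ne_of_gt ?_) (measure_ne_top _ _)
    exact (mu_pos_of_lt hm hd hℓ hd0).trans_le (measure_mono (Set.subset_univ _))
  -- An upper bound `B` for the discriminant also bounds its logarithm, since `log x ≤ x`; the peak
  -- is at `‖p i‖ = d`.
  obtain ⟨N, hN⟩ := exists_mul_integral_lt (μ := mu m t ℓ) (S := fun p => ‖p i‖)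
    (L := fun p => Real.log ‖MvPolynomial.eval p D‖) (s₀ := d) (M := B) (K := K) hd0
    (continuous_apply i).norm.measurable (fun p => norm_nonneg _) hB0
    (by
      filter_upwards [hrange] with p hp
      obtain ⟨x, rfl⟩ := hp
      beta_reduce
      rw [← hD]
      exact (Real.log_le_self (norm_nonneg _)).trans (hB x trivial))
    (by
      filter_upwards [hrange] with p hp
      obtain ⟨x, rfl⟩ := hp
      simp only [i, theta_zero_eq_sum hd]
      exact norm_sum_pow_le x)
    hintg
    (fun R => by
      obtain ⟨s, hs, h⟩ := exists_bound_norm_sum_pow (m := m) hd R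
      refine ⟨s, hs, ?_⟩
      filter_upwards [hrange, hDne] with p hp hp0 hsp
      obtain ⟨x, rfl⟩ := hp
      simp only [i, theta_zero_eq_sum hd] at hsp
      beta_reduce at hp0 ⊢
      have h1 := h x hsp
      rw [hD] at h1
      rw [← Real.log_exp (-R)]
      exact Real.log_le_log (norm_pos_iff.2 hp0) h1.le)
    (fun s hs => mu_pos_of_lt hm hd hℓ hs) (by positivity)
  have h1 := inner_mulLp_polyA_mul_eq hm hhom (hrot N) (hrot 0) hF
  have h2 := inner_mulLp_polyA_logDisc (ℓ := ℓ) hm hD i N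
  have h3 := norm_sq_mulLp_polyA (t := t) (ℓ := ℓ) hm i N
  have h4 : mulLp ℓ (A N) φ =
      mulLp ℓ (A N) (φ - logDisc ℓ hm hD) + mulLp ℓ (A N) (logDisc ℓ hm hD) := by
    rw [← mulLp_add, sub_add_cancel]
  have h5 : inner ℂ (mulLp ℓ (A N) (oneLp ℓ hm)) (mulLp ℓ (A N) (logDisc ℓ hm hD)) =
      inner ℂ (mulLp ℓ (A N) (oneLp ℓ hm)) (mulLp ℓ (A N) φ) -
      inner ℂ (mulLp ℓ (A N) (oneLp ℓ hm)) (mulLp ℓ (A N) (φ - logDisc ℓ hm hD)) := by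
    rw [h4, inner_add_right, add_sub_cancel_left]
  have h6 : ‖inner ℂ (mulLp ℓ (A N) (oneLp ℓ hm)) (mulLp ℓ (A N) φ)‖ ≤
      |c| * ‖mulLp ℓ (A N) (oneLp ℓ hm)‖ ^ 2 := by
    refine (norm_inner_le_norm _ _).trans ?_
    have h7 := (hφ (A N)).trans (mul_le_mul_of_nonneg_right (le_abs_self c) (norm_nonneg _))
    have h8 := mul_le_mul_of_nonneg_left h7 (norm_nonneg (mulLp ℓ (A N) (oneLp ℓ hm)))
    linarith
  have h7 : ‖inner ℂ (mulLp ℓ (A N) (oneLp ℓ hm)) (mulLp ℓ (A N) (φ - logDisc ℓ hm hD))‖ =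
      ‖inner ℂ (mulLp ℓ (A 0) (oneLp ℓ hm)) (mulLp ℓ (A 0) (φ - logDisc ℓ hm hD))‖ /
        ‖mulLp ℓ (A 0) (oneLp ℓ hm)‖ ^ 2 * ‖mulLp ℓ (A N) (oneLp ℓ hm)‖ ^ 2 := by
    have h8 := congrArg norm h1
    rw [norm_mul, norm_mul, Complex.norm_real, Complex.norm_real,
      Real.norm_of_nonneg (sq_nonneg _), Real.norm_of_nonneg (sq_nonneg _)] at h8
    rw [div_mul_eq_mul_div, eq_div_iff hpos.ne']
    exact h8
  have h8 : ‖inner ℂ (mulLp ℓ (A N) (oneLp ℓ hm)) (mulLp ℓ (A N) (logDisc ℓ hm hD))‖ ≤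
      K * ‖mulLp ℓ (A N) (oneLp ℓ hm)‖ ^ 2 := by
    rw [h5, add_mul, ← h7]
    exact (norm_sub_le _ _).trans (add_le_add_left h6 _)
  rw [show A N = polyA m t (MvPolynomial.X i ^ N) from rfl, h2, Complex.norm_real, h3,
    Real.norm_eq_abs] at h8
  exact absurd hN (not_lt.2 h8)

end NoLift

/-- The Hardy module has a self-extension that does not split. -/
theorem exists_extension_hardyObj_not_splits {m t d : ℕ} (hm : 0 < m) (ht : 0 < t) (htm : t ∣ m)
    (hd : 1 < d) {ρ : G m t d →* ℂˣ} {ℓ : MvPolynomial (Fin d) ℂ}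
    (hℓ : IsSemiInvariantGenerator ρ ℓ) (C : Category) :
    ∃ E : Extension (hardyObj m t ℓ C) (hardyObj m t ℓ C), ¬ E.Splits := by
  obtain ⟨D, hD⟩ := (isSemiInvariant_discPoly (t := t) (d := d) hm).exists_eval_theta hm ht htm hd
  refine exists_extension_not_splits (L := ambient m t ℓ) (P := hardy m t ℓ)
    (ι := hardyInclusion m t ℓ) (e := oneHardy ℓ hm) (ψ := logDisc ℓ hm hD)
    (c := (Finset.univ : Finset (Fin d)).offDiag.card * (2 * Real.pi)) C
    (isContractive_ambient m t ℓ) (isContractive_hardy m t ℓ) (hardyObj m t ℓ C).2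
    (fun _ => rfl) (denseRange_smul_oneHardy ℓ hm hℓ.homogeneous) (by positivity) ?_ ?_
  · intro w hw a
    exact norm_inner_mulLp_logDisc_le hm ht htm hd hℓ hD (fun F hF => hw ⟨F, hF⟩) a
  · intro φ c hφ f hf
    refine sub_logDisc_notMem_hardySubspace hm hd hℓ.ne_zero hℓ.homogeneous hD (φ := φ) (c := c)
      hφ ?_
    have h : hardyInclusion m t ℓ f ∈ hardySubspace m t ℓ := f.2
    rw [hf] at h
    exact h

end QuotientHardy

theorem theorem6p1 (m t d : ℕ) (hm : 0 < m) (ht : 0 < t) (htm : t ∣ m) (hd : 1 < d)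
    (ρ : QuotientHardy.G m t d →* ℂˣ)
    (ℓ : MvPolynomial (Fin d) ℂ) (hℓ : QuotientHardy.IsSemiInvariantGenerator ρ ℓ) :
    (¬ QuotientHardy.IsProjective (QuotientHardy.hardyObj m t ℓ .all) ∧
      ¬ QuotientHardy.IsProjective (QuotientHardy.hardyObj m t ℓ .cramped)) ∧
    (∃ e : QuotientHardy.Ext (QuotientHardy.hardyObj m t ℓ .all)
      (QuotientHardy.hardyObj m t ℓ .all), e ≠ 0) ∧
    (∃ e : QuotientHardy.Ext (QuotientHardy.hardyObj m t ℓ .cramped)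
      (QuotientHardy.hardyObj m t ℓ .cramped), e ≠ 0) := by
  have h := QuotientHardy.exists_extension_hardyObj_not_splits hm ht htm hd hℓ
  obtain ⟨E, hE⟩ := h .all
  obtain ⟨E', hE'⟩ := h .cramped
  exact ⟨⟨fun hP => hE (hP _ E), fun hP => hE' (hP _ E')⟩,
    ⟨Quotient.mk _ E, fun h0 => hE (E.splits_of_mk_eq_zero h0)⟩,
    ⟨Quotient.mk _ E', fun h0 => hE' (E'.splits_of_mk_eq_zero h0)⟩⟩
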